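/- Let $M\ge 2$, $L\ge 1$, let $g_1,\dots,g_M$, $\mathbf s=(s_1,\dots,s_L)$, $\gamma$, $\beta$ be independent indeterminates, $\mathbb K=\mathbb Q[g_1,\dots,g_M]$, and put $$G(w)=1+\sum_{i=1}^M g_iw^i,\quad S(w)=\sum_{k=1}^L k s_k w^k,\quad X(z)=\frac{z}{\gamma G(S(z))},\quad \sigma(z)=G(S(z))-zS'(z)G'(S(z)).$$ Let $D_w=w\frac{d}{dw}$, $\Delta_\pm(w)=S(w)\pm\beta D_w$, $V_\pm(w)=G(\Delta_\pm(w))$. Define $LM\times LM$ matrices, with indices from $0$ to $LM-1$, by $$\sum_{i,j}\mathbf A_{ij}r^it^j=\big(rV_-(t)-tV_+(r)\big)\Big(\frac1{r-t}\Big),$$ $$\sum_{i,j}\tilde{\mathbf E}(x)_{ij}r^it^j=\big(\Delta_+(r)\,r\,V_-(t)-\Delta_-(t)\,t\,V_+(r)\big)\Big(\frac1{r-t}\Big)-\frac{1}{\gamma x}\,rt\,\frac{S(r)-S(t)}{r-t},$$ $$\mathbf E(x)=(\mathbf A^T)^{-1}\tilde{\mathbf E}(x)^T,\qquad \mathbf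 E'(x)=\mathbf A^{-1}\tilde{\mathbf E}(x).$$ Let $\rho_j=\gamma^j\prod_{i=1}^jG(i\beta)$ for $j\ge0$ and $\rho_{-j}=\gamma^{-j}\prod_{i=0}^{j-1}G(-i\beta)^{-1}$ for $j\ge1$. Let $h_j(\mathbf t)$ be given by $\exp\big(\sum_{i\ge1}t_i\zeta^i\big)=\sum_j h_j(\mathbf t)\zeta^j$. For $0\le k<LM$ let $$\Psi^+_k(x)=\gamma\sum_{j\ge0}\rho_{j+k-1}h_j(\beta^{-1}\mathbf s)x^{j+k},\qquad \Psi^-_k(x)=\sum_{j\ge0}\rho_{-j-k}^{-1}h_j(-\beta^{-1}\mathbf s)x^{j+k},$$ let $\vec\Psi^\pm=(\Psi^\pm_0,\dots,\Psi^\pm_{LM-1})^T$, and put $$\mathbf M_+(x)=\vec\Psi^+(x)\,\vec\Psi^-(x)^T\mathbf A^T,\qquad \mathbf M_-(x)=\vec\Psi^-(x)\,\vec\Psi^+(x)^T\mathbf A .$$ In an algebraic closure of the field of Laurent series in $z$ over $\operatorname{Frac}(\mathbb K[\mathbf s,\gamma])$, the equation $X(w)=X(z)$ has $LM$ distinct solutions;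 list them, in an arbitrary fixed order with $z$ first, as $z^{(0)}=z,z^{(1)},\dots,z^{(LM-1)}$. Let $\mathbf V(z)=\big((z^{(j)})^i\big)_{0\le i,j<LM}$ and $\mathbf F=\mathrm{diag}(1,0,\dots,0)$. **Theorem.** Let $(\mathbf N,\mathbf M)$ be either of the pairs $(\mathbf E,\mathbf M_+)$ and $(-\mathbf E',\mathbf M_-)$. (I) There is a unique $LM\times LM$ matrix $\mathbf M^{WKB}(z)$ with entries in $\mathbb K[\mathbf s][[z,\beta]]$ which is a rank-$1$ projector, solves $$\beta\,\frac{zG(S(z))}{\sigma(z)}\,\frac{d}{dz}\mathbf M^{WKB}(z)=\big[\mathbf N(X(z)),\mathbf M^{WKB}(z)\big],$$ and has leading term $\mathbf M^{WKB}(z)=\mathbf V(z)\mathbf F\mathbf V(z)^{-1}+O(\beta)$. For each $k\ge0$ all entries of $\mathbf M^{(k)}(z)=[\beta^k]\mathbf M^{WKB}(z)$ are rational functions of $z$, with poles only at ramification points (roots of $\sigma$) or at $z=\infty$. (II) For each $k\ge0$, $\mathbf M^{(k)}(z)=[\beta^k]\,\mathbf M(X(z))$ as formal power series in $z$. -/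

import Mathlib

namespace WKBAdjoint

noncomputable section

/-! ### Parameters, weight generating function, spectral curve -/

/-- Values, in a ring `k`, of the parameters: the coefficients `g₁, …, g_M` of the weight generating
function (`g i` is `g_{i+1}`), the flow parameters `s₁, …, s_L` (`s i` is `s_{i+1}`), and `γ`, `β`. -/
structure Params (k : Type*) (M L : ℕ) where
  g : Fin M → k
  s : Fin L → k
  γ : k
  β : k

/-- Image of the parameters under a ring homomorphism. -/
def Params.map {k k' : Type*} [CommRing k] [CommRing k'] {M L : ℕ} (f : k →+* k')
    (d : Params k M L) : Params k' M L where
  g i := f (d.g i)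
  s i := f (d.s i)
  γ := f d.γ
  β := f d.β

/-- The weight generating function `G(w) = 1 + g₁ w + ⋯ + g_M w^M`. -/
def weightG {k : Type*} [CommRing k] {M : ℕ} (g : Fin M → k) : Polynomial k :=
  1 + ∑ i : Fin M, Polynomial.C (g i) * Polynomial.X ^ (i.val + 1)

/-- The polynomial `S(w) = s₁ w + 2 s₂ w² + ⋯ + L s_L w^L`. -/
def polyS {k : Type*} [CommRing k] {L : ℕ} (s : Fin L → k) : Polynomial k :=
  ∑ i : Fin L, Polynomial.C (((i.val + 1 : ℕ) : k) * s i) * Polynomial.X ^ (i.val + 1)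

/-- The composite polynomial `G(S(w))`. -/
def polyGS {k : Type*} [CommRing k] {M L : ℕ} (g : Fin M → k) (s : Fin L → k) : Polynomial k :=
  (weightG g).comp (polyS s)

/-- The polynomial `σ(w) = G(S(w)) - w S'(w) G'(S(w))`, whose roots are the finite ramification
points of the spectral curve. -/
def polySigma {k : Type*} [CommRing k] {M L : ℕ} (g : Fin M → k) (s : Fin L → k) : Polynomial k :=
  polyGS g s - Polynomial.X * Polynomial.derivative (polyS s) *
    (Polynomial.derivative (weightG g)).comp (polyS s)

/-- `X(w) = w / (γ G(S(w)))`, at a point `w` of a field. -/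
def curveX {k : Type*} [Field k] {M L : ℕ} (d : Params k M L) (w : k) : k :=
  w / (d.γ * (polyGS d.g d.s).eval w)

/-- `X(z) = z / (γ G(S(z)))` as a power series in `z`. -/
def curveXSeries {k : Type*} [Field k] {M L : ℕ} (d : Params k M L) : PowerSeries k :=
  PowerSeries.X * (PowerSeries.C d.γ * (polyGS d.g d.s : PowerSeries k))⁻¹

/-! ### The adapted bases -/

/-- Complete symmetric functions `h_j(t)`: `exp (∑ tᵢ ζ^i) = ∑ h_j(t) ζ^j`, where `t i` is
`t_{i+1}` and the other flow parameters vanish. -/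
def completeSymm {k : Type*} [Field k] [Algebra ℚ k] {L : ℕ} (t : Fin L → k) (j : ℕ) : k :=
  PowerSeries.coeff j ((PowerSeries.exp k).subst
    (∑ i : Fin L, PowerSeries.C (t i) * PowerSeries.X ^ (i.val + 1) : PowerSeries k))

/-- `ρ_j = γ^j ∏_{i=1}^j G(iβ)` and `ρ_{-j} = γ^{-j} ∏_{i=0}^{j-1} G(-iβ)⁻¹`. -/
def rho {k : Type*} [Field k] {M L : ℕ} (d : Params k M L) : ℤ → k
  | Int.ofNat j => d.γ ^ j * ∏ i ∈ Finset.Icc 1 j, (weightG d.g).eval ((i : k) * d.β)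
  | Int.negSucc j => (d.γ ^ (j + 1))⁻¹ *
      ∏ i ∈ Finset.range (j + 1), ((weightG d.g).eval (-((i : k) * d.β)))⁻¹

/-- `Ψ⁺_m(x) = γ ∑_j ρ_{j+m-1} h_j(β⁻¹ s) x^{j+m}` for `m ≥ 0`, a power series in `x`. -/
def psiPlus {k : Type*} [Field k] [Algebra ℚ k] {M L : ℕ} (d : Params k M L) (m : ℕ) :
    PowerSeries k :=
  PowerSeries.C d.γ * (PowerSeries.X ^ m * PowerSeries.mk fun j : ℕ =>
    rho d ((j : ℤ) + m - 1) * completeSymm (fun i => d.β⁻¹ * d.s i) j)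

/-- `Ψ⁻_m(x) = ∑_j ρ_{-j-m}⁻¹ h_j(-β⁻¹ s) x^{j+m}` for `m ≥ 0`, a power series in `x`. -/
def psiMinus {k : Type*} [Field k] [Algebra ℚ k] {M L : ℕ} (d : Params k M L) (m : ℕ) :
    PowerSeries k :=
  PowerSeries.X ^ m * PowerSeries.mk fun j : ℕ =>
    (rho d (-(j : ℤ) - m))⁻¹ * completeSymm (fun i => -(d.β⁻¹ * d.s i)) j

/-! ### Operators in two variables `r`, `t`, and the matrices `A`, `E`, `E'`

The operators act on formal two-sided series `∑ f_{ij} r^i t^j`, stored as `f : ℤ → ℤ → k`. -/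

/-- Formal two-sided series in `r` and `t`: `f i j` is the coefficient of `r^i t^j`. -/
abbrev BiSeries (k : Type*) := ℤ → ℤ → k

/-- Multiplication by `r`. -/
def mulR (k : Type*) [CommRing k] : Module.End k (BiSeries k) where
  toFun f i j := f (i - 1) j
  map_add' _ _ := rfl
  map_smul' _ _ := rfl

/-- Multiplication by `t`. -/
def mulT (k : Type*) [CommRing k] : Module.End k (BiSeries k) where
  toFun f i j := f i (j - 1)
  map_add' _ _ := rfl
  map_smul' _ _ := rfl

/-- The Euler operator `r ∂/∂r`. -/
def eulerR (k : Type*) [CommRing k] : Module.End k (BiSeries k) where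
  toFun f i j := (i : k) * f i j
  map_add' f g := by
    funext i j
    simp [mul_add]
  map_smul' c f := by
    funext i j
    simp [mul_left_comm]

/-- The Euler operator `t ∂/∂t`. -/
def eulerT (k : Type*) [CommRing k] : Module.End k (BiSeries k) where
  toFun f i j := (j : k) * f i j
  map_add' f g := by
    funext i j
    simp [mul_add]
  map_smul' c f := by
    funext i j
    simp [mul_left_comm]

/-- `1/(r-t) = ∑_{j ≥ 0} r^{-j-1} t^j`. It is only used inside expressions which are polynomials in
`r` and `t`, so that the choice of the expansion is immaterial. -/
def invRSubT (k : Type*) [CommRing k] : BiSeries k :=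
  fun i j => if 0 ≤ j ∧ i = -j - 1 then 1 else 0

/-- `Δ₊(r) = S(r) + β r ∂/∂r`. -/
def deltaPlusR {k : Type*} [CommRing k] {M L : ℕ} (d : Params k M L) : Module.End k (BiSeries k) :=
  Polynomial.aeval (mulR k) (polyS d.s) + d.β • eulerR k

/-- `Δ₋(t) = S(t) - β t ∂/∂t`. -/
def deltaMinusT {k : Type*} [CommRing k] {M L : ℕ} (d : Params k M L) :
    Module.End k (BiSeries k) :=
  Polynomial.aeval (mulT k) (polyS d.s) - d.β • eulerT k

/-- `V₊(r) = G(Δ₊(r))`. -/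
def vPlusR {k : Type*} [CommRing k] {M L : ℕ} (d : Params k M L) : Module.End k (BiSeries k) :=
  Polynomial.aeval (deltaPlusR d) (weightG d.g)

/-- `V₋(t) = G(Δ₋(t))`. -/
def vMinusT {k : Type*} [CommRing k] {M L : ℕ} (d : Params k M L) : Module.End k (BiSeries k) :=
  Polynomial.aeval (deltaMinusT d) (weightG d.g)

/-- The matrix `A`: `∑ A_{ij} r^i t^j = (r V₋(t) - t V₊(r)) (1/(r-t))`. -/
def matA {k : Type*} [CommRing k] {M L : ℕ} (d : Params k M L) :
    Matrix (Fin (L * M)) (Fin (L * M)) k :=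
  Matrix.of fun i j => (mulR k * vMinusT d - mulT k * vPlusR d) (invRSubT k) (i.val : ℤ) (j.val : ℤ)

/-- The matrix `Ẽ(x)`: `∑ Ẽ(x)_{ij} r^i t^j =
(Δ₊(r) r V₋(t) - Δ₋(t) t V₊(r)) (1/(r-t)) - (γx)⁻¹ r t (S(r) - S(t))/(r-t)`. -/
def matEtilde {k : Type*} [Field k] {M L : ℕ} (d : Params k M L) (x : k) :
    Matrix (Fin (L * M)) (Fin (L * M)) k :=
  Matrix.of fun i j =>
    (deltaPlusR d * mulR k * vMinusT d - deltaMinusT d * mulT k * vPlusR d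
      - (d.γ * x)⁻¹ • (mulR k * mulT k *
        (Polynomial.aeval (mulR k) (polyS d.s) - Polynomial.aeval (mulT k) (polyS d.s))))
      (invRSubT k) (i.val : ℤ) (j.val : ℤ)

/-- `E(x) = (Aᵀ)⁻¹ Ẽ(x)ᵀ`. -/
def matE {k : Type*} [Field k] {M L : ℕ} (d : Params k M L) (x : k) :
    Matrix (Fin (L * M)) (Fin (L * M)) k :=
  (matA d).transpose⁻¹ * (matEtilde d x).transpose

/-- `E'(x) = A⁻¹ Ẽ(x)`. -/
def matE' {k : Type*} [Field k] {M L : ℕ} (d : Params k M L) (x : k) :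
    Matrix (Fin (L * M)) (Fin (L * M)) k :=
  (matA d)⁻¹ * matEtilde d x

/-- `M₊(x) = Ψ⁺(x) Ψ⁻(x)ᵀ Aᵀ`. -/
def matMPlus {k : Type*} [Field k] [Algebra ℚ k] {M L : ℕ} (d : Params k M L) :
    Matrix (Fin (L * M)) (Fin (L * M)) (PowerSeries k) :=
  Matrix.vecMulVec (fun i => psiPlus d i.val) (fun i => psiMinus d i.val) *
    ((matA d).map PowerSeries.C).transpose

/-- `M₋(x) = Ψ⁻(x) Ψ⁺(x)ᵀ A`. -/
def matMMinus {k : Type*} [Field k] [Algebra ℚ k] {M L : ℕ} (d : Params k M L) :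
    Matrix (Fin (L * M)) (Fin (L * M)) (PowerSeries k) :=
  Matrix.vecMulVec (fun i => psiMinus d i.val) (fun i => psiPlus d i.val) *
    (matA d).map PowerSeries.C

/-! ### Indeterminate parameters and the rings of formal series -/

/-- `𝕂[s]`, with `𝕂 = ℚ[g₁, …, g_M]` and `s = (s₁, …, s_L)`. -/
abbrev Ks (M L : ℕ) : Type := MvPolynomial (Fin L) (MvPolynomial (Fin M) ℚ)

/-- The field of fractions of `𝕂[s][γ]`. -/
abbrev Frac (M L : ℕ) : Type := FractionRing (Polynomial (Ks M L))

/-- The inclusion of `𝕂[s]` into the field of fractions of `𝕂[s][γ]`. -/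
def toFrac (M L : ℕ) : Ks M L →+* Frac M L :=
  (algebraMap (Polynomial (Ks M L)) (Frac M L)).comp Polynomial.C

/-- The coefficients `g₁, …, g_M` as elements of `𝕂[s]`. -/
def gVar (M L : ℕ) (i : Fin M) : Ks M L := MvPolynomial.C (MvPolynomial.X i)

/-- The flow parameters `s₁, …, s_L` as elements of `𝕂[s]`. -/
def sVar (M L : ℕ) (i : Fin L) : Ks M L := MvPolynomial.X i

/-- Laurent series in `β`. -/
abbrev BetaField (M L : ℕ) : Type := LaurentSeries (Frac M L)

/-- The parameters `g`, `s`, `γ`, `β` as independent indeterminates. -/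
def params (M L : ℕ) : Params (BetaField M L) M L where
  g i := HahnSeries.C (toFrac M L (gVar M L i))
  s i := HahnSeries.C (toFrac M L (sVar M L i))
  γ := HahnSeries.C (algebraMap (Polynomial (Ks M L)) (Frac M L) Polynomial.X)
  β := HahnSeries.single 1 1

/-- Double formal series `𝕂[s][[z, β]]`: power series in `z` whose coefficients are power series
in `β`. -/
abbrev ZBeta (M L : ℕ) : Type := PowerSeries (PowerSeries (Ks M L))

/-- Laurent series in `z` whose coefficients are Laurent series in `β`; a field containing both
`𝕂[s][[z, β]]` and the entries of `E(X(z))`. -/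
abbrev ZBetaField (M L : ℕ) : Type := LaurentSeries (BetaField M L)

/-- The inclusion of `𝕂[s][[z, β]]` into the field of Laurent series. -/
def toZBetaField (M L : ℕ) : ZBeta M L →+* ZBetaField M L :=
  (HahnSeries.ofPowerSeries ℤ (BetaField M L)).comp
    (PowerSeries.map ((HahnSeries.ofPowerSeries ℤ (Frac M L)).comp
      (PowerSeries.map (toFrac M L))))

/-- The parameters as elements of `ZBetaField`. -/
def paramsZ (M L : ℕ) : Params (ZBetaField M L) M L := (params M L).map HahnSeries.C

/-- The variable `z` in `ZBetaField`. -/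
def zVar (M L : ℕ) : ZBetaField M L := HahnSeries.single 1 1

/-- The coefficient `[β^n]` of a double series, a power series in `z` over `𝕂[s]`. -/
def betaCoeff {M L : ℕ} (n : ℕ) (f : ZBeta M L) : PowerSeries (Ks M L) :=
  PowerSeries.mk fun m => PowerSeries.coeff n (PowerSeries.coeff m f)

/-- The coefficient `[β^n]` of a power series in `z` over the Laurent series in `β`. -/
def betaCoeffLaurent {M L : ℕ} (n : ℕ) (f : PowerSeries (BetaField M L)) :
    PowerSeries (Frac M L) :=
  PowerSeries.mk fun m => (PowerSeries.coeff m f).coeff (n : ℤ)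

/-- `N(X(z))`, entry by entry, for a matrix `N(x)` of power series in `x`. -/
def atCurve {M L : ℕ} (N : Matrix (Fin (L * M)) (Fin (L * M)) (PowerSeries (BetaField M L))) :
    Matrix (Fin (L * M)) (Fin (L * M)) (PowerSeries (BetaField M L)) :=
  N.map fun f => f.subst (curveXSeries (params M L))

/-! ### The sheets over `x = X(z)` and the leading term -/

/-- An algebraic closure of the field of Laurent series in `z`. -/
abbrev SheetField (M L : ℕ) : Type := AlgebraicClosure (LaurentSeries (Frac M L))

/-- Inclusion of the field of coefficients in `SheetField`. -/
def fracToSheet (M L : ℕ) : Frac M L →+* SheetField M L :=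
  (algebraMap (LaurentSeries (Frac M L)) (SheetField M L)).comp HahnSeries.C

/-- Inclusion of `𝕂[s][[z]]` in `SheetField`. -/
def seriesToSheet (M L : ℕ) : PowerSeries (Ks M L) →+* SheetField M L :=
  (algebraMap (LaurentSeries (Frac M L)) (SheetField M L)).comp
    ((HahnSeries.ofPowerSeries ℤ (Frac M L)).comp (PowerSeries.map (toFrac M L)))

/-- The parameters `g`, `s`, `γ` in `SheetField` (the curve does not involve `β`, set to `0`). -/
def paramsSheet (M L : ℕ) : Params (SheetField M L) M L where
  g i := fracToSheet M L (toFrac M L (gVar M L i))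
  s i := fracToSheet M L (toFrac M L (sVar M L i))
  γ := fracToSheet M L (algebraMap (Polynomial (Ks M L)) (Frac M L) Polynomial.X)
  β := 0

/-- `ζ` lists the `LM` distinct solutions `z⁽⁰⁾ = z, z⁽¹⁾, …, z⁽ᴸᴹ⁻¹⁾` of `X(w) = X(z)`. -/
structure IsSheets {M L : ℕ} (ζ : Fin (L * M) → SheetField M L) : Prop where
  injective : Function.Injective ζ
  zero : ∀ i : Fin (L * M), i.val = 0 → ζ i = seriesToSheet M L PowerSeries.X
  curve : ∀ i : Fin (L * M), curveX (paramsSheet M L) (ζ i) =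
    curveX (paramsSheet M L) (seriesToSheet M L PowerSeries.X)

/-- The Vandermonde matrix `V(z)_{ij} = (z⁽ʲ⁾)^i`, with indices starting from `0`. -/
def matV {M L : ℕ} (ζ : Fin (L * M) → SheetField M L) :
    Matrix (Fin (L * M)) (Fin (L * M)) (SheetField M L) :=
  Matrix.of fun i j => ζ j ^ i.val

/-- `F = diag(1, 0, …, 0)`. -/
def matF (M L : ℕ) : Matrix (Fin (L * M)) (Fin (L * M)) (SheetField M L) :=
  Matrix.diagonal fun i => if i.val = 0 then 1 else 0

/-! ### The WKB matrix -/

/-- `W(z)`, with entries in `𝕂[s][[z, β]]`, is a rank one projector which solves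
`β (z G(S(z)) / σ(z)) dW/dz = [N, W]` and has leading term `V(z) F V(z)⁻¹`. -/
structure IsWKBSolution {M L : ℕ} (ζ : Fin (L * M) → SheetField M L)
    (N : Matrix (Fin (L * M)) (Fin (L * M)) (ZBetaField M L))
    (W : Matrix (Fin (L * M)) (Fin (L * M)) (ZBeta M L)) : Prop where
  idempotent : W * W = W
  rank_eq_one : W.rank = 1
  ode : ((paramsZ M L).β * (zVar M L * (polyGS (paramsZ M L).g (paramsZ M L).s).eval (zVar M L) /
        (polySigma (paramsZ M L).g (paramsZ M L).s).eval (zVar M L))) •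
      W.map (fun f => toZBetaField M L (PowerSeries.derivative (PowerSeries (Ks M L)) f)) =
    N * W.map (toZBetaField M L) - W.map (toZBetaField M L) * N
  leading : W.map (fun f => seriesToSheet M L (betaCoeff 0 f)) = matV ζ * matF M L * (matV ζ)⁻¹

/-- The power series `f` in `z` is a rational function of `z` whose poles are at roots of `σ` or at
`z = ∞`: it is a polynomial divided by a power of `σ`. -/
def RationalPolesAtRamification {M L : ℕ} (f : PowerSeries (Ks M L)) : Prop :=
  ∃ (n : ℕ) (P : Polynomial (Ks M L)),
    (polySigma (gVar M L) (sVar M L) : PowerSeries (Ks M L)) ^ n * f = P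

end

end WKBAdjoint

namespace WKBAdjoint

noncomputable section

/-! ### Polynomials in an operator -/

/-! Write c(z) = G(S(z)).

Origin of the equation. The linear map r^m ↦ Ψ⁺_m (`psiMap`) turns S(r) + β r d/dr into β x d/dx,
and multiplication by r into γ x G(β x d/dx). Applied to the operator identity `opB_invRSubT`, it
yields the linear system with matrix E(x) for Ψ⁺ (`psiPlus_system`). Exchanging r and t transposes A
and Ẽ and changes the sign of β, while Ψ⁻ is Ψ⁺ at -β. So Ψ⁻ solves the adjoint system, and the form
∑ A_ij Ψ⁺_i Ψ⁻_j is constant, equal to 1 (`christoffelDarboux`). Hence M₊ = Ψ⁺ (A Ψ⁻)ᵀ is a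
projector satisfying the commutator equation, and the pair (-E', M₋) is the pair (E, M₊) with β
replaced by -β.

Regularity in β. The functions Ψ involve β⁻¹, but M₊ only needs ratios and one product. In the
coordinate z, Ψ⁺_m / Ψ⁺_0 = T_u^m 1 with T_u = (z/c) G(D + u), where D is the image of β x d/dx and
u is the logarithmic D-derivative of Ψ⁺_0. The equation for Ψ⁺_0 becomes the Riccati equation u =
S(T_u) 1, a z-adic contraction with a unique solution over every commutative ring, in particular
over 𝕂[s][[β]] (`existsUnique_riccati`, `phi_eq`). The product Ψ⁺_0 Ψ⁻_0 is then determined by the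
Christoffel–Darboux identity. The resulting matrix `wkbMat` has entries in 𝕂[s][[z, β]] and equals
M₊(X(z)) (`matMPlus_subst`).

Rationality. With u = S + c v the denominator c cancels from T_u (`curveT_eq_tOp`), and the Riccati
equation linearised in v at β = 0 is multiplication by c - z S' G'(S) = σ. Each coefficient of v is
therefore obtained from the earlier ones by ring operations, z d/dz and division by σ
(`ricV_mem_bRing`).

Uniqueness. At β = 0 the connection is diagonalised by the Vandermonde matrix of the sheets, with
distinct eigenvalues S(z⁽ⁱ⁾). The lowest β-coefficient Z of a difference of two solutions commutes
with it, so it is diagonal in that basis. Idempotency gives F Z + Z F = Z there, which kills the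
diagonal (`SameFiber.eq_zero_of_commute`, `eq_of_isFlat`). -/

theorem commute_aeval {k A : Type*} [CommRing k] [Ring A] [Algebra k A] {a b : A}
    (h : Commute a b) (p : Polynomial k) : Commute a (Polynomial.aeval b p) := by
  induction p using Polynomial.induction_on' with
  | add p q hp hq => simpa using hp.add_right hq
  | monomial n c =>
    rw [Polynomial.aeval_monomial]
    exact (Algebra.commute_algebraMap_right c a).mul_right (h.pow_right n)

/-- Commutation allows one factor at a time to be replaced on the vector: a^(n+1) x = a^n b x = b
a^n x. It is applied to the delta series, on which operators in r and in t agree. -/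
theorem aeval_apply_eq_of_commute {k V : Type*} [CommRing k] [AddCommGroup V] [Module k V]
    {a b : Module.End k V} (h : Commute a b) {x : V} (hx : a x = b x) (p : Polynomial k) :
    Polynomial.aeval a p x = Polynomial.aeval b p x := by
  induction p using Polynomial.induction_on' with
  | add p q hp hq => simp [hp, hq]
  | monomial n c =>
    simp only [Polynomial.aeval_monomial, Module.End.mul_apply]
    congr 1
    induction n with
    | zero => simp
    | succ n ih =>
      rw [pow_succ, Module.End.mul_apply, hx, ← Module.End.mul_apply, (h.pow_left n).eq,
        Module.End.mul_apply, ih, ← Module.End.mul_apply, ← pow_succ']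

/-- All changes of variable and of base ring below pass through this transport of polynomials in an
operator. The submodule `U` is needed because some intertwinings, such as reading off a column in t,
hold only for series without negative powers of r. -/
theorem aeval_semiconj {k k' V V' : Type*} [CommRing k] [CommRing k'] [AddCommGroup V]
    [Module k V] [AddCommGroup V'] [Module k' V'] {f : k →+* k'} (φ : V →ₛₗ[f] V')
    (U : Submodule k V) {a : Module.End k V} {a' : Module.End k' V'}
    (h : ∀ x ∈ U, a x ∈ U ∧ φ (a x) = a' (φ x)) (p : Polynomial k) :
    ∀ x ∈ U, Polynomial.aeval a p x ∈ U ∧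
      φ (Polynomial.aeval a p x) = Polynomial.aeval a' (p.map f) (φ x) := by
  induction p using Polynomial.induction_on' with
  | add p q hp hq =>
    intro x hx
    simp only [map_add, Polynomial.map_add, LinearMap.add_apply]
    exact ⟨U.add_mem (hp x hx).1 (hq x hx).1, by rw [(hp x hx).2, (hq x hx).2]⟩
  | monomial n c =>
    intro x hx
    simp only [Polynomial.map_monomial, Polynomial.aeval_monomial, Module.End.mul_apply,
      Module.algebraMap_end_apply, map_smulₛₗ]
    suffices H : (a ^ n) x ∈ U ∧ φ ((a ^ n) x) = (a' ^ n) (φ x) from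
      ⟨U.smul_mem _ H.1, by rw [H.2]⟩
    induction n with
    | zero => simpa using hx
    | succ n ih =>
      simp only [pow_succ', Module.End.mul_apply]
      exact ⟨(h _ ih.1).1, by rw [(h _ ih.1).2, ih.2]⟩

theorem aeval_mem_filtration {k V : Type*} [CommRing k] [AddCommGroup V] [Module k V]
    (U : ℤ → Submodule k V) (hU : Monotone U) {a : Module.End k V} {c : ℕ}
    (h : ∀ n, ∀ x ∈ U n, a x ∈ U (n + c)) (p : Polynomial k) (n : ℤ) (x : V) (hx : x ∈ U n) :
    Polynomial.aeval a p x ∈ U (n + (p.natDegree * c : ℕ)) := by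
  have hpow : ∀ m : ℕ, (a ^ m) x ∈ U (n + (m * c : ℕ)) := by
    intro m
    induction m with
    | zero => simpa using hx
    | succ m ih =>
      rw [pow_succ', Module.End.mul_apply]
      have := h _ _ ih
      convert this using 2
      push_cast
      ring
  rw [Polynomial.aeval_eq_sum_range, LinearMap.sum_apply]
  refine Submodule.sum_mem _ fun m hm => ?_
  rw [LinearMap.smul_apply]
  refine Submodule.smul_mem _ _ (hU ?_ (hpow m))
  have : m * c ≤ p.natDegree * c :=
    Nat.mul_le_mul_right _ (Nat.lt_succ_iff.1 (Finset.mem_range.1 hm))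
  exact_mod_cast (by omega : n + ((m * c : ℕ) : ℤ) ≤ n + ((p.natDegree * c : ℕ) : ℤ))

/-! ### Operators on two-sided series -/

section BiSeries

variable {k : Type*} [CommRing k] {M L : ℕ}

theorem commute_mulR_mulT : Commute (mulR k) (mulT k) := rfl

theorem commute_mulR_eulerT : Commute (mulR k) (eulerT k) := rfl

theorem commute_eulerR_mulT : Commute (eulerR k) (mulT k) := rfl

theorem commute_eulerR_eulerT : Commute (eulerR k) (eulerT k) := by
  ext f i j
  simp [eulerR, eulerT, mul_left_comm]

theorem commute_mulR_deltaMinusT (d : Params k M L) : Commute (mulR k) (deltaMinusT d) :=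
  (commute_aeval commute_mulR_mulT _).sub_right (commute_mulR_eulerT.smul_right _)

theorem commute_deltaPlusR_mulT (d : Params k M L) : Commute (deltaPlusR d) (mulT k) :=
  ((commute_aeval commute_mulR_mulT.symm _).symm).add_left (commute_eulerR_mulT.smul_left _)

theorem commute_deltaPlusR_deltaMinusT (d : Params k M L) :
    Commute (deltaPlusR d) (deltaMinusT d) := by
  refine (commute_aeval (commute_deltaPlusR_mulT d) _).sub_right (Commute.smul_right ?_ _)
  exact ((commute_aeval commute_mulR_eulerT.symm _).symm).add_left
    (commute_eulerR_eulerT.smul_left _)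

theorem commute_mulR_vMinusT (d : Params k M L) : Commute (mulR k) (vMinusT d) :=
  commute_aeval (commute_mulR_deltaMinusT d) _

theorem commute_vPlusR_mulT (d : Params k M L) : Commute (vPlusR d) (mulT k) :=
  (commute_aeval (commute_deltaPlusR_mulT d).symm _).symm

theorem commute_deltaPlusR_vMinusT (d : Params k M L) : Commute (deltaPlusR d) (vMinusT d) :=
  commute_aeval (commute_deltaPlusR_deltaMinusT d) _

theorem commute_vPlusR_deltaMinusT (d : Params k M L) : Commute (vPlusR d) (deltaMinusT d) :=
  (commute_aeval (commute_deltaPlusR_deltaMinusT d).symm _).symm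

theorem commute_deltaPlusR_vPlusR (d : Params k M L) : Commute (deltaPlusR d) (vPlusR d) :=
  commute_aeval (Commute.refl _) _

theorem commute_deltaMinusT_vMinusT (d : Params k M L) : Commute (deltaMinusT d) (vMinusT d) :=
  commute_aeval (Commute.refl _) _

/-- The operator `r V₋(t) - t V₊(r)`. -/
def opA (d : Params k M L) : Module.End k (BiSeries k) := mulR k * vMinusT d - mulT k * vPlusR d

/-- The operator `Δ₊(r) r V₋(t) - Δ₋(t) t V₊(r)`. -/
def opB (d : Params k M L) : Module.End k (BiSeries k) :=
  deltaPlusR d * mulR k * vMinusT d - deltaMinusT d * mulT k * vPlusR d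

/-- The operator `S(r) - S(t)`. -/
def opS (d : Params k M L) : Module.End k (BiSeries k) :=
  Polynomial.aeval (mulR k) (polyS d.s) - Polynomial.aeval (mulT k) (polyS d.s)

/-- The series `t (S(r) - S(t)) / (r - t)`. -/
def serG (d : Params k M L) : BiSeries k := mulT k (opS d (invRSubT k))

/-- The matrix of coefficients of a two-sided series with indices `0 ≤ i, j < L M`. -/
def coeffMat (L M : ℕ) (f : BiSeries k) : Matrix (Fin (L * M)) (Fin (L * M)) k :=
  Matrix.of fun i j => f i.val j.val

theorem matA_eq (d : Params k M L) : matA d = coeffMat L M (opA d (invRSubT k)) := rfl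

/-- The part of `Ẽ(x)` which does not depend on `x`. -/
def matB (d : Params k M L) : Matrix (Fin (L * M)) (Fin (L * M)) k :=
  coeffMat L M (opB d (invRSubT k))

/-- The coefficient of `-1/(γ x)` in `Ẽ(x)`. -/
def matC (d : Params k M L) : Matrix (Fin (L * M)) (Fin (L * M)) k :=
  coeffMat L M (mulR k (serG d))

theorem matEtilde_eq {k : Type*} [Field k] (d : Params k M L) (x : k) :
    matEtilde d x = matB d - (d.γ * x)⁻¹ • matC d := rfl

/-- The β-terms add up to the Euler operator r ∂/∂r + t ∂/∂t, which kills t/(r - t), homogeneous of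
degree 0. -/
theorem deltaPlusR_sub_deltaMinusT_invRSubT (d : Params k M L) :
    (deltaPlusR d - deltaMinusT d) (mulT k (invRSubT k)) = serG d := by
  have h0 : (eulerR k + eulerT k) (mulT k (invRSubT k)) = 0 := by
    funext i j
    simp only [LinearMap.add_apply, eulerR, eulerT, mulT, invRSubT, LinearMap.coe_mk, AddHom.coe_mk,
      Pi.add_apply, Pi.zero_apply]
    split_ifs with h
    · have : i = -j := by omega
      subst this
      push_cast
      ring
    · simp
  have h1 : deltaPlusR d - deltaMinusT d = opS d + d.β • (eulerR k + eulerT k) := by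
    simp only [deltaPlusR, deltaMinusT, opS, smul_add]
    abel
  have h2 : Commute (opS d) (mulT k) :=
    ((commute_aeval commute_mulR_mulT.symm _).symm).sub_left
      ((commute_aeval (Commute.refl _) _).symm)
  rw [h1, LinearMap.add_apply, LinearMap.smul_apply, h0, smul_zero, add_zero, serG,
    ← Module.End.mul_apply, h2.eq, Module.End.mul_apply]

/-- Replacing Δ₋ by Δ₊ in the second term of Ẽ leaves the error (Δ₊ - Δ₋) t V₊, and V₊ commutes with
the other factors. Afterwards only operators in r act, so the identity can be read column by column
in t; this is the source of the differential system. -/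
theorem opB_invRSubT (d : Params k M L) :
    opB d (invRSubT k) = deltaPlusR d (opA d (invRSubT k)) + vPlusR d (serG d) := by
  have h : opB d = deltaPlusR d * opA d + vPlusR d * ((deltaPlusR d - deltaMinusT d) * mulT k) := by
    have h1 := (commute_vPlusR_mulT d).eq
    have h2 := (commute_vPlusR_deltaMinusT d).eq
    have h3 := (commute_deltaPlusR_vPlusR d).eq
    simp only [opB, opA, mul_sub, sub_mul, ← mul_assoc]
    rw [h2, ← h3, mul_assoc _ (mulT k), mul_assoc _ (mulT k), mul_assoc _ (vPlusR d),
      mul_assoc _ (vPlusR d), h1]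
    abel
  rw [h, LinearMap.add_apply, Module.End.mul_apply, Module.End.mul_apply, Module.End.mul_apply,
    deltaPlusR_sub_deltaMinusT_invRSubT]

/-! ### Independence of the expansion of `1/(r-t)` -/

/-- The formal delta series `∑_j r^{-j-1} t^j`. -/
def deltaSeries (k : Type*) [CommRing k] : BiSeries k := fun i j => if i = -j - 1 then 1 else 0

theorem mulR_deltaSeries : mulR k (deltaSeries k) = mulT k (deltaSeries k) := by
  funext i j
  simp only [mulR, mulT, deltaSeries, LinearMap.coe_mk, AddHom.coe_mk]
  congr 1
  exact propext ⟨fun h => by omega, fun h => by omega⟩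

theorem opS_deltaSeries (d : Params k M L) : opS d (deltaSeries k) = 0 := by
  rw [opS, LinearMap.sub_apply, aeval_apply_eq_of_commute commute_mulR_mulT mulR_deltaSeries,
    sub_self]

/-- The factor r makes the delta series homogeneous of degree 0, so that r ∂/∂r and -t ∂/∂t agree on
it. -/
theorem deltaPlusR_deltaSeries (d : Params k M L) :
    deltaPlusR d (mulR k (deltaSeries k)) = deltaMinusT d (mulR k (deltaSeries k)) := by
  have h : Polynomial.aeval (mulR k) (polyS d.s) (mulR k (deltaSeries k)) =
      Polynomial.aeval (mulT k) (polyS d.s) (mulR k (deltaSeries k)) := by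
    refine aeval_apply_eq_of_commute commute_mulR_mulT ?_ _
    rw [mulR_deltaSeries, ← Module.End.mul_apply, commute_mulR_mulT.eq, Module.End.mul_apply,
      mulR_deltaSeries]
  have h' : eulerR k (mulR k (deltaSeries k)) = -eulerT k (mulR k (deltaSeries k)) := by
    funext i j
    simp only [eulerR, eulerT, mulR, deltaSeries, LinearMap.coe_mk, AddHom.coe_mk, Pi.neg_apply]
    split_ifs with h
    · have : i = -j := by omega
      subst this
      push_cast
      ring
    · simp
  rw [deltaPlusR, deltaMinusT, LinearMap.add_apply, LinearMap.sub_apply, LinearMap.smul_apply,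
    LinearMap.smul_apply, h, h', smul_neg, sub_eq_add_neg]

theorem vPlusR_deltaSeries (d : Params k M L) :
    vPlusR d (mulR k (deltaSeries k)) = vMinusT d (mulR k (deltaSeries k)) :=
  aeval_apply_eq_of_commute (commute_deltaPlusR_deltaMinusT d) (deltaPlusR_deltaSeries d) _

theorem opA_deltaSeries (d : Params k M L) : opA d (deltaSeries k) = 0 := by
  rw [opA, (commute_mulR_vMinusT d).eq, ← (commute_vPlusR_mulT d).eq, LinearMap.sub_apply,
    Module.End.mul_apply, Module.End.mul_apply, ← mulR_deltaSeries, vPlusR_deltaSeries, sub_self]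

theorem opB_deltaSeries (d : Params k M L) : opB d (deltaSeries k) = 0 := by
  rw [opB, mul_assoc, mul_assoc, (commute_mulR_vMinusT d).eq, ← (commute_vPlusR_mulT d).eq,
    ← mul_assoc, ← mul_assoc, (commute_deltaPlusR_vMinusT d).eq,
    ← (commute_vPlusR_deltaMinusT d).eq, LinearMap.sub_apply]
  simp only [Module.End.mul_apply]
  rw [← mulR_deltaSeries, deltaPlusR_deltaSeries]
  have h := LinearMap.congr_fun (commute_vPlusR_deltaMinusT d).eq (mulR k (deltaSeries k))
  have h' := LinearMap.congr_fun (commute_deltaMinusT_vMinusT d).eq (mulR k (deltaSeries k))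
  simp only [Module.End.mul_apply] at h h'
  rw [h, vPlusR_deltaSeries, h', sub_self]

/-- The expansion of `1/(r-t)` in the region `|r| < |t|`. -/
def invRSubT' (k : Type*) [CommRing k] : BiSeries k :=
  fun i j => if 0 ≤ i ∧ j = -i - 1 then -1 else 0

theorem invRSubT'_eq : invRSubT' k = invRSubT k - deltaSeries k := by
  funext i j
  simp only [invRSubT', invRSubT, deltaSeries, Pi.sub_apply]
  split_ifs <;> first | (exfalso; omega) | simp

theorem opA_invRSubT' (d : Params k M L) : opA d (invRSubT' k) = opA d (invRSubT k) := by
  rw [invRSubT'_eq, map_sub, opA_deltaSeries, sub_zero]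

theorem opB_invRSubT' (d : Params k M L) : opB d (invRSubT' k) = opB d (invRSubT k) := by
  rw [invRSubT'_eq, map_sub, opB_deltaSeries, sub_zero]

theorem opS_invRSubT' (d : Params k M L) : opS d (invRSubT' k) = opS d (invRSubT k) := by
  rw [invRSubT'_eq, map_sub, opS_deltaSeries, sub_zero]

/-! ### Exchange of `r` and `t` -/

/-- The parameters with `β` replaced by `-β`. -/
def Params.neg {k : Type*} [CommRing k] (d : Params k M L) : Params k M L := { d with β := -d.β }

/-- Exchange of `r` and `t`. -/
def swapRT (k : Type*) [CommRing k] : BiSeries k →ₗ[k] BiSeries k where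
  toFun f i j := f j i
  map_add' _ _ := rfl
  map_smul' _ _ := rfl

theorem swapRT_aeval {a b : Module.End k (BiSeries k)}
    (h : ∀ f, swapRT k (a f) = b (swapRT k f)) (p : Polynomial k) (f : BiSeries k) :
    swapRT k (Polynomial.aeval a p f) = Polynomial.aeval b p (swapRT k f) := by
  have := (aeval_semiconj (swapRT k) ⊤ (a := a) (a' := b) (fun x _ => ⟨trivial, h x⟩) p f
    trivial).2
  simpa using this

theorem swapRT_mulR (f : BiSeries k) : swapRT k (mulR k f) = mulT k (swapRT k f) := rfl

theorem swapRT_mulT (f : BiSeries k) : swapRT k (mulT k f) = mulR k (swapRT k f) := rfl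

theorem swapRT_deltaPlusR (d : Params k M L) (f : BiSeries k) :
    swapRT k (deltaPlusR d f) = deltaMinusT d.neg (swapRT k f) := by
  rw [deltaPlusR, deltaMinusT, LinearMap.add_apply, map_add, swapRT_aeval swapRT_mulR,
    LinearMap.sub_apply, sub_eq_add_neg]
  congr 1
  funext i j
  simp [Params.neg, swapRT, eulerR, eulerT]

theorem swapRT_deltaMinusT (d : Params k M L) (f : BiSeries k) :
    swapRT k (deltaMinusT d f) = deltaPlusR d.neg (swapRT k f) := by
  rw [deltaPlusR, deltaMinusT, LinearMap.sub_apply, map_sub, swapRT_aeval swapRT_mulT,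
    LinearMap.add_apply, sub_eq_add_neg]
  congr 1
  funext i j
  simp [Params.neg, swapRT, eulerR, eulerT]

theorem swapRT_vPlusR (d : Params k M L) (f : BiSeries k) :
    swapRT k (vPlusR d f) = vMinusT d.neg (swapRT k f) :=
  swapRT_aeval (swapRT_deltaPlusR d) _ f

theorem swapRT_vMinusT (d : Params k M L) (f : BiSeries k) :
    swapRT k (vMinusT d f) = vPlusR d.neg (swapRT k f) :=
  swapRT_aeval (swapRT_deltaMinusT d) _ f

theorem swapRT_invRSubT : swapRT k (invRSubT k) = -invRSubT' k := by
  funext i j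
  simp only [swapRT, invRSubT, invRSubT', LinearMap.coe_mk, AddHom.coe_mk, Pi.neg_apply]
  split_ifs <;> simp

theorem swapRT_opA (d : Params k M L) (f : BiSeries k) :
    swapRT k (opA d f) = -opA d.neg (swapRT k f) := by
  simp only [opA, LinearMap.sub_apply, Module.End.mul_apply, map_sub, swapRT_mulR, swapRT_mulT,
    swapRT_vPlusR, swapRT_vMinusT]
  abel

theorem swapRT_opB (d : Params k M L) (f : BiSeries k) :
    swapRT k (opB d f) = -opB d.neg (swapRT k f) := by
  simp only [opB, LinearMap.sub_apply, Module.End.mul_apply, map_sub, swapRT_mulR, swapRT_mulT,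
    swapRT_vPlusR, swapRT_vMinusT, swapRT_deltaPlusR, swapRT_deltaMinusT]
  abel

theorem swapRT_opS (d : Params k M L) (f : BiSeries k) :
    swapRT k (opS d f) = -opS d.neg (swapRT k f) := by
  simp only [opS, LinearMap.sub_apply, map_sub, swapRT_aeval swapRT_mulR,
    swapRT_aeval swapRT_mulT, Params.neg]
  abel

theorem swapRT_opA_invRSubT (d : Params k M L) :
    swapRT k (opA d (invRSubT k)) = opA d.neg (invRSubT k) := by
  rw [swapRT_opA, swapRT_invRSubT, map_neg, neg_neg, opA_invRSubT']

theorem swapRT_opB_invRSubT (d : Params k M L) :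
    swapRT k (opB d (invRSubT k)) = opB d.neg (invRSubT k) := by
  rw [swapRT_opB, swapRT_invRSubT, map_neg, neg_neg, opB_invRSubT']

theorem swapRT_mulR_serG (d : Params k M L) :
    swapRT k (mulR k (serG d)) = mulR k (serG d.neg) := by
  rw [serG, swapRT_mulR, swapRT_mulT, swapRT_opS, swapRT_invRSubT, map_neg (opS d.neg), neg_neg,
    opS_invRSubT', serG]
  rfl

/-- The exchange of r and t turns Δ₊ into Δ₋ at -β. The sign from the operator cancels the sign from
1/(r - t), and the change of expansion is harmless. Together with its analogues for `matB` and
`matC`, this makes every statement about Ψ⁻ or E' an instance of one about Ψ⁺ or E. -/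
theorem matA_neg (d : Params k M L) : matA d.neg = (matA d).transpose := by
  rw [matA_eq, matA_eq, ← swapRT_opA_invRSubT]
  rfl

theorem matB_neg (d : Params k M L) : matB d.neg = (matB d).transpose := by
  rw [matB, matB, ← swapRT_opB_invRSubT]
  rfl

theorem matC_neg (d : Params k M L) : matC d.neg = (matC d).transpose := by
  rw [matC, matC, ← swapRT_mulR_serG]
  rfl

/-! ### Supports -/

theorem natDegree_polyS_le (s : Fin L → k) : (polyS s).natDegree ≤ L :=
  Polynomial.natDegree_sum_le_of_forall_le _ _ fun i _ =>
    (Polynomial.natDegree_C_mul_X_pow_le _ _).trans i.2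

theorem natDegree_weightG_le (g : Fin M → k) : (weightG g).natDegree ≤ M :=
  Polynomial.natDegree_add_le_of_degree_le (by simp)
    (Polynomial.natDegree_sum_le_of_forall_le _ _ fun i _ =>
      (Polynomial.natDegree_C_mul_X_pow_le _ _).trans i.2)

theorem natDegree_polyGS_le (g : Fin M → k) (s : Fin L → k) :
    (polyGS g s).natDegree ≤ L * M := by
  rw [mul_comm]
  exact Polynomial.natDegree_comp_le.trans
    (Nat.mul_le_mul (natDegree_weightG_le g) (natDegree_polyS_le s))

/-- The series whose exponents of `r` are at most `n`. -/
def rLe (k : Type*) [CommRing k] (n : ℤ) : Submodule k (BiSeries k) where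
  carrier := {f | ∀ i j, n < i → f i j = 0}
  add_mem' {f g} hf hg i j h := by simp [hf i j h, hg i j h]
  zero_mem' _ _ _ := rfl
  smul_mem' c f hf i j h := by simp [hf i j h]

theorem rLe_mono : Monotone (rLe k) := fun _ _ h _ hf i j hi => hf i j (h.trans_lt hi)

/-- The series whose exponents of `r` are nonnegative. -/
def rGe (k : Type*) [CommRing k] : Submodule k (BiSeries k) where
  carrier := {f | ∀ i j, i < 0 → f i j = 0}
  add_mem' {f g} hf hg i j h := by simp [hf i j h, hg i j h]
  zero_mem' _ _ _ := rfl
  smul_mem' c f hf i j h := by simp [hf i j h]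

theorem aeval_mem {V : Type*} [AddCommGroup V] [Module k V] {U : Submodule k V}
    {a : Module.End k V} (h : ∀ x ∈ U, a x ∈ U) (p : Polynomial k) {x : V} (hx : x ∈ U) :
    Polynomial.aeval a p x ∈ U := by
  have := aeval_mem_filtration (fun _ => U) (fun _ _ _ => le_rfl) (c := 0) (fun _ x hx => h x hx)
    p 0 x hx
  exact this

theorem mulR_mem_rLe {n : ℤ} {f : BiSeries k} (hf : f ∈ rLe k n) : mulR k f ∈ rLe k (n + 1) :=
  fun i j hi => hf (i - 1) j (by omega)

theorem mulT_mem_rLe {n : ℤ} {f : BiSeries k} (hf : f ∈ rLe k n) : mulT k f ∈ rLe k n :=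
  fun i j hi => hf i (j - 1) hi

theorem eulerR_mem_rLe {n : ℤ} {f : BiSeries k} (hf : f ∈ rLe k n) : eulerR k f ∈ rLe k n :=
  fun i j hi => by simp [eulerR, hf i j hi]

theorem eulerT_mem_rLe {n : ℤ} {f : BiSeries k} (hf : f ∈ rLe k n) : eulerT k f ∈ rLe k n :=
  fun i j hi => by simp [eulerT, hf i j hi]

theorem aeval_mulR_mem_rLe (d : Params k M L) {n : ℤ} {f : BiSeries k} (hf : f ∈ rLe k n) :
    Polynomial.aeval (mulR k) (polyS d.s) f ∈ rLe k (n + L) := by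
  have := aeval_mem_filtration (rLe k) rLe_mono (c := 1) (fun _ _ h => mulR_mem_rLe h)
    (polyS d.s) n f hf
  refine rLe_mono ?_ this
  have := natDegree_polyS_le d.s
  push_cast
  omega

theorem deltaPlusR_mem_rLe (d : Params k M L) {n : ℤ} {f : BiSeries k} (hf : f ∈ rLe k n) :
    deltaPlusR d f ∈ rLe k (n + L) :=
  (rLe k _).add_mem (aeval_mulR_mem_rLe d hf)
    ((rLe k _).smul_mem _ (rLe_mono (by omega) (eulerR_mem_rLe hf)))

theorem vPlusR_mem_rLe (d : Params k M L) {n : ℤ} {f : BiSeries k} (hf : f ∈ rLe k n) :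
    vPlusR d f ∈ rLe k (n + (L * M : ℕ)) := by
  have := aeval_mem_filtration (rLe k) rLe_mono (c := L) (fun _ _ h => deltaPlusR_mem_rLe d h)
    (weightG d.g) n f hf
  refine rLe_mono ?_ this
  have := Nat.mul_le_mul_right L (natDegree_weightG_le d.g)
  rw [mul_comm L M]
  exact_mod_cast (by omega :
    n + (((weightG d.g).natDegree * L : ℕ) : ℤ) ≤ n + ((M * L : ℕ) : ℤ))

theorem aeval_mulT_mem_rLe (p : Polynomial k) {n : ℤ} {f : BiSeries k} (hf : f ∈ rLe k n) :
    Polynomial.aeval (mulT k) p f ∈ rLe k n :=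
  aeval_mem (fun _ h => mulT_mem_rLe h) p hf

theorem deltaMinusT_mem_rLe (d : Params k M L) {n : ℤ} {f : BiSeries k} (hf : f ∈ rLe k n) :
    deltaMinusT d f ∈ rLe k n :=
  (rLe k _).sub_mem (aeval_mulT_mem_rLe _ hf) ((rLe k _).smul_mem _ (eulerT_mem_rLe hf))

theorem vMinusT_mem_rLe (d : Params k M L) {n : ℤ} {f : BiSeries k} (hf : f ∈ rLe k n) :
    vMinusT d f ∈ rLe k n :=
  aeval_mem (fun _ h => deltaMinusT_mem_rLe d h) _ hf

theorem mulR_mem_rGe {f : BiSeries k} (hf : f ∈ rGe k) : mulR k f ∈ rGe k :=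
  fun i j hi => hf (i - 1) j (by omega)

theorem mulT_mem_rGe {f : BiSeries k} (hf : f ∈ rGe k) : mulT k f ∈ rGe k :=
  fun i j hi => hf i (j - 1) hi

theorem deltaPlusR_mem_rGe (d : Params k M L) {f : BiSeries k} (hf : f ∈ rGe k) :
    deltaPlusR d f ∈ rGe k :=
  (rGe k).add_mem (aeval_mem (fun _ h => mulR_mem_rGe h) _ hf)
    ((rGe k).smul_mem _ fun i j hi => by simp [eulerR, hf i j hi])

theorem vPlusR_mem_rGe (d : Params k M L) {f : BiSeries k} (hf : f ∈ rGe k) :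
    vPlusR d f ∈ rGe k :=
  aeval_mem (fun _ h => deltaPlusR_mem_rGe d h) _ hf

theorem deltaMinusT_mem_rGe (d : Params k M L) {f : BiSeries k} (hf : f ∈ rGe k) :
    deltaMinusT d f ∈ rGe k :=
  (rGe k).sub_mem (aeval_mem (fun _ h => mulT_mem_rGe h) _ hf)
    ((rGe k).smul_mem _ fun i j hi => by simp [eulerT, hf i j hi])

theorem vMinusT_mem_rGe (d : Params k M L) {f : BiSeries k} (hf : f ∈ rGe k) :
    vMinusT d f ∈ rGe k :=
  aeval_mem (fun _ h => deltaMinusT_mem_rGe d h) _ hf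

theorem invRSubT_mem_rLe : invRSubT k ∈ rLe k (-1) := fun i j hi => by
  simp only [invRSubT]
  rw [if_neg (by omega)]

theorem invRSubT'_mem_rGe : invRSubT' k ∈ rGe k := fun i j hi => by
  simp only [invRSubT']
  rw [if_neg (by omega)]

/-- One expansion of 1/(r - t) bounds the exponents of r from below, the other from above. As the
result does not depend on the expansion, both bounds hold at once. -/
theorem opA_mem_rGe (d : Params k M L) : opA d (invRSubT k) ∈ rGe k := by
  rw [← opA_invRSubT']
  exact (rGe k).sub_mem (mulR_mem_rGe (vMinusT_mem_rGe d invRSubT'_mem_rGe))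
    (mulT_mem_rGe (vPlusR_mem_rGe d invRSubT'_mem_rGe))

theorem serG_mem_rGe (d : Params k M L) : serG d ∈ rGe k := by
  rw [serG, ← opS_invRSubT']
  exact mulT_mem_rGe ((rGe k).sub_mem (aeval_mem (fun _ h => mulR_mem_rGe h) _ invRSubT'_mem_rGe)
    (aeval_mem (fun _ h => mulT_mem_rGe h) _ invRSubT'_mem_rGe))

theorem opA_mem_rLe (d : Params k M L) (hLM : 0 < L * M) :
    opA d (invRSubT k) ∈ rLe k ((L * M : ℕ) - 1) :=
  (rLe k _).sub_mem (rLe_mono (by omega) (mulR_mem_rLe (vMinusT_mem_rLe d invRSubT_mem_rLe)))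
    (rLe_mono (by omega) (mulT_mem_rLe (vPlusR_mem_rLe d invRSubT_mem_rLe)))

/-- The term Δ₊ r V₋ reaches degree L in r, which must not exceed LM - 1; this is where M ≥ 2
enters. -/
theorem opB_mem_rLe (d : Params k M L) (hLM : L < L * M) :
    opB d (invRSubT k) ∈ rLe k ((L * M : ℕ) - 1) :=
  (rLe k _).sub_mem
    (rLe_mono (by omega)
      (deltaPlusR_mem_rLe d (mulR_mem_rLe (vMinusT_mem_rLe d invRSubT_mem_rLe))))
    (rLe_mono (by omega)
      (deltaMinusT_mem_rLe d (mulT_mem_rLe (vPlusR_mem_rLe d invRSubT_mem_rLe))))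

theorem serG_mem_rLe (d : Params k M L) : serG d ∈ rLe k (L - 1) :=
  mulT_mem_rLe ((rLe k _).sub_mem
    (rLe_mono (by omega) (aeval_mulR_mem_rLe d invRSubT_mem_rLe))
    (rLe_mono (by omega) (aeval_mulT_mem_rLe _ invRSubT_mem_rLe)))

theorem mulR_serG_mem_rLe (d : Params k M L) (hLM : L < L * M) :
    mulR k (serG d) ∈ rLe k ((L * M : ℕ) - 1) :=
  rLe_mono (by omega) (mulR_mem_rLe (serG_mem_rLe d))

/-! ### Naturality -/

/-- Application of a ring homomorphism to the coefficients. -/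
def mapBi {k' : Type*} [CommRing k'] (f : k →+* k') : BiSeries k →ₛₗ[f] BiSeries k' where
  toFun F i j := f (F i j)
  map_add' _ _ := by funext i j; simp
  map_smul' _ _ := by funext i j; simp

variable {k' : Type*} [CommRing k'] (f : k →+* k')

theorem polyS_map (s : Fin L → k) : (polyS s).map f = polyS (fun i => f (s i)) := by
  simp [polyS, Polynomial.map_sum]

theorem weightG_map (g : Fin M → k) : (weightG g).map f = weightG (fun i => f (g i)) := by
  simp [weightG, Polynomial.map_sum]

theorem polyGS_map (g : Fin M → k) (s : Fin L → k) :
    (polyGS g s).map f = polyGS (fun i => f (g i)) (fun i => f (s i)) := by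
  rw [polyGS, Polynomial.map_comp, weightG_map, polyS_map, polyGS]

theorem polySigma_map (g : Fin M → k) (s : Fin L → k) :
    (polySigma g s).map f = polySigma (fun i => f (g i)) (fun i => f (s i)) := by
  simp only [polySigma, Polynomial.map_sub, Polynomial.map_mul, Polynomial.map_comp,
    polyGS_map, ← Polynomial.derivative_map, weightG_map, polyS_map, Polynomial.map_X]

theorem mapBi_aeval {a : Module.End k (BiSeries k)} {b : Module.End k' (BiSeries k')}
    (h : ∀ F, mapBi f (a F) = b (mapBi f F)) (p : Polynomial k) (F : BiSeries k) :
    mapBi f (Polynomial.aeval a p F) = Polynomial.aeval b (p.map f) (mapBi f F) :=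
  (aeval_semiconj (mapBi f) ⊤ (a := a) (a' := b) (fun x _ => ⟨trivial, h x⟩) p F trivial).2

theorem mapBi_mulR (F : BiSeries k) : mapBi f (mulR k F) = mulR k' (mapBi f F) := rfl

theorem mapBi_mulT (F : BiSeries k) : mapBi f (mulT k F) = mulT k' (mapBi f F) := rfl

theorem mapBi_eulerR (F : BiSeries k) : mapBi f (eulerR k F) = eulerR k' (mapBi f F) := by
  funext i j
  simp [mapBi, eulerR]

theorem mapBi_eulerT (F : BiSeries k) : mapBi f (eulerT k F) = eulerT k' (mapBi f F) := by
  funext i j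
  simp [mapBi, eulerT]

theorem mapBi_invRSubT : mapBi f (invRSubT k) = invRSubT k' := by
  funext i j
  simp only [mapBi, invRSubT, LinearMap.coe_mk, AddHom.coe_mk]
  split_ifs <;> simp

theorem mapBi_deltaPlusR (d : Params k M L) (F : BiSeries k) :
    mapBi f (deltaPlusR d F) = deltaPlusR (d.map f) (mapBi f F) := by
  rw [deltaPlusR, deltaPlusR, LinearMap.add_apply, LinearMap.add_apply, map_add,
    mapBi_aeval f (mapBi_mulR f), LinearMap.smul_apply, map_smulₛₗ, mapBi_eulerR, polyS_map]
  rfl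

theorem mapBi_deltaMinusT (d : Params k M L) (F : BiSeries k) :
    mapBi f (deltaMinusT d F) = deltaMinusT (d.map f) (mapBi f F) := by
  rw [deltaMinusT, deltaMinusT, LinearMap.sub_apply, LinearMap.sub_apply, map_sub,
    mapBi_aeval f (mapBi_mulT f), LinearMap.smul_apply, map_smulₛₗ, mapBi_eulerT, polyS_map]
  rfl

theorem mapBi_vPlusR (d : Params k M L) (F : BiSeries k) :
    mapBi f (vPlusR d F) = vPlusR (d.map f) (mapBi f F) := by
  rw [vPlusR, mapBi_aeval f (mapBi_deltaPlusR f d), weightG_map]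
  rfl

theorem mapBi_vMinusT (d : Params k M L) (F : BiSeries k) :
    mapBi f (vMinusT d F) = vMinusT (d.map f) (mapBi f F) := by
  rw [vMinusT, mapBi_aeval f (mapBi_deltaMinusT f d), weightG_map]
  rfl

theorem matA_map (d : Params k M L) : matA (d.map f) = (matA d).map f := by
  have : opA (d.map f) (invRSubT k') = mapBi f (opA d (invRSubT k)) := by
    simp only [opA, LinearMap.sub_apply, Module.End.mul_apply, map_sub, mapBi_mulR, mapBi_mulT,
      mapBi_vPlusR, mapBi_vMinusT, mapBi_invRSubT]
  rw [matA_eq, matA_eq, this]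
  rfl

theorem matB_map (d : Params k M L) : matB (d.map f) = (matB d).map f := by
  have : opB (d.map f) (invRSubT k') = mapBi f (opB d (invRSubT k)) := by
    simp only [opB, LinearMap.sub_apply, Module.End.mul_apply, map_sub, mapBi_mulR, mapBi_mulT,
      mapBi_vPlusR, mapBi_vMinusT, mapBi_invRSubT, mapBi_deltaPlusR, mapBi_deltaMinusT]
  rw [matB, matB, this]
  rfl

theorem matC_map (d : Params k M L) : matC (d.map f) = (matC d).map f := by
  have : mulR k' (serG (d.map f)) = mapBi f (mulR k (serG d)) := by
    simp only [serG, opS, LinearMap.sub_apply, map_sub, mapBi_mulR, mapBi_mulT,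
      mapBi_invRSubT, mapBi_aeval f (mapBi_mulR f), mapBi_aeval f (mapBi_mulT f), polyS_map]
    rfl
  rw [matC, matC, this]
  rfl

/-! ### The coefficient `A₀₀` -/

theorem coeff_zero_polyS (s : Fin L → k) : (polyS s).coeff 0 = 0 := by
  simp [polyS, Polynomial.coeff_X_pow]

theorem coeff_zero_weightG (g : Fin M → k) : (weightG g).coeff 0 = 1 := by
  simp [weightG, Polynomial.coeff_X_pow]

/-- An operator without degree-zero part in t contributes to the coefficient of t⁰ only through the
constant term of the polynomial. -/
theorem aeval_apply_coeff_zero {a : Module.End k (BiSeries k)}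
    (h : ∀ F : BiSeries k, (∀ i j, j < 0 → F i j = 0) →
      (∀ i j, j < 0 → a F i j = 0) ∧ ∀ i, a F i 0 = 0) (p : Polynomial k) (F : BiSeries k)
    (hF : ∀ i j, j < 0 → F i j = 0) :
    (∀ i j, j < 0 → Polynomial.aeval a p F i j = 0) ∧
      ∀ i, Polynomial.aeval a p F i 0 = p.coeff 0 * F i 0 := by
  induction p using Polynomial.induction_on' with
  | add p q hp hq =>
    simp only [map_add, LinearMap.add_apply, Pi.add_apply, Polynomial.coeff_add, add_mul]
    exact ⟨fun i j hj => by rw [hp.1 i j hj, hq.1 i j hj, add_zero],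
      fun i => by rw [hp.2, hq.2]⟩
  | monomial n c =>
    simp only [Polynomial.aeval_monomial, Module.End.mul_apply, Module.algebraMap_end_apply,
      Pi.smul_apply, smul_eq_mul]
    have H : ∀ n : ℕ, ∀ i j, j < 0 → (a ^ n) F i j = 0 := fun n => by
      induction n with
      | zero => exact hF
      | succ n ih =>
        rw [pow_succ', Module.End.mul_apply]
        exact (h _ ih).1
    refine ⟨fun i j hj => by rw [H n i j hj, mul_zero], fun i => ?_⟩
    cases n with
    | zero => simp
    | succ n =>
      rw [pow_succ', Module.End.mul_apply, (h _ (H n)).2,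
        Polynomial.coeff_monomial_of_ne _ (Nat.succ_ne_zero n).symm]
      simp

theorem mulT_coeff_zero (F : BiSeries k) (hF : ∀ i j, j < 0 → F i j = 0) :
    (∀ i j, j < 0 → mulT k F i j = 0) ∧ ∀ i, mulT k F i 0 = 0 :=
  ⟨fun i j hj => hF i (j - 1) (by omega), fun i => hF i (0 - 1) (by omega)⟩

theorem deltaMinusT_coeff_zero (d : Params k M L) (F : BiSeries k)
    (hF : ∀ i j, j < 0 → F i j = 0) :
    (∀ i j, j < 0 → deltaMinusT d F i j = 0) ∧ ∀ i, deltaMinusT d F i 0 = 0 := by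
  have := aeval_apply_coeff_zero mulT_coeff_zero (polyS d.s) F hF
  constructor
  · intro i j hj
    simp [deltaMinusT, eulerT, this.1 i j hj, hF i j hj]
  · intro i
    simp [deltaMinusT, eulerT, this.2 i, coeff_zero_polyS]

/-- The series without constant term in `t`. -/
def tNoConst (k : Type*) [CommRing k] : Submodule k (BiSeries k) where
  carrier := {F | ∀ i, F i 0 = 0}
  add_mem' {f g} hf hg i := by simp [hf i, hg i]
  zero_mem' _ := rfl
  smul_mem' c f hf i := by simp [hf i]

theorem deltaPlusR_mem_tNoConst (d : Params k M L) {F : BiSeries k} (hF : F ∈ tNoConst k) :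
    deltaPlusR d F ∈ tNoConst k :=
  (tNoConst k).add_mem (aeval_mem (U := tNoConst k) (fun _ hx i => hx (i - 1)) _ hF)
    ((tNoConst k).smul_mem _ fun i => by simp [eulerR, show F i 0 = 0 from hF i])

/-- The second summand is divisible by t. In the first one, V₋ acts at t⁰ as G(0) = 1, and r · r⁻¹ =
1. This normalises the Christoffel–Darboux constant. -/
theorem opA_zero_zero (d : Params k M L) : opA d (invRSubT k) 0 0 = 1 := by
  have h0 : ∀ i j, j < 0 → invRSubT k i j = 0 := fun i j hj => if_neg (by omega)
  have h1 := (aeval_apply_coeff_zero (deltaMinusT_coeff_zero d) (weightG d.g) _ h0).2 (-1)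
  have h2 : (mulT k * vPlusR d) (invRSubT k) 0 0 = 0 := by
    rw [← (commute_vPlusR_mulT d).eq]
    exact aeval_mem (U := tNoConst k) (fun _ hx => deltaPlusR_mem_tNoConst d hx) _
      (mulT_coeff_zero _ h0).2 0
  rw [opA, LinearMap.sub_apply, Pi.sub_apply, Pi.sub_apply, h2, sub_zero]
  change vMinusT d (invRSubT k) (0 - 1) 0 = 1
  rw [zero_sub]
  refine h1.trans ?_
  simp [coeff_zero_weightG, invRSubT]

end BiSeries

/-! ### Operators on power series -/

/-- The Euler operator `X d/dX` on power series. -/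
def eulerX (k : Type*) [CommRing k] : Module.End k (PowerSeries k) :=
  LinearMap.mulLeft k PowerSeries.X ∘ₗ (PowerSeries.derivative k).toLinearMap

theorem eulerX_apply {k : Type*} [CommRing k] (f : PowerSeries k) :
    eulerX k f = PowerSeries.X * PowerSeries.derivative k f := rfl

theorem coeff_eulerX {k : Type*} [CommRing k] (f : PowerSeries k) (n : ℕ) :
    PowerSeries.coeff n (eulerX k f) = n * PowerSeries.coeff n f := by
  cases n with
  | zero => simp [eulerX_apply]
  | succ n =>
    rw [eulerX_apply, PowerSeries.coeff_succ_X_mul, PowerSeries.coeff_derivative]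
    push_cast
    ring

theorem coeff_aeval_smul_eulerX {k : Type*} [CommRing k] (b : k) (p : Polynomial k)
    (f : PowerSeries k) (n : ℕ) :
    PowerSeries.coeff n (Polynomial.aeval (b • eulerX k) p f) =
      p.eval (n * b) * PowerSeries.coeff n f := by
  induction p using Polynomial.induction_on' with
  | add p q hp hq => simp [hp, hq, add_mul]
  | monomial m c =>
    simp only [Polynomial.aeval_monomial, Module.End.mul_apply, Module.algebraMap_end_apply,
      PowerSeries.coeff_smul, Polynomial.eval_monomial, smul_eq_mul, mul_assoc]
    congr 1
    induction m with
    | zero => simp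
    | succ m ih =>
      rw [pow_succ', Module.End.mul_apply, LinearMap.smul_apply, PowerSeries.coeff_smul,
        coeff_eulerX, ih]
      simp only [smul_eq_mul]
      ring

/-- The operator `S(r) + β r d/dr` on power series in `r`. -/
def deltaPow {k : Type*} [CommRing k] {M L : ℕ} (d : Params k M L) :
    Module.End k (PowerSeries k) :=
  LinearMap.mulLeft k (polyS d.s : PowerSeries k) + d.β • eulerX k

/-- The coefficient of `t^j`, as a power series in `r`. -/
def colSeries {k : Type*} [CommRing k] (j : ℤ) : BiSeries k →ₗ[k] PowerSeries k where
  toFun f := PowerSeries.mk fun i => f i j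
  map_add' _ _ := by ext; simp
  map_smul' _ _ := by ext; simp

/-! ### Columns in t as power series in r. -/

section

variable {k : Type*} [CommRing k] {M L : ℕ}

theorem coeff_colSeries (j : ℤ) (f : BiSeries k) (n : ℕ) :
    PowerSeries.coeff n (colSeries j f) = f n j :=
  PowerSeries.coeff_mk n fun i : ℕ => f i j

theorem colSeries_mulR (j : ℤ) {f : BiSeries k} (hf : f ∈ rGe k) :
    colSeries j (mulR k f) = PowerSeries.X * colSeries j f := by
  ext n
  rw [coeff_colSeries]
  cases n with
  | zero => simpa [mulR] using hf (-1) j (by omega)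
  | succ n =>
    rw [PowerSeries.coeff_succ_X_mul, coeff_colSeries]
    simp [mulR]

theorem aeval_mulLeft (a : PowerSeries k) (p : Polynomial k) :
    Polynomial.aeval (LinearMap.mulLeft k a) p = LinearMap.mulLeft k (Polynomial.aeval a p) :=
  Polynomial.aeval_algHom_apply (Algebra.lmul k (PowerSeries k)) a p

theorem aeval_X_eq_coe (p : Polynomial k) :
    Polynomial.aeval (PowerSeries.X : PowerSeries k) p = (p : PowerSeries k) := by
  induction p using Polynomial.induction_on' with
  | add p q hp hq => simp [hp, hq]
  | monomial m c =>
    rw [Polynomial.aeval_monomial, ← Polynomial.C_mul_X_pow_eq_monomial]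
    simp

theorem colSeries_aeval_mulR (j : ℤ) (p : Polynomial k) {f : BiSeries k} (hf : f ∈ rGe k) :
    colSeries j (Polynomial.aeval (mulR k) p f) = (p : PowerSeries k) * colSeries j f := by
  have := (aeval_semiconj (colSeries j) (rGe k) (a := mulR k)
    (a' := LinearMap.mulLeft k PowerSeries.X)
    (fun x hx => ⟨mulR_mem_rGe hx, colSeries_mulR j hx⟩) p f hf).2
  rw [this, Polynomial.map_id, aeval_mulLeft, aeval_X_eq_coe]
  rfl

theorem colSeries_deltaPlusR (d : Params k M L) (j : ℤ) {f : BiSeries k} (hf : f ∈ rGe k) :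
    colSeries j (deltaPlusR d f) = deltaPow d (colSeries j f) := by
  have : colSeries j (eulerR k f) = eulerX k (colSeries j f) := by
    ext n
    rw [coeff_eulerX, coeff_colSeries, coeff_colSeries]
    simp [eulerR]
  simp only [deltaPlusR, deltaPow, LinearMap.add_apply, map_add, LinearMap.smul_apply, map_smul,
    this, colSeries_aeval_mulR j _ hf, LinearMap.mulLeft_apply]

theorem colSeries_vPlusR (d : Params k M L) (j : ℤ) {f : BiSeries k} (hf : f ∈ rGe k) :
    colSeries j (vPlusR d f) = Polynomial.aeval (deltaPow d) (weightG d.g) (colSeries j f) := by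
  have := (aeval_semiconj (colSeries j) (rGe k) (a := deltaPlusR d) (a' := deltaPow d)
    (fun x hx => ⟨deltaPlusR_mem_rGe d hx, colSeries_deltaPlusR d j hx⟩) (weightG d.g) f hf).2
  rw [vPlusR, this, Polynomial.map_id]

theorem colSeries_opB (d : Params k M L) (j : ℤ) :
    colSeries j (opB d (invRSubT k)) = deltaPow d (colSeries j (opA d (invRSubT k))) +
      Polynomial.aeval (deltaPow d) (weightG d.g) (colSeries j (serG d)) := by
  rw [opB_invRSubT, map_add, colSeries_deltaPlusR d j (opA_mem_rGe d),
    colSeries_vPlusR d j (serG_mem_rGe d)]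

theorem colSeries_eq_sum {N : ℕ} (j : ℤ) {f : BiSeries k} (hf : f ∈ rLe k ((N : ℤ) - 1)) :
    colSeries j f = ∑ i : Fin N, PowerSeries.C (f i j) * PowerSeries.X ^ i.val := by
  ext n
  rw [coeff_colSeries, map_sum]
  simp only [PowerSeries.coeff_C_mul, PowerSeries.coeff_X_pow]
  by_cases h : n < N
  · rw [Finset.sum_eq_single ⟨n, h⟩]
    · simp
    · intro i _ hi
      rw [if_neg (fun h' => hi (Fin.ext h'.symm)), mul_zero]
    · simp
  · rw [hf n j (by omega), Finset.sum_eq_zero]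
    intro i _
    rw [if_neg (by omega), mul_zero]

end

/-! ### The adapted bases as images of monomials -/

section

variable {k : Type*} [Field k] [Algebra ℚ k] {M L : ℕ}

/-- The generating function of `h_j(β⁻¹ s)`. -/
def symmSeries (d : Params k M L) : PowerSeries k :=
  PowerSeries.mk fun j => completeSymm (fun i => d.β⁻¹ * d.s i) j

/-- The series is exp(β⁻¹ ∑ sᵢ xⁱ), and β x d/dx of the exponent is ∑ i sᵢ xⁱ = S. -/
theorem eulerX_symmSeries (d : Params k M L) (hβ : d.β ≠ 0) :
    d.β • eulerX k (symmSeries d) = (polyS d.s : PowerSeries k) * symmSeries d := by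
  set e : PowerSeries k := ∑ i : Fin L,
    PowerSeries.C (d.β⁻¹ * d.s i) * PowerSeries.X ^ (i.val + 1) with he
  have h1 : symmSeries d = (PowerSeries.exp k).subst e := by
    ext n
    rw [symmSeries, PowerSeries.coeff_mk, completeSymm]
  have hs : PowerSeries.HasSubst e := PowerSeries.HasSubst.of_constantCoeff_zero' (by
    simp [he, map_sum])
  have h2 : d.β • eulerX k e = (polyS d.s : PowerSeries k) := by
    ext n
    rw [PowerSeries.coeff_smul, coeff_eulerX, he, polyS, Polynomial.coeff_coe,
      Polynomial.finsetSum_coeff, map_sum, Finset.mul_sum, Finset.smul_sum]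
    refine Finset.sum_congr rfl fun i _ => ?_
    rw [PowerSeries.coeff_C_mul, PowerSeries.coeff_X_pow, Polynomial.coeff_C_mul_X_pow]
    split_ifs with h
    · rw [h]
      simp only [smul_eq_mul]
      field_simp
    · simp
  rw [h1, eulerX_apply, PowerSeries.derivative_subst hs, PowerSeries.derivative_exp, ← h2,
    eulerX_apply, smul_mul_assoc]
  ring_nf

theorem eulerX_mul {R : Type*} [CommRing R] (f g : PowerSeries R) :
    eulerX R (f * g) = eulerX R f * g + f * eulerX R g := by
  simp only [eulerX_apply, Derivation.leibniz, smul_eq_mul]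
  ring

/-- The linear map which sends `r^m` to `Ψ⁺_m`. -/
def psiMap (d : Params k M L) : PowerSeries k →ₗ[k] PowerSeries k where
  toFun f := PowerSeries.mk fun n =>
    d.γ * rho d ((n : ℤ) - 1) * PowerSeries.coeff n (symmSeries d * f)
  map_add' f g := by ext; simp [mul_add]
  map_smul' c f := by ext; simp [mul_left_comm]

theorem coeff_psiMap (d : Params k M L) (f : PowerSeries k) (n : ℕ) :
    PowerSeries.coeff n (psiMap d f) =
      d.γ * rho d ((n : ℤ) - 1) * PowerSeries.coeff n (symmSeries d * f) :=
  PowerSeries.coeff_mk n fun n : ℕ =>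
    d.γ * rho d ((n : ℤ) - 1) * PowerSeries.coeff n (symmSeries d * f)

theorem psiMap_X_pow (d : Params k M L) (m : ℕ) : psiMap d (PowerSeries.X ^ m) = psiPlus d m := by
  ext n
  rw [coeff_psiMap, psiPlus, PowerSeries.coeff_C_mul, PowerSeries.coeff_mul_X_pow',
    PowerSeries.coeff_X_pow_mul']
  split_ifs with h
  · rw [symmSeries, PowerSeries.coeff_mk, PowerSeries.coeff_mk, mul_assoc, Nat.cast_sub h,
      sub_add_cancel]
  · simp

/-- Multiplication by the exponential series conjugates S + β r d/dr into β r d/dr, and the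
remaining coefficientwise factor γ ρ_{n-1} commutes with the Euler operator. -/
theorem psiMap_deltaPow (d : Params k M L) (hβ : d.β ≠ 0) (f : PowerSeries k) :
    psiMap d (deltaPow d f) = d.β • eulerX k (psiMap d f) := by
  have h : symmSeries d * deltaPow d f = d.β • eulerX k (symmSeries d * f) := by
    rw [eulerX_mul, smul_add, ← smul_mul_assoc, eulerX_symmSeries d hβ, deltaPow,
      LinearMap.add_apply, LinearMap.smul_apply, LinearMap.mulLeft_apply, mul_add,
      mul_smul_comm]
    ring
  ext n
  rw [coeff_psiMap, h, PowerSeries.coeff_smul, PowerSeries.coeff_smul, coeff_eulerX, coeff_eulerX,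
    coeff_psiMap]
  simp only [smul_eq_mul]
  ring

theorem psiMap_aeval_deltaPow (d : Params k M L) (hβ : d.β ≠ 0) (p : Polynomial k)
    (f : PowerSeries k) :
    psiMap d (Polynomial.aeval (deltaPow d) p f) =
      Polynomial.aeval (d.β • eulerX k) p (psiMap d f) := by
  have := (aeval_semiconj (psiMap d) ⊤ (a := deltaPow d) (a' := d.β • eulerX k)
    (fun x _ => ⟨trivial, psiMap_deltaPow d hβ x⟩) p f trivial).2
  simpa using this

theorem eval_zero_weightG {k : Type*} [CommRing k] (g : Fin M → k) : (weightG g).eval 0 = 1 := by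
  rw [← Polynomial.coeff_zero_eq_eval_zero, coeff_zero_weightG]

theorem rho_succ {k : Type*} [Field k] (d : Params k M L) (hγ : d.γ ≠ 0) (n : ℕ) :
    rho d n = d.γ * (weightG d.g).eval (n * d.β) * rho d ((n : ℤ) - 1) := by
  cases n with
  | zero =>
    change d.γ ^ 0 * ∏ i ∈ Finset.Icc 1 0, _ = _ * ((d.γ ^ (0 + 1))⁻¹ *
      ∏ i ∈ Finset.range (0 + 1), ((weightG d.g).eval (-((i : k) * d.β)))⁻¹)
    simp [eval_zero_weightG, hγ]
  | succ n =>
    rw [show ((n + 1 : ℕ) : ℤ) - 1 = (n : ℤ) by push_cast; ring]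
    change d.γ ^ (n + 1) * ∏ i ∈ Finset.Icc 1 (n + 1), _ =
      _ * (d.γ ^ n * ∏ i ∈ Finset.Icc 1 n, _)
    rw [Finset.prod_Icc_succ_top (by omega)]
    ring

/-- The shift of index is compensated by ρ_n = γ G(nβ) ρ_{n-1}, and the factor G(nβ) is the
eigenvalue of G(β x d/dx) on xⁿ. -/
theorem psiMap_X_mul (d : Params k M L) (hγ : d.γ ≠ 0) (f : PowerSeries k) :
    psiMap d (PowerSeries.X * f) = PowerSeries.C d.γ * PowerSeries.X *
      Polynomial.aeval (d.β • eulerX k) (weightG d.g) (psiMap d f) := by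
  ext n
  rw [coeff_psiMap, mul_left_comm, mul_assoc (PowerSeries.C d.γ), PowerSeries.coeff_C_mul]
  cases n with
  | zero => simp
  | succ n =>
    rw [PowerSeries.coeff_succ_X_mul, PowerSeries.coeff_succ_X_mul, coeff_aeval_smul_eulerX,
      coeff_psiMap, show ((n + 1 : ℕ) : ℤ) - 1 = (n : ℤ) by push_cast; ring, rho_succ d hγ]
    ring

/-- This symmetry of the weights is what identifies Ψ⁻ with Ψ⁺ at -β. -/
theorem rho_neg {k : Type*} [Field k] (d : Params k M L) (hγ : d.γ ≠ 0) (n : ℕ) :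
    (rho d (-(n : ℤ)))⁻¹ = d.γ * rho d.neg ((n : ℤ) - 1) := by
  cases n with
  | zero =>
    change (d.γ ^ 0 * ∏ i ∈ Finset.Icc 1 0, _)⁻¹ = _ * ((d.γ ^ (0 + 1))⁻¹ *
      ∏ i ∈ Finset.range (0 + 1), ((weightG d.g).eval (-((i : k) * -d.β)))⁻¹)
    simp [eval_zero_weightG, hγ]
  | succ n =>
    rw [show ((n + 1 : ℕ) : ℤ) - 1 = (n : ℤ) by push_cast; ring]
    change ((d.γ ^ (n + 1))⁻¹ *
      ∏ i ∈ Finset.range (n + 1), ((weightG d.g).eval (-((i : k) * d.β)))⁻¹)⁻¹ =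
      d.γ * (d.γ ^ n * ∏ i ∈ Finset.Icc 1 n, (weightG d.g).eval ((i : k) * -d.β))
    -- The factor with i = 0 is G(0) = 1; dropping it makes the product start at 1, as in ρ_n with n
    -- ≥ 0.
    rw [mul_inv, inv_inv, Finset.prod_inv_distrib, inv_inv, Finset.prod_range_succ']
    simp only [Nat.cast_zero, zero_mul, neg_zero, eval_zero_weightG, mul_one]
    rw [← Finset.Ico_add_one_right_eq_Icc, Finset.prod_Ico_eq_prod_range, pow_succ', mul_assoc]
    simp [add_comm]

theorem Params.neg_neg {k : Type*} [CommRing k] (d : Params k M L) : d.neg.neg = d := by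
  simp [Params.neg]

theorem psiMinus_eq (d : Params k M L) (hγ : d.γ ≠ 0) (m : ℕ) :
    psiMinus d m = psiPlus d.neg m := by
  rw [psiMinus, psiPlus, mul_left_comm]
  congr 1
  ext n
  rw [PowerSeries.coeff_C_mul, PowerSeries.coeff_mk, PowerSeries.coeff_mk, ← mul_assoc,
    show -(n : ℤ) - m = -((n + m : ℕ) : ℤ) by push_cast; ring, rho_neg d hγ]
  simp [Params.neg]

/-! ### The differential system and the Christoffel–Darboux identity -/

theorem psiMap_colSeries {N : ℕ} (d : Params k M L) (j : ℤ) {f : BiSeries k}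
    (hf : f ∈ rLe k ((N : ℤ) - 1)) :
    psiMap d (colSeries j f) = ∑ i : Fin N, PowerSeries.C (f i j) * psiPlus d i := by
  rw [colSeries_eq_sum j hf, map_sum]
  refine Finset.sum_congr rfl fun i _ => ?_
  rw [← PowerSeries.smul_eq_C_mul, map_smul, psiMap_X_pow, PowerSeries.smul_eq_C_mul]

/-- This is Aᵀ β x dΨ⁺/dx = Ẽ(x)ᵀ Ψ⁺ multiplied by γx, so that neither A nor x has to be inverted.
-/
theorem psiPlus_system (d : Params k M L) (hγ : d.γ ≠ 0) (hβ : d.β ≠ 0) (hLM : L < L * M)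
    (j : Fin (L * M)) :
    PowerSeries.C d.γ * PowerSeries.X *
        ∑ i, PowerSeries.C (matA d i j) * d.β • eulerX k (psiPlus d i) =
      PowerSeries.C d.γ * PowerSeries.X * ∑ i, PowerSeries.C (matB d i j) * psiPlus d i -
        ∑ i, PowerSeries.C (matC d i j) * psiPlus d i := by
  have hA := psiMap_colSeries d j (opA_mem_rLe (k := k) d (by omega))
  have hB := psiMap_colSeries d j (opB_mem_rLe (k := k) d hLM)
  have hC := psiMap_colSeries d j (mulR_serG_mem_rLe (k := k) d hLM)
  rw [colSeries_opB, map_add, psiMap_deltaPow d hβ, psiMap_aeval_deltaPow d hβ, hA, map_sum,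
    Finset.smul_sum] at hB
  rw [colSeries_mulR _ (serG_mem_rGe d), psiMap_X_mul d hγ] at hC
  change _ = _ * ∑ i : Fin (L * M), PowerSeries.C (opB d (invRSubT k) i j) * _ -
    ∑ i : Fin (L * M), PowerSeries.C (mulR k (serG d) i j) * _
  -- The image of V₊ `serG`, multiplied by γx, is the image of r `serG`: the last sum cancels it
  -- exactly.
  rw [← hB, ← hC, mul_add, add_sub_cancel_right]
  congr 1
  refine Finset.sum_congr rfl fun i _ => ?_
  rw [← PowerSeries.smul_eq_C_mul, ← PowerSeries.smul_eq_C_mul, map_smul, smul_comm]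
  rfl

theorem constantCoeff_psiPlus_zero (d : Params k M L) (hγ : d.γ ≠ 0) :
    PowerSeries.constantCoeff (psiPlus d 0) = 1 := by
  have h := rho_succ d hγ 0
  rw [psiPlus, pow_zero, one_mul, map_mul, ← PowerSeries.coeff_zero_eq_constantCoeff_apply,
    ← PowerSeries.coeff_zero_eq_constantCoeff_apply, PowerSeries.coeff_zero_C,
    PowerSeries.coeff_mk]
  have h1 : completeSymm (fun i => d.β⁻¹ * d.s i) 0 = 1 := by
    rw [completeSymm, PowerSeries.coeff_zero_eq_constantCoeff_apply]
    have hs : PowerSeries.constantCoeff (∑ i : Fin L,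
        PowerSeries.C (d.β⁻¹ * d.s i) * PowerSeries.X ^ (i.val + 1) : PowerSeries k) = 0 := by
      simp [map_sum]
    have := PowerSeries.constantCoeff_subst_eq_zero hs (PowerSeries.exp k - 1) (by simp)
    rw [PowerSeries.subst_sub (PowerSeries.HasSubst.of_constantCoeff_zero' hs)] at this
    have h1 : (1 : PowerSeries k).subst (∑ i : Fin L,
        PowerSeries.C (d.β⁻¹ * d.s i) * PowerSeries.X ^ (i.val + 1) : PowerSeries k) = 1 := by
      rw [← PowerSeries.coe_substAlgHom (PowerSeries.HasSubst.of_constantCoeff_zero' hs), map_one]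
    rw [h1, map_sub, sub_eq_zero] at this
    exact this.trans (map_one _)
  rw [h1]
  simp only [Nat.cast_zero, zero_mul, eval_zero_weightG, mul_one, zero_sub, add_zero] at h ⊢
  rw [← h]
  change d.γ ^ 0 * ∏ i ∈ Finset.Icc 1 0, _ = 1
  simp

theorem constantCoeff_psiPlus_succ (d : Params k M L) (m : ℕ) :
    PowerSeries.constantCoeff (psiPlus d (m + 1)) = 0 := by
  simp [psiPlus]

/-- The systems for Ψ⁺ and Ψ⁻ are adjoint to each other, so the bilinear form has zero derivative.
In characteristic zero it is constant. At x = 0 only Ψ⁺_0 and Ψ⁻_0 survive, which leaves A₀₀ = 1. -/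
theorem christoffelDarboux (d : Params k M L) (hγ : d.γ ≠ 0) (hβ : d.β ≠ 0) (hLM : L < L * M) :
    ∑ i, ∑ j, PowerSeries.C (matA d i j) * psiPlus d i * psiPlus d.neg j = 1 := by
  have : CharZero k := algebraRat.charZero k
  have h1 := psiPlus_system d hγ hβ hLM
  have h2 := psiPlus_system d.neg hγ (neg_ne_zero.2 hβ) hLM
  simp only [matA_neg, matB_neg, matC_neg, Matrix.transpose_apply] at h2
  change ∀ j : Fin (L * M), PowerSeries.C d.γ * PowerSeries.X * ∑ i, PowerSeries.C (matA d j i) *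
      (-d.β) • eulerX k (psiPlus d.neg i) =
      PowerSeries.C d.γ * PowerSeries.X * ∑ i, PowerSeries.C (matB d j i) * psiPlus d.neg i -
        ∑ i, PowerSeries.C (matC d j i) * psiPlus d.neg i at h2
  set K := ∑ i, ∑ j, PowerSeries.C (matA d i j) * psiPlus d i * psiPlus d.neg j with hK
  have hD : PowerSeries.C d.γ * PowerSeries.X * d.β • eulerX k K = 0 := by
    -- The derivative of the second factor is written with -β, the parameter of its own system; this
    -- produces the minus sign which makes the contributions of B and of C cancel.
    have e1 : d.β • eulerX k K =
        ∑ j, (∑ i, PowerSeries.C (matA d i j) * d.β • eulerX k (psiPlus d i)) * psiPlus d.neg j -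
        ∑ i, (∑ j, PowerSeries.C (matA d i j) * (-d.β) • eulerX k (psiPlus d.neg j)) *
          psiPlus d i := by
      simp only [Finset.sum_mul]
      rw [Finset.sum_comm, ← Finset.sum_sub_distrib, hK, map_sum, Finset.smul_sum]
      refine Finset.sum_congr rfl fun i _ => ?_
      rw [← Finset.sum_sub_distrib, map_sum, Finset.smul_sum]
      refine Finset.sum_congr rfl fun j _ => ?_
      rw [mul_assoc, ← PowerSeries.smul_eq_C_mul, map_smul, eulerX_mul]
      simp only [PowerSeries.smul_eq_C_mul, map_neg]
      ring
    rw [e1, mul_sub, Finset.mul_sum, Finset.mul_sum]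
    simp only [← mul_assoc, h1, h2, sub_mul]
    simp only [Finset.sum_sub_distrib, Finset.mul_sum, Finset.sum_mul]
    rw [sub_sub_sub_comm]
    refine (congrArg₂ (· - ·) (sub_eq_zero.2 ?_) (sub_eq_zero.2 ?_)).trans (sub_zero 0)
    · rw [Finset.sum_comm]
      exact Finset.sum_congr rfl fun i _ => Finset.sum_congr rfl fun j _ => by ring
    · rw [Finset.sum_comm]
      exact Finset.sum_congr rfl fun i _ => Finset.sum_congr rfl fun j _ => by ring
  have hD' : eulerX k K = 0 := by
    have h3 : PowerSeries.C d.γ * PowerSeries.X ≠ (0 : PowerSeries k) :=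
      mul_ne_zero (by simpa using hγ) PowerSeries.X_ne_zero
    exact (smul_eq_zero.1 ((mul_eq_zero.1 hD).resolve_left h3)).resolve_left hβ
  ext n
  cases n with
  | zero =>
    have hpos : 0 < L * M := by omega
    rw [PowerSeries.coeff_zero_eq_constantCoeff_apply, hK, map_sum,
      Finset.sum_eq_single ⟨0, hpos⟩, map_sum, Finset.sum_eq_single ⟨0, hpos⟩]
    · have := opA_zero_zero d
      simp only [map_mul, constantCoeff_psiPlus_zero d hγ, constantCoeff_psiPlus_zero d.neg hγ,
        PowerSeries.constantCoeff_C, mul_one, PowerSeries.coeff_zero_eq_constantCoeff_apply,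
        map_one]
      exact this
    · rintro ⟨i, hi⟩ _ hi'
      obtain ⟨i, rfl⟩ := Nat.exists_eq_succ_of_ne_zero (fun h => hi' (Fin.ext h))
      simp [constantCoeff_psiPlus_succ]
    · simp
    · rintro ⟨i, hi⟩ _ hi'
      obtain ⟨i, rfl⟩ := Nat.exists_eq_succ_of_ne_zero (fun h => hi' (Fin.ext h))
      simp [constantCoeff_psiPlus_succ]
    · simp
  | succ n =>
    have := congrArg (PowerSeries.coeff (n + 1)) hD'
    rw [coeff_eulerX, map_zero, mul_eq_zero, Nat.cast_eq_zero] at this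
    rw [this.resolve_left (Nat.succ_ne_zero n), PowerSeries.coeff_one,
      if_neg (Nat.succ_ne_zero n)]

end

/-! ### Contractions of power series -/

theorem eq_zero_of_forall_X_pow_dvd {R : Type*} [CommRing R] {f : PowerSeries R}
    (h : ∀ n : ℕ, PowerSeries.X ^ n ∣ f) : f = 0 := by
  ext n
  exact (PowerSeries.X_pow_dvd_iff.1 (h (n + 1))) n (Nat.lt_succ_self n)

/-- Banach's fixed point theorem for the X-adic distance. -/
theorem existsUnique_fixedPoint {R : Type*} [CommRing R] (Φ : PowerSeries R → PowerSeries R)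
    (hΦ : ∀ (n : ℕ) (f g : PowerSeries R), PowerSeries.X ^ n ∣ f - g →
      PowerSeries.X ^ (n + 1) ∣ Φ f - Φ g) : ∃! u, Φ u = u := by
  have hstep : ∀ n : ℕ, PowerSeries.X ^ n ∣ Φ^[n + 1] 0 - Φ^[n] 0 := by
    intro n
    induction n with
    | zero => simp
    | succ n ih =>
      simpa only [← Function.iterate_succ_apply'] using hΦ n _ _ ih
  have hle : ∀ m n : ℕ, m ≤ n → PowerSeries.X ^ m ∣ Φ^[n] 0 - Φ^[m] 0 := by
    intro m n h
    induction n, h using Nat.le_induction with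
    | base => simp
    | succ n h ih =>
      have := dvd_add ((pow_dvd_pow _ h).trans (hstep n)) ih
      simpa using this
  -- The coefficient of Xⁿ does not change from the iterate n + 1 on.
  set u : PowerSeries R := PowerSeries.mk fun n => PowerSeries.coeff n (Φ^[n + 1] 0) with hu
  have hu' : ∀ n : ℕ, PowerSeries.X ^ n ∣ u - Φ^[n] 0 := by
    intro n
    rw [PowerSeries.X_pow_dvd_iff]
    intro m hm
    have := PowerSeries.X_pow_dvd_iff.1 (hle (m + 1) n hm) m (Nat.lt_succ_self m)
    rw [map_sub, sub_eq_zero] at this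
    rw [map_sub, this, hu, PowerSeries.coeff_mk, sub_self]
  refine ⟨u, ?_, ?_⟩
  · refine sub_eq_zero.1 (eq_zero_of_forall_X_pow_dvd fun n => ?_)
    have h1 := hΦ n _ _ (hu' n)
    have h2 := hu' (n + 1)
    rw [Function.iterate_succ_apply'] at h2
    have := (pow_dvd_pow PowerSeries.X (Nat.le_succ n)).trans (dvd_sub h1 h2)
    simpa using this
  · intro v hv
    refine sub_eq_zero.1 (eq_zero_of_forall_X_pow_dvd fun n => ?_)
    have hΦu : Φ u = u := by
      refine sub_eq_zero.1 (eq_zero_of_forall_X_pow_dvd fun n => ?_)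
      have h1 := hΦ n _ _ (hu' n)
      have h2 := hu' (n + 1)
      rw [Function.iterate_succ_apply'] at h2
      have := (pow_dvd_pow PowerSeries.X (Nat.le_succ n)).trans (dvd_sub h1 h2)
      simpa using this
    induction n with
    | zero => simp
    | succ n ih =>
      have := hΦ n _ _ ih
      rwa [hv, hΦu] at this

/-- A linear relation between vectors which is preserved by a pair of operators is preserved by the
same polynomial in both. It is used for congruence modulo a power of X, where the two operators
depend on different `u`. -/
theorem aeval_pair_mem {R V : Type*} [CommRing R] [AddCommGroup V] [Module R V]
    (U : Submodule R (V × V)) {a a' : Module.End R V}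
    (h : ∀ x ∈ U, (a x.1, a' x.2) ∈ U) (p : Polynomial R) {x : V × V} (hx : x ∈ U) :
    (Polynomial.aeval a p x.1, Polynomial.aeval a' p x.2) ∈ U := by
  have h1 := aeval_semiconj (LinearMap.fst R V V) U (a := LinearMap.prodMap a a') (a' := a)
    (fun x hx => ⟨h x hx, rfl⟩) p x hx
  have h2 := aeval_semiconj (LinearMap.snd R V V) U (a := LinearMap.prodMap a a') (a' := a')
    (fun x hx => ⟨h x hx, rfl⟩) p x hx
  rw [Polynomial.map_id] at h1 h2
  have h3 : Polynomial.aeval (LinearMap.prodMap a a') p x =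
      (Polynomial.aeval a p x.1, Polynomial.aeval a' p x.2) := Prod.ext h1.2 h2.2
  exact h3 ▸ h1.1

/-! ### The quantum curve in the coordinate `z` -/

section

variable {R : Type*} [CommRing R] {M L : ℕ}

/-- `G(S(z))` as a power series. -/
def curveC (d : Params R M L) : PowerSeries R := (polyGS d.g d.s : PowerSeries R)

/-- `σ(z)` as a power series. -/
def curveSig (d : Params R M L) : PowerSeries R := (polySigma d.g d.s : PowerSeries R)

/-- `1/G(S(z))`. -/
def curveCInv (d : Params R M L) : PowerSeries R := PowerSeries.invOfUnit (curveC d) 1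

/-- `1/σ(z)`. -/
def curveSigInv (d : Params R M L) : PowerSeries R := PowerSeries.invOfUnit (curveSig d) 1

theorem polySigma_eq (g : Fin M → R) (s : Fin L → R) :
    polySigma g s = polyGS g s - Polynomial.X * Polynomial.derivative (polyGS g s) := by
  rw [polySigma, polyGS, Polynomial.derivative_comp]
  ring

theorem coeff_zero_polyGS (g : Fin M → R) (s : Fin L → R) : (polyGS g s).coeff 0 = 1 := by
  rw [Polynomial.coeff_zero_eq_eval_zero, polyGS, Polynomial.eval_comp,
    ← Polynomial.coeff_zero_eq_eval_zero, coeff_zero_polyS, ← Polynomial.coeff_zero_eq_eval_zero,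
    coeff_zero_weightG]

theorem coeff_zero_polySigma (g : Fin M → R) (s : Fin L → R) : (polySigma g s).coeff 0 = 1 := by
  rw [polySigma_eq, Polynomial.coeff_sub, coeff_zero_polyGS, Polynomial.coeff_X_mul_zero, sub_zero]

theorem constantCoeff_coe (p : Polynomial R) :
    PowerSeries.constantCoeff (p : PowerSeries R) = p.coeff 0 := by
  rw [← PowerSeries.coeff_zero_eq_constantCoeff_apply, Polynomial.coeff_coe]

theorem curveC_mul_inv (d : Params R M L) : curveC d * curveCInv d = 1 :=
  PowerSeries.mul_invOfUnit _ _ (by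
    rw [curveC, constantCoeff_coe, coeff_zero_polyGS, Units.val_one])

theorem curveSig_mul_inv (d : Params R M L) : curveSig d * curveSigInv d = 1 :=
  PowerSeries.mul_invOfUnit _ _ (by
    rw [curveSig, constantCoeff_coe, coeff_zero_polySigma, Units.val_one])

/-- The operator `β (z G(S(z)) / σ(z)) d/dz`. -/
def curveD (d : Params R M L) : Module.End R (PowerSeries R) :=
  d.β • (LinearMap.mulLeft R (curveC d * curveSigInv d) * eulerX R)

theorem curveD_apply (d : Params R M L) (f : PowerSeries R) :
    curveD d f = d.β • (curveC d * curveSigInv d * eulerX R f) := rfl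

theorem curveD_mul (d : Params R M L) (f g : PowerSeries R) :
    curveD d (f * g) = curveD d f * g + f * curveD d g := by
  simp only [curveD_apply, eulerX_mul, PowerSeries.smul_eq_C_mul]
  ring

/-- The operator `(z / G(S(z))) G(D + u)`. -/
def curveT (d : Params R M L) (u : PowerSeries R) : Module.End R (PowerSeries R) :=
  LinearMap.mulLeft R (PowerSeries.X * curveCInv d) *
    Polynomial.aeval (curveD d + LinearMap.mulLeft R u) (weightG d.g)

/-- The right-hand side of the Riccati equation `u = S(T_u) 1`. -/
def riccati (d : Params R M L) (u : PowerSeries R) : PowerSeries R :=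
  Polynomial.aeval (curveT d u) (polyS d.s) 1

/-- The pairs of power series which agree modulo `X^n`. -/
def congrMod (R : Type*) [CommRing R] (n : ℕ) : Submodule R (PowerSeries R × PowerSeries R) where
  carrier := {x | PowerSeries.X ^ n ∣ x.1 - x.2}
  add_mem' {x y} hx hy := by
    have := dvd_add (Set.mem_ofPred.1 hx) (Set.mem_ofPred.1 hy)
    simp only [Set.mem_ofPred_eq, Prod.fst_add, Prod.snd_add]
    rwa [add_sub_add_comm]
  zero_mem' := by simp
  smul_mem' c x hx := by
    simp only [Set.mem_ofPred_eq, Prod.smul_fst, Prod.smul_snd, ← smul_sub] at hx ⊢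
    rw [PowerSeries.smul_eq_C_mul]
    exact hx.mul_left _

theorem X_pow_dvd_eulerX {n : ℕ} {f : PowerSeries R} (h : PowerSeries.X ^ n ∣ f) :
    PowerSeries.X ^ n ∣ eulerX R f := by
  rw [PowerSeries.X_pow_dvd_iff] at h ⊢
  intro m hm
  rw [coeff_eulerX, h m hm, mul_zero]

theorem X_pow_dvd_curveD (d : Params R M L) {n : ℕ} {f : PowerSeries R}
    (h : PowerSeries.X ^ n ∣ f) : PowerSeries.X ^ n ∣ curveD d f := by
  rw [curveD_apply, PowerSeries.smul_eq_C_mul]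
  exact ((X_pow_dvd_eulerX h).mul_left _).mul_left _

/-- D and multiplication by u respect congruences modulo Xⁿ; the gain of one order comes from the
prefactor z/c of T. -/
theorem curveT_congr (d : Params R M L) {n : ℕ} {u u' : PowerSeries R}
    (hu : PowerSeries.X ^ n ∣ u - u') {x : PowerSeries R × PowerSeries R} (hx : x ∈ congrMod R n) :
    PowerSeries.X ^ (n + 1) ∣ curveT d u x.1 - curveT d u' x.2 := by
  have h : ∀ x ∈ congrMod R n, ((curveD d + LinearMap.mulLeft R u) x.1,
      (curveD d + LinearMap.mulLeft R u') x.2) ∈ congrMod R n := by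
    intro x hx
    change _ ∣ (curveD d x.1 + u * x.1) - (curveD d x.2 + u' * x.2)
    have h1 := X_pow_dvd_curveD d hx
    rw [map_sub] at h1
    have h2 := dvd_add h1 (dvd_add (hu.mul_right x.1) (Dvd.dvd.mul_left hx u'))
    convert h2 using 1
    ring
  have := aeval_pair_mem _ h (weightG d.g) hx
  change _ ∣ (PowerSeries.X * curveCInv d) * _ - (PowerSeries.X * curveCInv d) * _
  rw [← mul_sub, pow_succ', mul_assoc]
  exact mul_dvd_mul_left _ (Dvd.dvd.mul_left this _)

theorem riccati_congr (d : Params R M L) (n : ℕ) (u u' : PowerSeries R)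
    (hu : PowerSeries.X ^ n ∣ u - u') :
    PowerSeries.X ^ (n + 1) ∣ riccati d u - riccati d u' := by
  -- Since S(0) = 0, at least one T stands on the left of every term of S(T), and it supplies the
  -- extra power of X.
  obtain ⟨p, hp⟩ := Polynomial.X_dvd_iff.2 (coeff_zero_polyS d.s)
  have h := aeval_pair_mem (congrMod R n) (a := curveT d u) (a' := curveT d u')
    (fun x hx => (pow_dvd_pow _ (Nat.le_succ n)).trans (curveT_congr d hu hx)) p
    (x := (1, 1)) (by simp [congrMod])
  simp only [riccati, hp, map_mul, Polynomial.aeval_X, Module.End.mul_apply]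
  exact curveT_congr d hu h

/-- No division by β is needed and the base ring is arbitrary. The solution thus exists over
𝕂[s][[β]], can be specialised to β = 0, and can be compared with Ψ over a field where β is
invertible. -/
theorem existsUnique_riccati (d : Params R M L) : ∃! u, riccati d u = u :=
  existsUnique_fixedPoint _ (riccati_congr d)

/-- The solution of the Riccati equation `u = S(T_u) 1`. -/
def ricU (d : Params R M L) : PowerSeries R := (existsUnique_riccati d).choose

theorem riccati_ricU (d : Params R M L) : riccati d (ricU d) = ricU d :=
  (existsUnique_riccati d).choose_spec.1

theorem eq_ricU {d : Params R M L} {u : PowerSeries R} (h : riccati d u = u) : u = ricU d :=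
  (existsUnique_riccati d).unique h (riccati_ricU d)

/-- The ratio of `Ψ⁺_m` and `Ψ⁺_0` in the coordinate `z`. -/
def pSer (d : Params R M L) (m : ℕ) : PowerSeries R := (curveT d (ricU d) ^ m) 1

theorem pSer_zero (d : Params R M L) : pSer d 0 = 1 := rfl

theorem pSer_succ (d : Params R M L) (m : ℕ) :
    pSer d (m + 1) = curveT d (ricU d) (pSer d m) := by
  rw [pSer, pow_succ', Module.End.mul_apply, pSer]

theorem constantCoeff_pSer_succ (d : Params R M L) (m : ℕ) :
    PowerSeries.constantCoeff (pSer d (m + 1)) = 0 := by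
  rw [pSer_succ, curveT, Module.End.mul_apply, LinearMap.mulLeft_apply]
  simp

/-- The sum `∑ A_{ij} p⁺_i p⁻_j`. -/
def kSer (d : Params R M L) : PowerSeries R :=
  ∑ i, ∑ j, PowerSeries.C (matA d i j) * pSer d i * pSer d.neg j

theorem matA_zero_zero (d : Params R M L) (h : 0 < L * M) : matA d ⟨0, h⟩ ⟨0, h⟩ = 1 := by
  change opA d (invRSubT R) ((0 : ℕ) : ℤ) ((0 : ℕ) : ℤ) = 1
  rw [Nat.cast_zero, opA_zero_zero]

theorem constantCoeff_kSer (d : Params R M L) (hLM : 0 < L * M) :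
    PowerSeries.constantCoeff (kSer d) = 1 := by
  rw [kSer, map_sum, Finset.sum_eq_single ⟨0, hLM⟩, map_sum, Finset.sum_eq_single ⟨0, hLM⟩]
  · simp only [pSer_zero, PowerSeries.constantCoeff_C, mul_one, matA_zero_zero]
  · rintro ⟨i, hi⟩ _ hi'
    obtain ⟨i, rfl⟩ := Nat.exists_eq_succ_of_ne_zero (fun h => hi' (Fin.ext h))
    simp [constantCoeff_pSer_succ]
  · simp
  · rintro ⟨i, hi⟩ _ hi'
    obtain ⟨i, rfl⟩ := Nat.exists_eq_succ_of_ne_zero (fun h => hi' (Fin.ext h))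
    simp [constantCoeff_pSer_succ]
  · simp

/-- The product `Ψ⁺_0 Ψ⁻_0` in the coordinate `z`. -/
def qSer (d : Params R M L) : PowerSeries R := PowerSeries.invOfUnit (kSer d) 1

theorem kSer_mul_qSer (d : Params R M L) (hLM : 0 < L * M) : kSer d * qSer d = 1 :=
  PowerSeries.mul_invOfUnit _ _ (by rw [constantCoeff_kSer d hLM, Units.val_one])

/-- The left factor of the rank one projector `wkbMat`. -/
def wkbCol (d : Params R M L) (i : Fin (L * M)) : PowerSeries R := pSer d i

/-- The right factor of the rank one projector `wkbMat`. -/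
def wkbRow (d : Params R M L) (l : Fin (L * M)) : PowerSeries R :=
  qSer d * ∑ j : Fin (L * M), PowerSeries.C (matA d l j) * pSer d.neg j

/-- The WKB matrix. -/
def wkbMat (d : Params R M L) : Matrix (Fin (L * M)) (Fin (L * M)) (PowerSeries R) :=
  Matrix.vecMulVec (wkbCol d) (wkbRow d)

theorem wkbRow_dotProduct_wkbCol (d : Params R M L) (hLM : 0 < L * M) :
    dotProduct (wkbRow d) (wkbCol d) = 1 := by
  rw [← kSer_mul_qSer d hLM, kSer, Finset.sum_mul]
  refine Finset.sum_congr rfl fun l _ => ?_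
  rw [wkbRow, wkbCol, mul_assoc, mul_comm, Finset.sum_mul]
  congr 1
  exact Finset.sum_congr rfl fun j _ => by ring

theorem wkbMat_mul_self (d : Params R M L) (hLM : 0 < L * M) :
    wkbMat d * wkbMat d = wkbMat d := by
  rw [wkbMat, Matrix.vecMulVec_mul_vecMulVec, wkbRow_dotProduct_wkbCol d hLM, one_smul]

theorem rank_wkbMat [IsDomain R] (d : Params R M L) (hLM : 0 < L * M) : (wkbMat d).rank = 1 := by
  refine le_antisymm (Matrix.rank_vecMulVec_le _ _) ?_
  -- Lower bound for the rank: sandwiched between its own row and column, the projector gives the 1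
  -- × 1 identity.
  have h : Matrix.replicateRow Unit (wkbRow d) * wkbMat d * Matrix.replicateCol Unit (wkbCol d) =
      1 := by
    have h1 : Matrix.replicateRow Unit (wkbRow d) * Matrix.replicateCol Unit (wkbCol d) = 1 :=
      Matrix.ext fun i j => (wkbRow_dotProduct_wkbCol d hLM).trans (by simp)
    rw [wkbMat, Matrix.vecMulVec_eq Unit, ← Matrix.mul_assoc, h1, Matrix.one_mul, h1]
  have h2 : (1 : Matrix Unit Unit (PowerSeries R)).rank = 1 := by simp
  rw [← h2, ← h]
  exact (Matrix.rank_mul_le_left _ _).trans (Matrix.rank_mul_le_right _ _)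

/-! ### Naturality -/

variable {R' : Type*} [CommRing R'] (f : R →+* R')

/-- Application of a ring homomorphism to the coefficients, as a semilinear map. -/
def mapSer : PowerSeries R →ₛₗ[f] PowerSeries R' where
  toFun := PowerSeries.map f
  map_add' := map_add _
  map_smul' c x := by simp [PowerSeries.smul_eq_C_mul]

theorem mapSer_apply (x : PowerSeries R) : mapSer f x = PowerSeries.map f x := rfl

theorem map_coe (p : Polynomial R) :
    PowerSeries.map f (p : PowerSeries R) = (p.map f : PowerSeries R') := by
  ext n
  simp

theorem map_curveC (d : Params R M L) : PowerSeries.map f (curveC d) = curveC (d.map f) := by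
  rw [curveC, map_coe, polyGS_map, curveC]
  rfl

theorem map_curveSig (d : Params R M L) : PowerSeries.map f (curveSig d) = curveSig (d.map f) := by
  rw [curveSig, map_coe, polySigma_map, curveSig]
  rfl

theorem map_curveCInv (d : Params R M L) :
    PowerSeries.map f (curveCInv d) = curveCInv (d.map f) := by
  have h := congrArg (PowerSeries.map f) (curveC_mul_inv d)
  rw [map_mul, map_one, map_curveC] at h
  exact left_inv_eq_right_inv ((mul_comm _ _).trans h) (curveC_mul_inv _)

theorem map_curveSigInv (d : Params R M L) :
    PowerSeries.map f (curveSigInv d) = curveSigInv (d.map f) := by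
  have h := congrArg (PowerSeries.map f) (curveSig_mul_inv d)
  rw [map_mul, map_one, map_curveSig] at h
  exact left_inv_eq_right_inv ((mul_comm _ _).trans h) (curveSig_mul_inv _)

theorem map_eulerX (x : PowerSeries R) :
    PowerSeries.map f (eulerX R x) = eulerX R' (PowerSeries.map f x) := by
  ext n
  rw [PowerSeries.coeff_map, coeff_eulerX, coeff_eulerX, PowerSeries.coeff_map, map_mul,
    map_natCast]

theorem map_curveD (d : Params R M L) (x : PowerSeries R) :
    PowerSeries.map f (curveD d x) = curveD (d.map f) (PowerSeries.map f x) := by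
  simp only [curveD_apply, PowerSeries.smul_eq_C_mul, map_mul, PowerSeries.map_C, map_curveC,
    map_curveSigInv, map_eulerX]
  rfl

theorem map_aeval_curve (d : Params R M L) (u : PowerSeries R) (p : Polynomial R)
    (x : PowerSeries R) :
    PowerSeries.map f (Polynomial.aeval (curveD d + LinearMap.mulLeft R u) p x) =
      Polynomial.aeval (curveD (d.map f) + LinearMap.mulLeft R' (PowerSeries.map f u)) (p.map f)
        (PowerSeries.map f x) :=
  (aeval_semiconj (mapSer f) ⊤ (fun x _ => ⟨trivial, by
    simp [mapSer_apply, map_curveD]⟩) p x trivial).2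

theorem map_curveT (d : Params R M L) (u x : PowerSeries R) :
    PowerSeries.map f (curveT d u x) =
      curveT (d.map f) (PowerSeries.map f u) (PowerSeries.map f x) := by
  simp only [curveT, Module.End.mul_apply, LinearMap.mulLeft_apply, map_mul, map_aeval_curve,
    PowerSeries.map_X, map_curveCInv, weightG_map]
  rfl

theorem map_riccati (d : Params R M L) (u : PowerSeries R) :
    PowerSeries.map f (riccati d u) = riccati (d.map f) (PowerSeries.map f u) := by
  have := (aeval_semiconj (mapSer f) ⊤ (a := curveT d u)
    (a' := curveT (d.map f) (PowerSeries.map f u))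
    (fun x _ => ⟨trivial, map_curveT f d u x⟩) (polyS d.s) 1 trivial).2
  rw [polyS_map, mapSer_apply, mapSer_apply, show PowerSeries.map f 1 = 1 from map_one _] at this
  exact this

/-- The image solves the mapped Riccati equation, so uniqueness identifies it; every later
naturality statement rests on this one. -/
theorem map_ricU (d : Params R M L) : PowerSeries.map f (ricU d) = ricU (d.map f) :=
  eq_ricU (by rw [← map_riccati, riccati_ricU])

theorem map_pSer (d : Params R M L) (m : ℕ) :
    PowerSeries.map f (pSer d m) = pSer (d.map f) m := by
  induction m with
  | zero => exact map_one _
  | succ m ih => rw [pSer_succ, map_curveT, map_ricU, ih, pSer_succ]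

theorem Params.map_neg (d : Params R M L) : d.neg.map f = (d.map f).neg := by
  simp [Params.map, Params.neg]

theorem map_kSer (d : Params R M L) : PowerSeries.map f (kSer d) = kSer (d.map f) := by
  simp only [kSer, map_sum, map_mul, PowerSeries.map_C, map_pSer, Params.map_neg, matA_map,
    Matrix.map_apply]

theorem map_qSer (d : Params R M L) (hLM : 0 < L * M) :
    PowerSeries.map f (qSer d) = qSer (d.map f) := by
  have h := congrArg (PowerSeries.map f) (kSer_mul_qSer d hLM)
  rw [map_mul, map_one, map_kSer] at h
  exact left_inv_eq_right_inv ((mul_comm _ _).trans h) (kSer_mul_qSer _ hLM)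

theorem map_wkbMat (d : Params R M L) (hLM : 0 < L * M) (i j : Fin (L * M)) :
    PowerSeries.map f (wkbMat d i j) = wkbMat (d.map f) i j := by
  simp only [wkbMat, Matrix.vecMulVec_apply, wkbCol, wkbRow, map_mul, map_sum, map_pSer,
    map_qSer f d hLM, PowerSeries.map_C, Params.map_neg, matA_map, Matrix.map_apply]

end

/-! ### Substitution of `x = X(z)` -/

section

variable {k : Type*} [Field k] [Algebra ℚ k] {M L : ℕ}

theorem curveXSeries_eq {k : Type*} [Field k] (d : Params k M L) :
    curveXSeries d = PowerSeries.C d.γ⁻¹ * (PowerSeries.X * curveCInv d) := by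
  have h : (curveC d)⁻¹ = curveCInv d := by
    rw [PowerSeries.inv_eq_iff_mul_eq_one, mul_comm, curveC_mul_inv]
    rw [curveC, constantCoeff_coe, coeff_zero_polyGS]
    exact one_ne_zero
  rw [curveXSeries, PowerSeries.mul_inv_rev, PowerSeries.C_inv]
  rw [← h, curveC]
  ring

theorem hasSubst_curveXSeries {k : Type*} [Field k] (d : Params k M L) :
    PowerSeries.HasSubst (curveXSeries d) :=
  PowerSeries.HasSubst.of_constantCoeff_zero' (by simp [curveXSeries])

/-- Substitution of `x = X(z)`. -/
def substX {k : Type*} [Field k] (d : Params k M L) : PowerSeries k →ₐ[k] PowerSeries k :=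
  PowerSeries.substAlgHom (hasSubst_curveXSeries d)

theorem substX_apply {k : Type*} [Field k] (d : Params k M L) (f : PowerSeries k) :
    substX d f = f.subst (curveXSeries d) := by
  rw [substX, PowerSeries.coe_substAlgHom]

theorem substX_C {k : Type*} [Field k] (d : Params k M L) (c : k) :
    substX d (PowerSeries.C c) = PowerSeries.C c :=
  (substX d).commutes c

theorem substX_X {k : Type*} [Field k] (d : Params k M L) :
    substX d PowerSeries.X = curveXSeries d := by
  rw [substX_apply, PowerSeries.subst_X (hasSubst_curveXSeries d)]

theorem substX_gamma_X {k : Type*} [Field k] (d : Params k M L) (hγ : d.γ ≠ 0) :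
    substX d (PowerSeries.C d.γ * PowerSeries.X) = PowerSeries.X * curveCInv d := by
  rw [map_mul, substX_C, substX_X, curveXSeries_eq, ← mul_assoc, ← map_mul, mul_inv_cancel₀ hγ,
    map_one, one_mul]

/-- The logarithmic derivative z X'/X equals 1 - z c'/c = σ/c. It is found by differentiating c X =
γ⁻¹ z. -/
theorem eulerX_curveXSeries {k : Type*} [Field k] (d : Params k M L) :
    curveC d * curveSigInv d * eulerX k (curveXSeries d) = curveXSeries d := by
  have h1 : curveC d * curveXSeries d = PowerSeries.C d.γ⁻¹ * PowerSeries.X := by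
    rw [curveXSeries_eq]
    linear_combination PowerSeries.C d.γ⁻¹ * PowerSeries.X * curveC_mul_inv d
  have h2 := congrArg (eulerX k) h1
  rw [eulerX_mul] at h2
  have h3 : eulerX k (PowerSeries.C d.γ⁻¹ * PowerSeries.X) =
      PowerSeries.C d.γ⁻¹ * PowerSeries.X := by
    rw [← PowerSeries.smul_eq_C_mul, map_smul, eulerX_apply, PowerSeries.derivative_X, mul_one]
  have h4 : curveSig d = curveC d - eulerX k (curveC d) := by
    rw [curveSig, polySigma_eq, curveC, eulerX_apply, PowerSeries.derivative_coe]
    simp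
  have h5 := curveSig_mul_inv d
  rw [h4] at h5
  rw [h3, ← h1] at h2
  linear_combination curveSigInv d * h2 + curveXSeries d * h5

theorem substX_eulerX {k : Type*} [Field k] (d : Params k M L) (f : PowerSeries k) :
    substX d (eulerX k f) = curveC d * curveSigInv d * eulerX k (substX d f) := by
  rw [eulerX_apply, map_mul, substX_X, substX_apply, substX_apply, eulerX_apply,
    PowerSeries.derivative_subst (hasSubst_curveXSeries d)]
  nth_rewrite 1 [← eulerX_curveXSeries d]
  rw [eulerX_apply]
  ring

theorem substX_smul_eulerX {k : Type*} [Field k] (d : Params k M L) (f : PowerSeries k) :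
    substX d (d.β • eulerX k f) = curveD d (substX d f) := by
  rw [map_smul, substX_eulerX, curveD_apply]

theorem substX_aeval {k : Type*} [Field k] (d : Params k M L) (p : Polynomial k)
    (f : PowerSeries k) :
    substX d (Polynomial.aeval (d.β • eulerX k) p f) =
      Polynomial.aeval (curveD d) p (substX d f) := by
  have := (aeval_semiconj (substX d).toLinearMap ⊤ (a := d.β • eulerX k) (a' := curveD d)
    (fun x _ => ⟨trivial, substX_smul_eulerX d x⟩) p f trivial).2
  simpa using this

/-- The functions `Ψ⁺_m(X(z))`. -/
def phi (d : Params k M L) (m : ℕ) : PowerSeries k := substX d (psiPlus d m)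

theorem phi_succ (d : Params k M L) (hγ : d.γ ≠ 0) (m : ℕ) :
    phi d (m + 1) = PowerSeries.X * curveCInv d *
      Polynomial.aeval (curveD d) (weightG d.g) (phi d m) := by
  rw [phi, ← psiMap_X_pow, pow_succ', psiMap_X_mul d hγ, map_mul, substX_gamma_X d hγ,
    substX_aeval, psiMap_X_pow, phi]

/-- It is the image of (S(r) + β r d/dr) 1 = S(r) under the map r^m ↦ Ψ⁺_m(X(z)). -/
theorem curveD_phi_zero (d : Params k M L) (hβ : d.β ≠ 0) :
    curveD d (phi d 0) = (polyS d.s).sum fun l c => c • phi d l := by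
  have h : deltaPow d 1 = ((polyS d.s).sum fun l c => c • PowerSeries.X ^ l : PowerSeries k) := by
    rw [deltaPow, LinearMap.add_apply, LinearMap.smul_apply, eulerX_apply, LinearMap.mulLeft_apply]
    have : PowerSeries.derivative k (1 : PowerSeries k) = 0 :=
      (PowerSeries.derivative k).map_one_eq_zero
    rw [this, mul_zero, smul_zero, add_zero, mul_one, ← aeval_X_eq_coe, Polynomial.aeval_eq_sum_range,
      Polynomial.sum_over_range _ (by simp)]
  rw [phi, ← psiMap_X_pow, pow_zero, ← substX_smul_eulerX, ← psiMap_deltaPow d hβ, h,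
    Polynomial.sum, map_sum, map_sum, Polynomial.sum]
  refine Finset.sum_congr rfl fun l _ => ?_
  rw [map_smul, map_smul, psiMap_X_pow, phi]

theorem constantCoeff_phi_zero (d : Params k M L) (hγ : d.γ ≠ 0) :
    PowerSeries.constantCoeff (phi d 0) = 1 := by
  have h0 : PowerSeries.constantCoeff (curveXSeries d) = 0 := by simp [curveXSeries]
  have := PowerSeries.constantCoeff_subst_eq_zero h0 (psiPlus d 0 - 1) (by
    rw [map_sub, constantCoeff_psiPlus_zero d hγ, map_one, sub_self])
  change PowerSeries.constantCoeff _ = 0 at this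
  rw [← substX_apply, map_sub, map_one, map_sub, map_one, sub_eq_zero] at this
  exact this

/-- Conjugating D by φ₀ gives D + u, with u the logarithmic derivative of φ₀. The recursion
`phi_succ` then reads φ_m = φ₀ T_u^m 1, and the equation for D φ₀ becomes u = S(T_u) 1. Uniqueness
forces u to be `ricU`, so all ratios φ_m/φ₀ are regular in β although φ₀ is not. -/
theorem phi_eq (d : Params k M L) (hγ : d.γ ≠ 0) (hβ : d.β ≠ 0) (m : ℕ) :
    phi d m = phi d 0 * pSer d m := by
  have h0 : phi d 0 * (phi d 0)⁻¹ = 1 := PowerSeries.mul_inv_cancel _ (by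
    rw [constantCoeff_phi_zero d hγ]; exact one_ne_zero)
  set u := curveD d (phi d 0) * (phi d 0)⁻¹ with hu
  have hT : ∀ x, phi d 0 * curveT d u x = PowerSeries.X * curveCInv d *
      Polynomial.aeval (curveD d) (weightG d.g) (phi d 0 * x) := by
    intro x
    have := (aeval_semiconj (LinearMap.mulLeft k (phi d 0)) ⊤
      (a := curveD d + LinearMap.mulLeft k u) (a' := curveD d)
      (fun x _ => ⟨trivial, by
        simp only [LinearMap.add_apply, LinearMap.mulLeft_apply, curveD_mul]
        rw [hu]
        linear_combination x * curveD d (phi d 0) * h0⟩) (weightG d.g) x trivial).2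
    simp only [LinearMap.mulLeft_apply, Polynomial.map_id] at this
    rw [← this, curveT, Module.End.mul_apply, LinearMap.mulLeft_apply]
    ring
  have hpow : ∀ m, phi d 0 * (curveT d u ^ m) 1 = phi d m := by
    intro m
    induction m with
    | zero => simp
    | succ m ih => rw [pow_succ', Module.End.mul_apply, hT, ih, ← phi_succ d hγ]
  have hric : riccati d u = u := by
    have h1 : phi d 0 * riccati d u = curveD d (phi d 0) := by
      rw [curveD_phi_zero d hβ, riccati, Polynomial.aeval_eq_sum_range, LinearMap.sum_apply,
        Finset.mul_sum, Polynomial.sum_over_range _ (by simp)]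
      refine Finset.sum_congr rfl fun l _ => ?_
      rw [LinearMap.smul_apply, mul_smul_comm, hpow]
    linear_combination (phi d 0)⁻¹ * h1 - riccati d u * h0 - hu
  rw [← hpow m, eq_ricU hric, pSer]

/-- The prefactors φ₀(β) and φ₀(-β) enter only through their product, and the Christoffel–Darboux
identity says that this product is the inverse of `kSer`. -/
theorem matMPlus_subst (d : Params k M L) (hγ : d.γ ≠ 0) (hβ : d.β ≠ 0) (hLM : L < L * M)
    (i j : Fin (L * M)) : (matMPlus d i j).subst (curveXSeries d) = wkbMat d i j := by
  have hcd := congrArg (substX d) (christoffelDarboux d hγ hβ hLM)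
  -- X(z) does not contain β, so both signs of β share the same substitution.
  have hneg : ∀ f, substX d.neg f = substX d f := fun _ => rfl
  have hm : ∀ m, substX d (psiPlus d.neg m) = phi d.neg 0 * pSer d.neg m := fun m =>
    phi_eq d.neg hγ (neg_ne_zero.2 hβ) m
  have hp : ∀ m, substX d (psiPlus d m) = phi d 0 * pSer d m := phi_eq d hγ hβ
  simp only [map_sum, map_mul, map_one, substX_C, hm, hp] at hcd
  have hq : phi d 0 * phi d.neg 0 = qSer d := by
    have h1 : phi d 0 * phi d.neg 0 * kSer d = 1 := by
      rw [← hcd, kSer, Finset.mul_sum]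
      refine Finset.sum_congr rfl fun i _ => ?_
      rw [Finset.mul_sum]
      exact Finset.sum_congr rfl fun j _ => by ring
    exact left_inv_eq_right_inv h1 (kSer_mul_qSer d (by omega))
  rw [← substX_apply, matMPlus, Matrix.mul_apply, wkbMat, Matrix.vecMulVec_apply, wkbCol, wkbRow,
    map_sum, ← hq, Finset.mul_sum, Finset.mul_sum]
  refine Finset.sum_congr rfl fun l _ => ?_
  rw [Matrix.vecMulVec_apply, Matrix.transpose_apply, Matrix.map_apply, psiMinus_eq d hγ]
  simp only [map_mul, substX_C, hm, hp]
  ring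

/-- After the substitution γx becomes z/c; multiplication by c clears the denominator and removes γ
altogether. -/
theorem phi_system (d : Params k M L) (hγ : d.γ ≠ 0) (hβ : d.β ≠ 0) (hLM : L < L * M)
    (j : Fin (L * M)) :
    PowerSeries.X * ∑ i : Fin (L * M), PowerSeries.C (matA d i j) * curveD d (phi d i) =
      PowerSeries.X * ∑ i : Fin (L * M), PowerSeries.C (matB d i j) * phi d i -
        curveC d * ∑ i : Fin (L * M), PowerSeries.C (matC d i j) * phi d i := by
  have h := congrArg (substX d) (psiPlus_system d hγ hβ hLM j)
  rw [map_sub, map_mul, map_mul _ (PowerSeries.C d.γ * PowerSeries.X), substX_gamma_X d hγ] at h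
  simp only [map_sum, map_mul _ (PowerSeries.C _), substX_C, substX_smul_eulerX] at h
  have hc := curveC_mul_inv d
  simp only [phi]
  linear_combination curveC d * h + (PowerSeries.X * (∑ i : Fin (L * M), PowerSeries.C (matB d i j)
    * substX d (psiPlus d i) - ∑ i : Fin (L * M), PowerSeries.C (matA d i j) *
      curveD d (substX d (psiPlus d i)))) * hc

end

/-! ### The classical limit `β = 0` -/

section

variable {R : Type*} [CommRing R] {M L : ℕ}

theorem aeval_aeval {A : Type*} [Ring A] [Algebra R A] (a : A) (p q : Polynomial R) :
    Polynomial.aeval (Polynomial.aeval a p) q = Polynomial.aeval a (q.comp p) := by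
  rw [Polynomial.aeval_comp]

theorem vPlusR_of_beta_eq_zero {d : Params R M L} (h : d.β = 0) :
    vPlusR d = Polynomial.aeval (mulR R) (polyGS d.g d.s) := by
  rw [vPlusR, deltaPlusR, h, zero_smul, add_zero, aeval_aeval, polyGS]

theorem vMinusT_of_beta_eq_zero {d : Params R M L} (h : d.β = 0) :
    vMinusT d = Polynomial.aeval (mulT R) (polyGS d.g d.s) := by
  rw [vMinusT, deltaMinusT, h, zero_smul, sub_zero, aeval_aeval, polyGS]

theorem aeval_mulR_apply (p : Polynomial R) (F : BiSeries R) (i j : ℤ) :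
    Polynomial.aeval (mulR R) p F i j = p.sum fun m c => c * F (i - m) j := by
  have h : ∀ m : ℕ, (mulR R ^ m) F i j = F (i - m) j := fun m => by
    induction m generalizing i with
    | zero => simp
    | succ m ih =>
      rw [pow_succ', Module.End.mul_apply]
      change (mulR R ^ m) F (i - 1) j = _
      rw [ih]
      congr 1
      push_cast
      ring
  rw [Polynomial.aeval_eq_sum_range, Polynomial.sum_over_range _ (by simp), LinearMap.sum_apply,
    Finset.sum_apply, Finset.sum_apply]
  exact Finset.sum_congr rfl fun m _ => by simp [h]

theorem aeval_mulT_apply (p : Polynomial R) (F : BiSeries R) (i j : ℤ) :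
    Polynomial.aeval (mulT R) p F i j = p.sum fun m c => c * F i (j - m) := by
  have := congrFun (congrFun (swapRT_aeval (k := R) swapRT_mulT p F) j) i
  exact this.trans (aeval_mulR_apply p _ j i)

/-- The series `1`. -/
def oneBi (R : Type*) [CommRing R] : BiSeries R := fun i j => if i = 0 ∧ j = 0 then 1 else 0

theorem mulR_sub_mulT_invRSubT : (mulR R - mulT R) (invRSubT R) = oneBi R := by
  funext i j
  simp only [LinearMap.sub_apply, mulR, mulT, invRSubT, oneBi, LinearMap.coe_mk, AddHom.coe_mk,
    Pi.sub_apply]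
  split_ifs <;> first | (exfalso; omega) | simp

theorem sum_mul_oneBi_left (p : Polynomial R) (i : ℕ) (j : ℤ) :
    (p.sum fun m c => c * oneBi R ((i : ℤ) - m) j) = if j = 0 then p.coeff i else 0 := by
  rw [Polynomial.sum_def, Finset.sum_eq_single i]
  · simp [oneBi]
  · intro m _ hm
    rw [oneBi, if_neg (by omega), mul_zero]
  · intro hi
    rw [Polynomial.notMem_support_iff.1 hi, zero_mul]

theorem sum_mul_oneBi_right (p : Polynomial R) (i : ℤ) (j : ℕ) :
    (p.sum fun m c => c * oneBi R i ((j : ℤ) - m)) = if i = 0 then p.coeff j else 0 := by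
  rw [Polynomial.sum_def, Finset.sum_eq_single j]
  · simp [oneBi]
  · intro m _ hm
    rw [oneBi, if_neg (by omega), mul_zero]
  · intro hi
    rw [Polynomial.notMem_support_iff.1 hi, zero_mul]

/-- At β = 0 all operators are multiplications and commute with r - t, which sends 1/(r - t) to 1.
This is the coefficient form of (r - t) A(r, t) = r c(t) - t c(r). -/
theorem opA_recursion {d : Params R M L} (h : d.β = 0) (i j : ℕ) :
    opA d (invRSubT R) ((i : ℤ) - 1) j - opA d (invRSubT R) i ((j : ℤ) - 1) =
      (if i = 1 then (polyGS d.g d.s).coeff j else 0) -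
        if j = 1 then (polyGS d.g d.s).coeff i else 0 := by
  have hc : Commute (mulR R - mulT R) (opA d) := by
    have h1 : Commute (mulR R) (vPlusR d) := by
      rw [vPlusR_of_beta_eq_zero h]
      exact commute_aeval (Commute.refl _) _
    have h2 : Commute (mulT R) (vMinusT d) := by
      rw [vMinusT_of_beta_eq_zero h]
      exact commute_aeval (Commute.refl _) _
    have h3 := commute_mulR_vMinusT d
    have h4 := (commute_vPlusR_mulT d).symm
    have h5 := commute_mulR_mulT (k := R)
    exact (((Commute.refl _).mul_right h3).sub_right (h5.mul_right h1)).sub_left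
      ((h5.symm.mul_right h2).sub_right ((Commute.refl _).mul_right h4))
  have h1 := LinearMap.congr_fun hc.eq (invRSubT R)
  rw [Module.End.mul_apply, Module.End.mul_apply, mulR_sub_mulT_invRSubT] at h1
  have h2 := congrFun (congrFun h1 i) j
  change opA d (invRSubT R) ((i : ℤ) - 1) j - opA d (invRSubT R) i ((j : ℤ) - 1) =
    vMinusT d (oneBi R) ((i : ℤ) - 1) j - vPlusR d (oneBi R) i ((j : ℤ) - 1) at h2
  rw [h2, vPlusR_of_beta_eq_zero h, vMinusT_of_beta_eq_zero h, aeval_mulR_apply,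
    aeval_mulT_apply, sum_mul_oneBi_left, sum_mul_oneBi_right]
  congr 1 <;> exact if_congr (by omega) rfl rfl

/-- The value of the polynomial `∑ A_{ij} r^i t^j`. -/
def evalA (d : Params R M L) (x y : R) : R := ∑ i, ∑ j, matA d i j * x ^ i.val * y ^ j.val

theorem opA_eq_zero_of_neg_right (d : Params R M L) {i j : ℤ} (hj : j < 0) :
    opA d (invRSubT R) i j = 0 := by
  have := opA_mem_rGe d.neg j i hj
  rw [← swapRT_opA_invRSubT] at this
  exact this

theorem opA_eq_zero_of_le_right (d : Params R M L) (hLM : 0 < L * M) {i j : ℤ}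
    (hj : ((L * M : ℕ) : ℤ) ≤ j) : opA d (invRSubT R) i j = 0 := by
  have := opA_mem_rLe d.neg hLM j i (by omega)
  rw [← swapRT_opA_invRSubT] at this
  exact this

theorem sub_mul_evalA {d : Params R M L} (h : d.β = 0) (hLM : 0 < L * M) (x y : R) :
    (x - y) * evalA d x y =
      x * (polyGS d.g d.s).eval y - y * (polyGS d.g d.s).eval x := by
  set N := L * M with hN
  set F := opA d (invRSubT R) with hF
  have e0 : evalA d x y = ∑ i ∈ Finset.range N, ∑ j ∈ Finset.range N, F i j * x ^ i * y ^ j := by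
    rw [evalA, Finset.sum_range]
    refine Finset.sum_congr rfl fun i _ => ?_
    rw [Finset.sum_range]
    rfl
  -- The ranges are enlarged to a common size for both products; the added row and column vanish by
  -- the bounds on the support of A.
  have e1 : x * evalA d x y = ∑ i ∈ Finset.range (N + 1), ∑ j ∈ Finset.range (N + 1),
      F ((i : ℤ) - 1) j * x ^ i * y ^ j := by
    rw [Finset.sum_range_succ', add_comm, Finset.sum_eq_zero, zero_add, e0, Finset.mul_sum]
    · refine Finset.sum_congr rfl fun i _ => ?_
      rw [Finset.sum_range_succ, hF, opA_eq_zero_of_le_right d hLM (le_of_eq rfl), zero_mul, zero_mul,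
        add_zero, Finset.mul_sum]
      refine Finset.sum_congr rfl fun j _ => ?_
      rw [show ((i + 1 : ℕ) : ℤ) - 1 = (i : ℤ) by push_cast; ring]
      ring
    · intro j _
      rw [hF, opA_mem_rGe d (((0 : ℕ) : ℤ) - 1) _ (by simp), zero_mul, zero_mul]
  have e2 : y * evalA d x y = ∑ i ∈ Finset.range (N + 1), ∑ j ∈ Finset.range (N + 1),
      F i ((j : ℤ) - 1) * x ^ i * y ^ j := by
    rw [Finset.sum_range_succ, add_comm, Finset.sum_eq_zero, zero_add, e0, Finset.mul_sum]
    · refine Finset.sum_congr rfl fun i _ => ?_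
      rw [Finset.sum_range_succ', hF, opA_eq_zero_of_neg_right d (j := ((0 : ℕ) : ℤ) - 1) (by simp), zero_mul, zero_mul,
        add_zero, Finset.mul_sum]
      refine Finset.sum_congr rfl fun j _ => ?_
      rw [show ((j + 1 : ℕ) : ℤ) - 1 = (j : ℤ) by push_cast; ring]
      ring
    · intro j _
      rw [hF, opA_mem_rLe d hLM _ _ (by omega), zero_mul, zero_mul]
  have hdeg : (polyGS d.g d.s).natDegree < N + 1 :=
    Nat.lt_succ_of_le (natDegree_polyGS_le d.g d.s)
  have h1 : 1 ∈ Finset.range (N + 1) := Finset.mem_range.2 (by omega)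
  rw [sub_mul, e1, e2, ← Finset.sum_sub_distrib]
  simp only [← Finset.sum_sub_distrib, ← sub_mul, hF, opA_recursion h]
  simp only [sub_mul, Finset.sum_sub_distrib, ite_mul, zero_mul]
  congr 1
  · simp only [Finset.sum_ite_irrel, Finset.sum_const_zero]
    rw [Finset.sum_ite_eq' _ _ _, if_pos h1, Polynomial.eval_eq_sum_range' hdeg, Finset.mul_sum]
    exact Finset.sum_congr rfl fun j _ => by ring
  · simp only [Finset.sum_ite_eq', if_pos h1]
    rw [Polynomial.eval_eq_sum_range' hdeg, Finset.mul_sum]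
    exact Finset.sum_congr rfl fun j _ => by ring

theorem evalA_self {d : Params R M L} (h : d.β = 0) (hLM : 0 < L * M) (w : R) :
    evalA d w w = (polySigma d.g d.s).eval w := by
  -- Division by x - y at x = y is replaced by differentiation: x becomes a variable, y = w stays
  -- constant, and the derivative at w gives A(w, w) = c(w) - w c'(w).
  have h1 := sub_mul_evalA (d := d.map Polynomial.C) (by simp [Params.map, h]) hLM
    Polynomial.X (Polynomial.C w)
  have hc : polyGS (d.map Polynomial.C).g (d.map Polynomial.C).s =
      (polyGS d.g d.s).map Polynomial.C := (polyGS_map _ _ _).symm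
  rw [hc, Polynomial.eval_map, Polynomial.eval_map, Polynomial.eval₂_at_apply,
    Polynomial.eval₂_C_X] at h1
  have h2 := congrArg (fun p => (Polynomial.derivative p).eval w) h1
  have h3 : (evalA (d.map Polynomial.C) Polynomial.X (Polynomial.C w)).eval w = evalA d w w := by
    simp [evalA, matA_map, Polynomial.eval_finsetSum]
  simp only [Polynomial.derivative_mul, Polynomial.derivative_sub, Polynomial.derivative_X,
    Polynomial.derivative_C, Polynomial.eval_add, Polynomial.eval_sub, Polynomial.eval_mul,
    Polynomial.eval_X, Polynomial.eval_C, Polynomial.eval_one, h3, Polynomial.eval_zero] at h2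
  rw [polySigma_eq, Polynomial.eval_sub, Polynomial.eval_mul, Polynomial.eval_X]
  linear_combination h2

theorem aeval_coe_series (p q : Polynomial R) :
    Polynomial.aeval (p : PowerSeries R) q = (q.comp p : Polynomial R) := by
  rw [← aeval_X_eq_coe, ← aeval_X_eq_coe, aeval_aeval]

/-- For u = S and β = 0, T_u is multiplication by (z/c) G(S) = z, so S(T_u) 1 = S. -/
theorem ricU_of_beta_eq_zero {d : Params R M L} (h : d.β = 0) :
    ricU d = (polyS d.s : PowerSeries R) := by
  symm
  apply eq_ricU
  rw [riccati, curveT, curveD, h, zero_smul, zero_add, aeval_mulLeft, aeval_coe_series,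
    Module.End.mul_eq_comp, ← LinearMap.mulLeft_mul]
  have h1 : PowerSeries.X * curveCInv d * (((weightG d.g).comp (polyS d.s) : Polynomial R) :
      PowerSeries R) = PowerSeries.X := by
    have := curveC_mul_inv d
    rw [curveC, polyGS] at this
    linear_combination PowerSeries.X * this
  rw [h1, aeval_mulLeft, aeval_X_eq_coe, LinearMap.mulLeft_apply, mul_one]

theorem pSer_of_beta_eq_zero {d : Params R M L} (h : d.β = 0) (m : ℕ) :
    pSer d m = PowerSeries.X ^ m := by
  induction m with
  | zero => rfl
  | succ m ih =>
    rw [pSer_succ, ih, ricU_of_beta_eq_zero h, curveT, curveD, h, zero_smul, zero_add,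
      aeval_mulLeft, aeval_coe_series, Module.End.mul_apply, LinearMap.mulLeft_apply,
      LinearMap.mulLeft_apply]
    have := curveC_mul_inv d
    rw [curveC, polyGS] at this
    linear_combination PowerSeries.X ^ (m + 1) * this

/-- Classically p_m = z^m for both signs, so the sum is the diagonal value A(z, z) = σ(z). -/
theorem kSer_of_beta_eq_zero {d : Params R M L} (h : d.β = 0) (hLM : 0 < L * M) :
    kSer d = curveSig d := by
  have h1 := evalA_self (d := d.map (PowerSeries.C (R := R))) (by simp [Params.map, h]) hLM
    PowerSeries.X
  have h2 : polySigma (d.map (PowerSeries.C (R := R))).g (d.map (PowerSeries.C (R := R))).s =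
      (polySigma d.g d.s).map PowerSeries.C := (polySigma_map _ _ _).symm
  have h3 : d.neg.β = 0 := by simp [Params.neg, h]
  rw [h2, Polynomial.eval_map, show (PowerSeries.C (R := R)) = algebraMap R (PowerSeries R) from rfl,
    ← Polynomial.aeval_def, aeval_X_eq_coe] at h1
  rw [curveSig, ← h1, kSer, evalA, matA_map]
  simp only [pSer_of_beta_eq_zero h, pSer_of_beta_eq_zero h3]
  rfl

theorem wkbMat_of_beta_eq_zero {d : Params R M L} (h : d.β = 0) (hLM : 0 < L * M)
    (i l : Fin (L * M)) :
    wkbMat d i l = PowerSeries.X ^ i.val * (curveSigInv d *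
      ∑ j : Fin (L * M), PowerSeries.C (matA d l j) * PowerSeries.X ^ j.val) := by
  have h3 : d.neg.β = 0 := by simp [Params.neg, h]
  simp only [wkbMat, Matrix.vecMulVec_apply, wkbCol, wkbRow, pSer_of_beta_eq_zero h,
    pSer_of_beta_eq_zero h3, qSer, kSer_of_beta_eq_zero h hLM, curveSigInv]

/-- At `β = 0` the matrix `A` intertwines `Ẽ` and the multiplication by `S`. -/
theorem sum_matB_sub_matC {d : Params R M L} (h : d.β = 0) (hLM : L < L * M) (w : R)
    (j : Fin (L * M)) :
    w * ∑ i : Fin (L * M), matB d i j * w ^ i.val -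
        (polyGS d.g d.s).eval w * ∑ i : Fin (L * M), matC d i j * w ^ i.val =
      w * (polyS d.s).eval w * ∑ i : Fin (L * M), matA d i j * w ^ i.val := by
  have hpoly : ∀ {f : BiSeries R}, f ∈ rLe R ((L * M : ℕ) - 1) → colSeries j f =
      ((∑ i : Fin (L * M), Polynomial.C (f i j) * Polynomial.X ^ i.val : Polynomial R) :
        PowerSeries R) := by
    intro f hf
    rw [colSeries_eq_sum _ hf, ← Polynomial.coeToPowerSeries.ringHom_apply, map_sum]
    simp [Polynomial.coeToPowerSeries.ringHom_apply]
  have hdelta : deltaPow d = LinearMap.mulLeft R (polyS d.s : PowerSeries R) := by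
    rw [deltaPow, h, zero_smul, add_zero]
  have hB := colSeries_opB d j
  have hC := colSeries_mulR j (serG_mem_rGe d)
  have hG := hpoly (rLe_mono (by omega) (serG_mem_rLe (k := R) d))
  -- All series involved are polynomials; the identity is brought back to polynomials so that it can
  -- be evaluated at an arbitrary point `w`.
  rw [hdelta, aeval_mulLeft, aeval_coe_series, LinearMap.mulLeft_apply, LinearMap.mulLeft_apply,
    hpoly (opB_mem_rLe d hLM), hpoly (opA_mem_rLe d (by omega)), hG, ← Polynomial.coe_mul,
    ← Polynomial.coe_mul, ← Polynomial.coe_add, Polynomial.coe_inj] at hB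
  rw [hpoly (mulR_serG_mem_rLe d hLM), hG, ← Polynomial.coe_X, ← Polynomial.coe_mul,
    Polynomial.coe_inj] at hC
  have hB' := congrArg (Polynomial.eval w) hB
  have hC' := congrArg (Polynomial.eval w) hC
  simp only [Polynomial.eval_add, Polynomial.eval_mul, Polynomial.eval_finsetSum,
    Polynomial.eval_C, Polynomial.eval_pow, Polynomial.eval_X] at hB' hC'
  simp only [matB, matC, matA_eq, coeffMat, Matrix.of_apply, hB', hC', polyGS]
  ring

end

/-! ### Coefficients of powers of `β` -/

section

variable {K : Type*} [CommRing K] {M L : ℕ}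

/-- The coefficient of `β^n` of a power series in `z` over the power series in `β`. -/
def bCoeff (n : ℕ) : PowerSeries (PowerSeries K) →+ PowerSeries K where
  toFun f := PowerSeries.mk fun m => PowerSeries.coeff n (PowerSeries.coeff m f)
  map_zero' := by ext; simp
  map_add' f g := by ext; simp

theorem coeff_bCoeff (n m : ℕ) (f : PowerSeries (PowerSeries K)) :
    PowerSeries.coeff m (bCoeff n f) = PowerSeries.coeff n (PowerSeries.coeff m f) :=
  PowerSeries.coeff_mk m fun m => PowerSeries.coeff n (PowerSeries.coeff m f)

theorem ext_bCoeff {f g : PowerSeries (PowerSeries K)} (h : ∀ n, bCoeff n f = bCoeff n g) :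
    f = g := by
  ext m n
  rw [← coeff_bCoeff, h, coeff_bCoeff]

theorem bCoeff_zero_eq_map (f : PowerSeries (PowerSeries K)) :
    bCoeff 0 f = PowerSeries.map PowerSeries.constantCoeff f := by
  ext m
  rw [coeff_bCoeff, PowerSeries.coeff_map, PowerSeries.coeff_zero_eq_constantCoeff_apply]

theorem bCoeff_mul (n : ℕ) (f g : PowerSeries (PowerSeries K)) :
    bCoeff n (f * g) = ∑ x ∈ Finset.HasAntidiagonal.antidiagonal n, bCoeff x.1 f * bCoeff x.2 g := by
  ext m
  rw [coeff_bCoeff, PowerSeries.coeff_mul, map_sum, map_sum]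
  simp only [PowerSeries.coeff_mul, coeff_bCoeff]
  rw [Finset.sum_comm]

theorem bCoeff_C (n : ℕ) (r : PowerSeries K) :
    bCoeff n (PowerSeries.C r) = PowerSeries.C (PowerSeries.coeff n r) := by
  ext m
  rw [coeff_bCoeff, PowerSeries.coeff_C, PowerSeries.coeff_C]
  split_ifs <;> simp

theorem bCoeff_map_C (n : ℕ) (f : PowerSeries K) :
    bCoeff n (PowerSeries.map PowerSeries.C f) = if n = 0 then f else 0 := by
  ext m
  rw [coeff_bCoeff, PowerSeries.coeff_map, PowerSeries.coeff_C]
  split_ifs <;> simp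

theorem bCoeff_C_X_pow_mul (n j : ℕ) (f : PowerSeries (PowerSeries K)) :
    bCoeff j (PowerSeries.C (PowerSeries.X ^ n : PowerSeries K) * f) =
      if n ≤ j then bCoeff (j - n) f else 0 := by
  ext m
  rw [coeff_bCoeff, PowerSeries.coeff_C_mul, PowerSeries.coeff_X_pow_mul']
  split_ifs <;> simp [coeff_bCoeff]

theorem bCoeff_eulerX (n : ℕ) (f : PowerSeries (PowerSeries K)) :
    bCoeff n (eulerX (PowerSeries K) f) = eulerX K (bCoeff n f) := by
  ext m
  rw [coeff_bCoeff, coeff_eulerX, coeff_eulerX, coeff_bCoeff, ← map_natCast (PowerSeries.C (R := K)),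
    PowerSeries.coeff_C_mul]

theorem exists_eq_C_X_pow_mul {n : ℕ} {f : PowerSeries (PowerSeries K)}
    (h : ∀ j < n, bCoeff j f = 0) :
    ∃ g, f = PowerSeries.C (PowerSeries.X ^ n : PowerSeries K) * g := by
  refine ⟨PowerSeries.mk fun m => PowerSeries.mk fun j =>
    PowerSeries.coeff (j + n) (PowerSeries.coeff m f), ?_⟩
  ext m j
  rw [PowerSeries.coeff_C_mul, PowerSeries.coeff_X_pow_mul', PowerSeries.coeff_mk,
    PowerSeries.coeff_mk]
  split_ifs with hj
  · rw [Nat.sub_add_cancel hj]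
  · rw [← coeff_bCoeff, h j (not_le.1 hj), map_zero]

/-! ### Rational functions with poles at the roots of `σ` -/

/-- The power series `f` such that `σ^n f` is a polynomial for some `n`. -/
def ratRing (σ : Polynomial K) : Subring (PowerSeries K) where
  carrier := {f | ∃ (n : ℕ) (P : Polynomial K), (σ : PowerSeries K) ^ n * f = P}
  mul_mem' := by
    rintro f g ⟨n, P, hP⟩ ⟨m, Q, hQ⟩
    refine ⟨n + m, P * Q, ?_⟩
    rw [Polynomial.coe_mul, ← hP, ← hQ]
    ring
  one_mem' := ⟨0, 1, by simp⟩
  add_mem' := by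
    rintro f g ⟨n, P, hP⟩ ⟨m, Q, hQ⟩
    refine ⟨n + m, σ ^ m * P + σ ^ n * Q, ?_⟩
    rw [Polynomial.coe_add, Polynomial.coe_mul, Polynomial.coe_mul, ← hP, ← hQ,
      Polynomial.coe_pow, Polynomial.coe_pow]
    ring
  zero_mem' := ⟨0, 0, by simp⟩
  neg_mem' := by
    rintro f ⟨n, P, hP⟩
    exact ⟨n, -P, by rw [Polynomial.coe_neg, ← hP, mul_neg]⟩

theorem coe_mem_ratRing (σ p : Polynomial K) : (p : PowerSeries K) ∈ ratRing σ :=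
  ⟨0, p, by simp⟩

theorem eulerX_coe (p : Polynomial K) :
    eulerX K (p : PowerSeries K) = (Polynomial.X * Polynomial.derivative p : Polynomial K) := by
  rw [eulerX_apply, PowerSeries.derivative_coe]
  simp

theorem eulerX_pow_mul (f : PowerSeries K) (n : ℕ) :
    f * eulerX K (f ^ n) = n * f ^ n * eulerX K f := by
  induction n with
  | zero =>
    have : PowerSeries.derivative K (1 : PowerSeries K) = 0 :=
      (PowerSeries.derivative K).map_one_eq_zero
    simp [eulerX_apply, this]
  | succ n ih =>
    rw [pow_succ, eulerX_mul]
    push_cast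
    linear_combination f * ih

theorem eulerX_mem_ratRing {σ : Polynomial K} {f : PowerSeries K} (hf : f ∈ ratRing σ) :
    eulerX K f ∈ ratRing σ := by
  obtain ⟨n, P, hP⟩ := hf
  -- Quotient rule: apply z d/dz to σⁿ f = P and multiply by σ.
  refine ⟨n + 1, σ * (Polynomial.X * Polynomial.derivative P) -
    (n : Polynomial K) * (Polynomial.X * Polynomial.derivative σ) * P, ?_⟩
  have h1 := congrArg (eulerX K) hP
  rw [eulerX_mul] at h1
  have h2 := eulerX_pow_mul (σ : PowerSeries K) n
  rw [Polynomial.coe_sub, Polynomial.coe_mul, Polynomial.coe_mul _ P,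
    Polynomial.coe_mul (n : Polynomial K), ← eulerX_coe, ← eulerX_coe,
    ← Polynomial.coeToPowerSeries.ringHom_apply (φ := (n : Polynomial K)), map_natCast]
  linear_combination (σ : PowerSeries K) * h1 - f * h2 - n * eulerX K (σ : PowerSeries K) * hP

/-- The double series whose coefficients in `β` lie in a given subring. -/
def bRing (A : Subring (PowerSeries K)) : Subring (PowerSeries (PowerSeries K)) where
  carrier := {f | ∀ n, bCoeff n f ∈ A}
  mul_mem' := by
    intro f g hf hg n
    rw [bCoeff_mul]
    exact A.sum_mem fun x _ => A.mul_mem (hf _) (hg _)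
  one_mem' n := by
    rw [← map_one (PowerSeries.map (PowerSeries.C (R := K))), bCoeff_map_C]
    split_ifs
    exacts [A.one_mem, A.zero_mem]
  add_mem' := by
    intro f g hf hg n
    rw [map_add]
    exact A.add_mem (hf n) (hg n)
  zero_mem' n := by
    rw [map_zero]
    exact A.zero_mem
  neg_mem' := by
    intro f hf n
    rw [map_neg]
    exact A.neg_mem (hf n)

theorem map_C_mem_bRing {A : Subring (PowerSeries K)} {f : PowerSeries K} (hf : f ∈ A) :
    PowerSeries.map PowerSeries.C f ∈ bRing A := fun n => by
  rw [bCoeff_map_C]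
  split_ifs
  exacts [hf, A.zero_mem]

theorem C_mem_bRing (σ : Polynomial K) (r : PowerSeries K) :
    PowerSeries.C r ∈ bRing (ratRing σ) := fun n => by
  rw [bCoeff_C, ← Polynomial.coe_C]
  exact coe_mem_ratRing _ _

/-- The recursion for the coefficients of an inverse divides only by the leading coefficient. -/
theorem inv_mem_bRing {A : Subring (PowerSeries K)} {f g : PowerSeries (PowerSeries K)}
    {c : PowerSeries K} (hf : f ∈ bRing A) (hfg : f * g = 1) (hc : c ∈ A)
    (h0 : bCoeff 0 f * c = 1) : g ∈ bRing A := by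
  intro n
  induction n using Nat.strong_induction_on with
  | _ n ih =>
    have h1 := bCoeff_mul n f g
    rw [Finset.Nat.sum_antidiagonal_eq_sum_range_succ_mk, Finset.sum_range_succ', hfg,
      Nat.sub_zero] at h1
    have h2 : bCoeff n g = c * (bCoeff n 1 -
        ∑ i ∈ Finset.range n, bCoeff (i + 1) f * bCoeff (n - (i + 1)) g) := by
      linear_combination -(bCoeff n g) * h0 - c * h1
    rw [h2]
    refine A.mul_mem hc (A.sub_mem ((bRing A).one_mem n) (A.sum_mem fun i hi => ?_))
    have := Finset.mem_range.1 hi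
    exact A.mul_mem (hf _) (ih _ (by omega))

end

/-! ### The regularized form of the Riccati equation -/

section

variable {R : Type*} [CommRing R] {M L : ℕ}

/-- The operator `β (z/σ) d/dz + v`. -/
def nab (d : Params R M L) (v : PowerSeries R) : Module.End R (PowerSeries R) :=
  d.β • (LinearMap.mulLeft R (curveSigInv d) * eulerX R) + LinearMap.mulLeft R v

/-- The operator `S(z) + G(S(z)) (β (z/σ) d/dz + v)`. -/
def lin (d : Params R M L) (v : PowerSeries R) : Module.End R (PowerSeries R) :=
  LinearMap.mulLeft R (polyS d.s : PowerSeries R) + LinearMap.mulLeft R (curveC d) * nab d v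

/-- The quotient of `(S + c ∇)^n - S^n` by `c = G(S(z))`. -/
def qOp (d : Params R M L) (v : PowerSeries R) : ℕ → Module.End R (PowerSeries R)
  | 0 => 0
  | n + 1 => LinearMap.mulLeft R (polyS d.s : PowerSeries R) * qOp d v n + nab d v * lin d v ^ n

/-- The operator `z (1 + ∑ gₙ Qₙ)`. -/
def tOp (d : Params R M L) (v : PowerSeries R) : Module.End R (PowerSeries R) :=
  LinearMap.mulLeft R PowerSeries.X * (1 + (weightG d.g).sum fun n c => c • qOp d v n)

theorem lin_pow (d : Params R M L) (v : PowerSeries R) (n : ℕ) :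
    lin d v ^ n = LinearMap.mulLeft R (polyS d.s : PowerSeries R) ^ n +
      LinearMap.mulLeft R (curveC d) * qOp d v n := by
  induction n with
  | zero => simp [qOp]
  | succ n ih =>
    have hc : LinearMap.mulLeft R (polyS d.s : PowerSeries R) * LinearMap.mulLeft R (curveC d) =
        LinearMap.mulLeft R (curveC d) * LinearMap.mulLeft R (polyS d.s : PowerSeries R) := by
      ext1 x
      simp only [Module.End.mul_apply, LinearMap.mulLeft_apply]
      ring
    have h1 : lin d v ^ (n + 1) = LinearMap.mulLeft R (polyS d.s : PowerSeries R) * lin d v ^ n +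
        LinearMap.mulLeft R (curveC d) * (nab d v * lin d v ^ n) := by
      rw [pow_succ', ← mul_assoc, ← add_mul]
      rfl
    rw [h1, qOp]
    nth_rewrite 1 [ih]
    rw [mul_add, mul_add, ← mul_assoc, hc, mul_assoc, ← pow_succ', add_assoc]

/-- With u = S + c v, D + u equals S + c ∇, whose powers are Sⁿ + c Qₙ. Hence G(D + u) = c (1 + ∑ gₙ
Qₙ), and the denominator c of T cancels. This is why zeros of G(S(z)) are not poles. -/
theorem curveT_eq_tOp (d : Params R M L) (v : PowerSeries R) :
    curveT d ((polyS d.s : PowerSeries R) + curveC d * v) = tOp d v := by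
  have h1 : curveD d + LinearMap.mulLeft R ((polyS d.s : PowerSeries R) + curveC d * v) =
      lin d v := by
    ext1 x
    simp only [curveD_apply, lin, nab, LinearMap.add_apply, LinearMap.mulLeft_apply,
      Module.End.mul_apply, LinearMap.smul_apply, PowerSeries.smul_eq_C_mul]
    ring
  have h2 : Polynomial.aeval (lin d v) (weightG d.g) = LinearMap.mulLeft R (curveC d) *
      (1 + (weightG d.g).sum fun n c => c • qOp d v n) := by
    have h3 : Polynomial.aeval (LinearMap.mulLeft R (polyS d.s : PowerSeries R)) (weightG d.g) =
        LinearMap.mulLeft R (curveC d) := by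
      rw [aeval_mulLeft, aeval_coe_series]
      rfl
    rw [mul_add, mul_one]
    nth_rewrite 1 [← h3]
    rw [Polynomial.aeval_def, Polynomial.aeval_def, Polynomial.eval₂_eq_sum,
      Polynomial.eval₂_eq_sum, Polynomial.sum_def, Polynomial.sum_def, Polynomial.sum_def,
      Finset.mul_sum, ← Finset.sum_add_distrib]
    refine Finset.sum_congr rfl fun n _ => ?_
    rw [lin_pow, mul_add, mul_smul_comm, ← Algebra.smul_def, ← Algebra.smul_def]
  rw [curveT, h1, h2, ← mul_assoc, tOp]
  congr 1
  ext1 x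
  simp only [Module.End.mul_apply, LinearMap.mulLeft_apply]
  linear_combination PowerSeries.X * x * curveC_mul_inv d

theorem apply_C_mul (A : Module.End R (PowerSeries R)) (r : R) (f : PowerSeries R) :
    A (PowerSeries.C r * f) = PowerSeries.C r * A f := by
  rw [← PowerSeries.smul_eq_C_mul, map_smul, PowerSeries.smul_eq_C_mul]

/-- The operators `A` and `A'` act modulo `b` as the multiplication by `x`, and `A'` differs from
`A` by `b^n w y` modulo `b^(n+1)`. -/
structure Perturb (b : R) (n : ℕ) (w : PowerSeries R) (A A' : Module.End R (PowerSeries R))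
    (x y : PowerSeries R) : Prop where
  symbol : ∀ f, ∃ h, A f = x * f + PowerSeries.C b * h
  diff : ∀ f, ∃ h, A' f = A f + PowerSeries.C (b ^ n) * (y * w * f) + PowerSeries.C (b ^ (n + 1)) * h

namespace Perturb

variable {b : R} {n : ℕ} {w : PowerSeries R} {A A' B B' : Module.End R (PowerSeries R)}
  {x y x' y' : PowerSeries R}

theorem mulLeft (a : PowerSeries R) :
    Perturb b n w (LinearMap.mulLeft R a) (LinearMap.mulLeft R a) a 0 :=
  ⟨fun f => ⟨0, by simp⟩, fun f => ⟨0, by simp⟩⟩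

theorem zero : Perturb b n w 0 0 0 0 := ⟨fun f => ⟨0, by simp⟩, fun f => ⟨0, by simp⟩⟩

theorem one : Perturb b n w 1 1 1 0 := ⟨fun f => ⟨0, by simp⟩, fun f => ⟨0, by simp⟩⟩

theorem add (hA : Perturb b n w A A' x y) (hB : Perturb b n w B B' x' y') :
    Perturb b n w (A + B) (A' + B') (x + x') (y + y') := by
  constructor
  · intro f
    obtain ⟨h, hh⟩ := hA.symbol f
    obtain ⟨h', hh'⟩ := hB.symbol f
    exact ⟨h + h', by rw [LinearMap.add_apply, hh, hh']; ring⟩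
  · intro f
    obtain ⟨h, hh⟩ := hA.diff f
    obtain ⟨h', hh'⟩ := hB.diff f
    exact ⟨h + h', by rw [LinearMap.add_apply, LinearMap.add_apply, hh, hh']; ring⟩

theorem smul (c : R) (hA : Perturb b n w A A' x y) :
    Perturb b n w (c • A) (c • A') (c • x) (c • y) := by
  constructor
  · intro f
    obtain ⟨h, hh⟩ := hA.symbol f
    refine ⟨PowerSeries.C c * h, ?_⟩
    simp only [LinearMap.smul_apply, hh, PowerSeries.smul_eq_C_mul]
    ring
  · intro f
    obtain ⟨h, hh⟩ := hA.diff f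
    refine ⟨PowerSeries.C c * h, ?_⟩
    simp only [LinearMap.smul_apply, hh, PowerSeries.smul_eq_C_mul]
    ring

/-- Leibniz rule for the first variation: since the operators act modulo `b` as multiplications,
their symbols commute, and the product of the two variations is of order b^(2n). -/
theorem mul (hn : 1 ≤ n) (hA : Perturb b n w A A' x y) (hB : Perturb b n w B B' x' y') :
    Perturb b n w (A * B) (A' * B') (x * x') (x * y' + y * x') := by
  constructor
  · intro f
    obtain ⟨h, hh⟩ := hB.symbol f
    obtain ⟨h', hh'⟩ := hA.symbol (x' * f)
    refine ⟨h' + A h, ?_⟩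
    rw [Module.End.mul_apply, hh, map_add, apply_C_mul, hh']
    ring
  · intro f
    -- With n = m + 1, the quadratic term b^(2n) is b^m times the allowed error b^(n+1).
    obtain ⟨m, rfl⟩ := Nat.exists_eq_add_of_le' hn
    obtain ⟨h1, e1⟩ := hB.diff f
    obtain ⟨h2, e2⟩ := hA.diff (B f)
    obtain ⟨h3, e3⟩ := hB.symbol f
    obtain ⟨h4, e4⟩ := hA.diff (y' * w * f)
    obtain ⟨h5, e5⟩ := hA.symbol (y' * w * f)
    refine ⟨A' h1 + h2 + y * w * h3 + h5 + PowerSeries.C (b ^ m) * (y * w * (y' * w * f)) +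
      PowerSeries.C (b ^ (m + 1)) * h4, ?_⟩
    rw [Module.End.mul_apply, Module.End.mul_apply, e1, map_add, map_add, apply_C_mul,
      apply_C_mul, e4, e5, e2]
    nth_rewrite 2 [e3]
    simp only [map_pow]
    ring

theorem pow (hn : 1 ≤ n) (hA : Perturb b n w A A' x y) (m : ℕ) :
    Perturb b n w (A ^ m) (A' ^ m) (x ^ m) (m * x ^ (m - 1) * y) := by
  induction m with
  | zero => simpa using one
  | succ m ih =>
    have := hA.mul hn ih
    rw [← pow_succ', ← pow_succ', ← pow_succ'] at this
    convert this using 1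
    cases m with
    | zero => simp
    | succ m =>
      push_cast
      ring

theorem sum {ι : Type*} (s : Finset ι) {F F' : ι → Module.End R (PowerSeries R)}
    {u v : ι → PowerSeries R} (h : ∀ i ∈ s, Perturb b n w (F i) (F' i) (u i) (v i)) :
    Perturb b n w (∑ i ∈ s, F i) (∑ i ∈ s, F' i) (∑ i ∈ s, u i) (∑ i ∈ s, v i) := by
  classical
  induction s using Finset.induction_on with
  | empty => simpa using zero
  | insert i s hi ih =>
    rw [Finset.sum_insert hi, Finset.sum_insert hi, Finset.sum_insert hi, Finset.sum_insert hi]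
    exact (h i (Finset.mem_insert_self i s)).add
      (ih fun j hj => h j (Finset.mem_insert_of_mem hj))

end Perturb

theorem sum_smul_pow (p : Polynomial R) (x : PowerSeries R) :
    (∑ m ∈ p.support, p.coeff m • x ^ m) = Polynomial.aeval x p := by
  rw [Polynomial.aeval_def, Polynomial.eval₂_eq_sum, Polynomial.sum_def]
  exact Finset.sum_congr rfl fun m _ => Algebra.smul_def _ _

theorem sum_smul_mul_pow (p : Polynomial R) (x : PowerSeries R) :
    (∑ m ∈ p.support, p.coeff m • ((m : PowerSeries R) * x ^ (m - 1))) =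
      Polynomial.aeval x (Polynomial.derivative p) := by
  rw [Polynomial.derivative_apply, Polynomial.sum_def, map_sum]
  refine Finset.sum_congr rfl fun m _ => ?_
  rw [map_mul, Polynomial.aeval_C, map_pow, Polynomial.aeval_X, Algebra.smul_def, map_mul,
    map_natCast, mul_assoc]

theorem Perturb.aeval {b : R} {n : ℕ} (hn : 1 ≤ n) {w : PowerSeries R}
    {A A' : Module.End R (PowerSeries R)} {x y : PowerSeries R} (hA : Perturb b n w A A' x y)
    (p : Polynomial R) : Perturb b n w (Polynomial.aeval A p) (Polynomial.aeval A' p)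
      (Polynomial.aeval x p) (Polynomial.aeval x (Polynomial.derivative p) * y) := by
  have h := Perturb.sum p.support (w := w) (b := b) (n := n) fun m _ =>
    (hA.pow hn m).smul (p.coeff m)
  rw [sum_smul_pow] at h
  convert h using 1
  · rw [Polynomial.aeval_def, Polynomial.eval₂_eq_sum, Polynomial.sum_def]
    exact Finset.sum_congr rfl fun m _ => (Algebra.smul_def _ _).symm
  · rw [Polynomial.aeval_def, Polynomial.eval₂_eq_sum, Polynomial.sum_def]
    exact Finset.sum_congr rfl fun m _ => (Algebra.smul_def _ _).symm
  · rw [← sum_smul_mul_pow, Finset.sum_mul]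
    exact Finset.sum_congr rfl fun m _ => smul_mul_assoc _ _ _

/-- Both β and v are multiples of `b`, so the symbol of ∇ is 0, while its variation in the direction
w is w itself. -/
theorem perturb_nab (d : Params R M L) {b b' : R} (hb : d.β = b * b') {n : ℕ}
    (v w : PowerSeries R) (hv : ∃ h, v = PowerSeries.C b * h) :
    Perturb b n w (nab d v) (nab d (v + PowerSeries.C (b ^ n) * w)) 0 1 := by
  constructor
  · intro f
    obtain ⟨h, rfl⟩ := hv
    refine ⟨PowerSeries.C b' * (curveSigInv d * eulerX R f) + h * f, ?_⟩
    simp only [nab, LinearMap.add_apply, LinearMap.smul_apply, Module.End.mul_apply,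
      LinearMap.mulLeft_apply, PowerSeries.smul_eq_C_mul, hb, map_mul]
    ring
  · intro f
    refine ⟨0, ?_⟩
    simp only [nab, LinearMap.add_apply, LinearMap.smul_apply, Module.End.mul_apply,
      LinearMap.mulLeft_apply]
    ring

/-- The variation of Qₘ is m S^(m-1), whence z ∑ gₘ m S^(m-1) = z G'(S) for the whole operator. -/
theorem perturb_tOp (d : Params R M L) {b b' : R} (hb : d.β = b * b') {n : ℕ} (hn : 1 ≤ n)
    (v w : PowerSeries R) (hv : ∃ h, v = PowerSeries.C b * h) :
    Perturb b n w (tOp d v) (tOp d (v + PowerSeries.C (b ^ n) * w)) PowerSeries.X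
      (PowerSeries.X * Polynomial.aeval (polyS d.s : PowerSeries R)
        (Polynomial.derivative (weightG d.g))) := by
  have hnab := perturb_nab d hb (n := n) v w hv
  have hlin : Perturb b n w (lin d v) (lin d (v + PowerSeries.C (b ^ n) * w))
      (polyS d.s : PowerSeries R) (curveC d) := by
    have := (Perturb.mulLeft (b := b) (n := n) (w := w) (polyS d.s : PowerSeries R)).add
      ((Perturb.mulLeft (curveC d)).mul hn hnab)
    simp only [mul_zero, add_zero, mul_one, zero_add] at this
    exact this
  have hQ : ∀ m, Perturb b n w (qOp d v m) (qOp d (v + PowerSeries.C (b ^ n) * w) m) 0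
      (m * (polyS d.s : PowerSeries R) ^ (m - 1)) := by
    intro m
    induction m with
    | zero => simpa [qOp] using Perturb.zero
    | succ m ih =>
      have := ((Perturb.mulLeft (polyS d.s : PowerSeries R)).mul hn ih).add
        (hnab.mul hn (hlin.pow hn m))
      rw [qOp, qOp]
      convert this using 1
      · ring
      · cases m with
        | zero => simp
        | succ m =>
          push_cast
          ring
  have h := (Perturb.mulLeft PowerSeries.X).mul hn (Perturb.one.add
    (Perturb.sum (weightG d.g).support (w := w) (b := b) (n := n) fun m _ =>
      (hQ m).smul ((weightG d.g).coeff m)))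
  rw [sum_smul_mul_pow] at h
  rw [tOp, tOp, Polynomial.sum_def, Polynomial.sum_def]
  convert h using 1
  · simp
  · ring

theorem curveC_congr {d d' : Params R M L} (hg : d.g = d'.g) (hs : d.s = d'.s) :
    curveC d = curveC d' := by
  rw [curveC, curveC, hg, hs]

theorem curveSig_congr {d d' : Params R M L} (hg : d.g = d'.g) (hs : d.s = d'.s) :
    curveSig d = curveSig d' := by
  rw [curveSig, curveSig, hg, hs]

theorem curveSigInv_congr {d d' : Params R M L} (hg : d.g = d'.g) (hs : d.s = d'.s) :
    curveSigInv d = curveSigInv d' := by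
  rw [curveSigInv, curveSigInv, curveSig_congr hg hs]

/-- In this form σ is the linearisation in v of S + c v - S(T) 1: the term c from c v, minus S'(z) ·
z G'(S) from S(T). -/
theorem curveSig_eq (d : Params R M L) : curveSig d = curveC d -
    Polynomial.aeval PowerSeries.X (Polynomial.derivative (polyS d.s)) *
      (PowerSeries.X * Polynomial.aeval (polyS d.s : PowerSeries R)
        (Polynomial.derivative (weightG d.g))) := by
  rw [aeval_X_eq_coe, aeval_coe_series, curveSig, curveC, polySigma]
  simp only [Polynomial.coe_sub, Polynomial.coe_mul, Polynomial.coe_X]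
  ring

theorem regularized_riccati (d : Params R M L) :
    (polyS d.s : PowerSeries R) +
        curveC d * (curveCInv d * (ricU d - (polyS d.s : PowerSeries R))) = ricU d := by
  linear_combination (ricU d - (polyS d.s : PowerSeries R)) * curveC_mul_inv d

end

/-! ### Expansion in powers of β and rationality of the coefficients. -/

section

variable {K : Type*} [CommRing K] {M L : ℕ}

/-- The parameters over the power series in `β`, with `g`, `s` constant and `β` replaced by
`β b`. -/
def betaParams (d : Params K M L) (b : PowerSeries K) : Params (PowerSeries K) M L :=
  { d.map PowerSeries.C with β := PowerSeries.X * b }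

theorem betaParams_neg (d : Params K M L) (b : PowerSeries K) :
    (betaParams d b).neg = betaParams d (-b) := by
  simp [Params.neg, betaParams]

/-- The parameters with `β = 0`. -/
def Params.classical (d : Params K M L) : Params K M L := { d with β := 0 }

theorem betaParams_map (d : Params K M L) (b : PowerSeries K) :
    (betaParams d b).map PowerSeries.constantCoeff = d.classical := by
  simp [betaParams, Params.map, Params.classical]

theorem coe_polyS_betaParams (d : Params K M L) (b : PowerSeries K) :
    (polyS (betaParams d b).s : PowerSeries (PowerSeries K)) =
      PowerSeries.map PowerSeries.C (polyS d.s : PowerSeries K) := by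
  rw [map_coe, polyS_map]
  rfl

theorem curveC_betaParams (d : Params K M L) (b : PowerSeries K) :
    curveC (betaParams d b) = PowerSeries.map PowerSeries.C (curveC d) := by
  rw [map_curveC]
  exact curveC_congr rfl rfl

theorem curveSig_betaParams (d : Params K M L) (b : PowerSeries K) :
    curveSig (betaParams d b) = PowerSeries.map PowerSeries.C (curveSig d) := by
  rw [map_curveSig]
  exact curveSig_congr rfl rfl

theorem curveSigInv_betaParams (d : Params K M L) (b : PowerSeries K) :
    curveSigInv (betaParams d b) = PowerSeries.map PowerSeries.C (curveSigInv d) := by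
  rw [map_curveSigInv]
  exact curveSigInv_congr rfl rfl

/-- The rational functions with poles at the ramification points. -/
abbrev curveRing (d : Params K M L) : Subring (PowerSeries K) := ratRing (polySigma d.g d.s)

theorem curveSigInv_mem (d : Params K M L) : curveSigInv d ∈ curveRing d :=
  ⟨1, 1, by rw [pow_one, Polynomial.coe_one]; exact curveSig_mul_inv d⟩

theorem mul_C_mem_bRing {σ : Polynomial K} (r : PowerSeries K)
    {f : PowerSeries (PowerSeries K)} (hf : f ∈ bRing (ratRing σ)) :
    PowerSeries.C r * f ∈ bRing (ratRing σ) :=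
  Subring.mul_mem _ (C_mem_bRing σ r) hf

/-- The only denominator in `tOp` is σ, and the ring of rational functions with poles at the roots
of σ is stable under z d/dz. -/
theorem tOp_mem_bRing (d : Params K M L) (b : PowerSeries K) {v : PowerSeries (PowerSeries K)}
    (hv : v ∈ bRing (curveRing d)) {f : PowerSeries (PowerSeries K)}
    (hf : f ∈ bRing (curveRing d)) : tOp (betaParams d b) v f ∈ bRing (curveRing d) := by
  have hS : (polyS (betaParams d b).s : PowerSeries (PowerSeries K)) ∈ bRing (curveRing d) := by
    rw [coe_polyS_betaParams]
    exact map_C_mem_bRing (coe_mem_ratRing _ _)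
  have hc : curveC (betaParams d b) ∈ bRing (curveRing d) := by
    rw [curveC_betaParams]
    exact map_C_mem_bRing (coe_mem_ratRing _ _)
  have hnab : ∀ f ∈ bRing (curveRing d), nab (betaParams d b) v f ∈ bRing (curveRing d) := by
    intro f hf
    rw [nab, LinearMap.add_apply, LinearMap.smul_apply, Module.End.mul_apply,
      LinearMap.mulLeft_apply, LinearMap.mulLeft_apply, PowerSeries.smul_eq_C_mul,
      curveSigInv_betaParams]
    refine Subring.add_mem _ (mul_C_mem_bRing _ (Subring.mul_mem _
      (map_C_mem_bRing (curveSigInv_mem d)) fun n => ?_)) (Subring.mul_mem _ hv hf)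
    rw [bCoeff_eulerX]
    exact eulerX_mem_ratRing (hf n)
  have hlin : ∀ m, ∀ f ∈ bRing (curveRing d),
      (lin (betaParams d b) v ^ m) f ∈ bRing (curveRing d) := by
    intro m f hf
    induction m with
    | zero => exact hf
    | succ m ih =>
      rw [pow_succ', Module.End.mul_apply]
      exact Subring.add_mem _ (Subring.mul_mem _ hS ih) (Subring.mul_mem _ hc (hnab _ ih))
  have hQ : ∀ m, qOp (betaParams d b) v m f ∈ bRing (curveRing d) := by
    intro m
    induction m with
    | zero => exact Subring.zero_mem _
    | succ m ih => exact Subring.add_mem _ (Subring.mul_mem _ hS ih) (hnab _ (hlin m f hf))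
  have hX : (PowerSeries.X : PowerSeries (PowerSeries K)) ∈ bRing (curveRing d) := by
    have := map_C_mem_bRing (coe_mem_ratRing (polySigma d.g d.s) Polynomial.X)
    rwa [Polynomial.coe_X, PowerSeries.map_X] at this
  rw [tOp, Module.End.mul_apply, LinearMap.mulLeft_apply, LinearMap.add_apply, Polynomial.sum_def,
    LinearMap.sum_apply]
  refine Subring.mul_mem _ hX (Subring.add_mem _ hf (Subring.sum_mem _ fun m _ => ?_))
  rw [LinearMap.smul_apply, PowerSeries.smul_eq_C_mul]
  exact mul_C_mem_bRing _ (hQ m)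

theorem tOp_pow_mem_bRing (d : Params K M L) (b : PowerSeries K)
    {v : PowerSeries (PowerSeries K)} (hv : v ∈ bRing (curveRing d)) (m : ℕ) :
    (tOp (betaParams d b) v ^ m) 1 ∈ bRing (curveRing d) := by
  induction m with
  | zero => exact Subring.one_mem _
  | succ m ih =>
    rw [pow_succ', Module.End.mul_apply]
    exact tOp_mem_bRing d b hv ih

theorem aeval_tOp_mem_bRing (d : Params K M L) (b : PowerSeries K)
    {v : PowerSeries (PowerSeries K)} (hv : v ∈ bRing (curveRing d))
    (p : Polynomial (PowerSeries K)) :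
    Polynomial.aeval (tOp (betaParams d b) v) p 1 ∈ bRing (curveRing d) := by
  rw [Polynomial.aeval_eq_sum_range, LinearMap.sum_apply]
  refine Subring.sum_mem _ fun m _ => ?_
  rw [LinearMap.smul_apply, PowerSeries.smul_eq_C_mul]
  exact mul_C_mem_bRing _ (tOp_pow_mem_bRing d b hv m)

/-- The correction `v` in `u = S(z) + G(S(z)) v`. -/
def ricV (d : Params K M L) (b : PowerSeries K) : PowerSeries (PowerSeries K) :=
  curveCInv (betaParams d b) * (ricU (betaParams d b) - (polyS (betaParams d b).s :
    PowerSeries (PowerSeries K)))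

theorem bCoeff_zero_ricV (d : Params K M L) (b : PowerSeries K) : bCoeff 0 (ricV d b) = 0 := by
  have h : (fun i => PowerSeries.constantCoeff ((betaParams d b).s i)) = d.classical.s := by
    funext i
    simp [betaParams, Params.map, Params.classical]
  rw [bCoeff_zero_eq_map, ricV, map_mul, map_sub, map_ricU, betaParams_map,
    ricU_of_beta_eq_zero rfl, map_coe, polyS_map, h, sub_self, mul_zero]

theorem curveT_ricU (d : Params K M L) (b : PowerSeries K) :
    curveT (betaParams d b) (ricU (betaParams d b)) = tOp (betaParams d b) (ricV d b) := by
  rw [← curveT_eq_tOp, ricV, regularized_riccati]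

/-- Induction on the power of β: in the Riccati equation the coefficient of βⁿ of v occurs linearly
with factor σ, and everything else is built from lower coefficients. -/
theorem ricV_mem_bRing (d : Params K M L) (b : PowerSeries K) : ricV d b ∈ bRing (curveRing d) := by
  intro n
  induction n using Nat.strong_induction_on with
  | _ n ih =>
    rcases Nat.eq_zero_or_pos n with rfl | hn
    · rw [bCoeff_zero_ricV]
      exact Subring.zero_mem _
    set v := ricV d b with hv
    -- The truncation of v below βⁿ, whose coefficients are covered by the induction hypothesis;
    -- then v = v0 + βⁿ w.
    let v0 : PowerSeries (PowerSeries K) := PowerSeries.mk fun m => PowerSeries.mk fun j =>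
      if j < n then PowerSeries.coeff j (PowerSeries.coeff m v) else 0
    have hv0 : ∀ j, bCoeff j v0 = if j < n then bCoeff j v else 0 := by
      intro j
      ext m
      rw [coeff_bCoeff, PowerSeries.coeff_mk, PowerSeries.coeff_mk]
      split_ifs <;> simp [coeff_bCoeff]
    have hv0mem : v0 ∈ bRing (curveRing d) := by
      intro j
      rw [hv0]
      split_ifs with hj
      exacts [ih j hj, Subring.zero_mem _]
    obtain ⟨w, hw⟩ := exists_eq_C_X_pow_mul (n := n) (f := v - v0) fun j hj => by
      rw [map_sub, hv0, if_pos hj, sub_self]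
    obtain ⟨h, hh⟩ := exists_eq_C_X_pow_mul (n := 1) (f := v0) fun j hj => by
      obtain rfl : j = 0 := by omega
      rw [hv0, if_pos hn, bCoeff_zero_ricV]
    rw [pow_one] at hh
    have hvw : v = v0 + PowerSeries.C (PowerSeries.X ^ n) * w := by rw [← hw]; ring
    have hbw : bCoeff 0 w = bCoeff n v := by
      have := congrArg (bCoeff n) hw
      rw [map_sub, hv0, if_neg (lt_irrefl n), sub_zero, bCoeff_C_X_pow_mul, if_pos le_rfl,
        Nat.sub_self] at this
      exact this.symm
    have hP := (perturb_tOp (betaParams d b) (b := PowerSeries.X) (b' := b) rfl hn v0 w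
      ⟨h, hh⟩).aeval hn (polyS (betaParams d b).s)
    obtain ⟨h', e1⟩ := hP.diff 1
    have e2 : Polynomial.aeval (tOp (betaParams d b) v) (polyS (betaParams d b).s) 1 =
        (polyS (betaParams d b).s : PowerSeries (PowerSeries K)) + curveC (betaParams d b) * v := by
      rw [hv, ← curveT_ricU, ricV, regularized_riccati]
      exact riccati_ricU _
    rw [← hvw, e2] at e1
    have e3 := curveSig_eq (betaParams d b)
    -- The first-order terms in w, c w on one side and S' z G'(S) w on the other, combine into σ w.
    have e4 : PowerSeries.C (PowerSeries.X ^ n) * (curveSig (betaParams d b) * w) =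
        Polynomial.aeval (tOp (betaParams d b) v0) (polyS (betaParams d b).s) 1 -
          (polyS (betaParams d b).s : PowerSeries (PowerSeries K)) -
          curveC (betaParams d b) * v0 + PowerSeries.C (PowerSeries.X ^ (n + 1)) * h' := by
      rw [e3]
      linear_combination e1 - curveC (betaParams d b) * hvw
    have e5 := congrArg (bCoeff n) e4
    rw [bCoeff_C_X_pow_mul, if_pos le_rfl, Nat.sub_self, map_add, bCoeff_C_X_pow_mul,
      if_neg (by omega), add_zero, bCoeff_zero_eq_map, map_mul, ← bCoeff_zero_eq_map,
      ← bCoeff_zero_eq_map, hbw, curveSig_betaParams, bCoeff_map_C, if_pos rfl] at e5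
    have e6 : bCoeff n v = curveSigInv d * bCoeff n (Polynomial.aeval (tOp (betaParams d b) v0)
        (polyS (betaParams d b).s) 1 - (polyS (betaParams d b).s : PowerSeries (PowerSeries K)) -
          curveC (betaParams d b) * v0) := by
      linear_combination curveSigInv d * e5 - bCoeff n v * curveSig_mul_inv d
    rw [e6]
    refine Subring.mul_mem _ (curveSigInv_mem d) (Subring.sub_mem _ (Subring.sub_mem _
      (aeval_tOp_mem_bRing d b hv0mem _) ?_) (Subring.mul_mem _ ?_ hv0mem) n)
    · rw [coe_polyS_betaParams]
      exact map_C_mem_bRing (coe_mem_ratRing _ _)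
    · rw [curveC_betaParams]
      exact map_C_mem_bRing (coe_mem_ratRing _ _)

theorem pSer_mem_bRing (d : Params K M L) (b : PowerSeries K) (m : ℕ) :
    pSer (betaParams d b) m ∈ bRing (curveRing d) := by
  rw [pSer, curveT_ricU]
  exact tOp_pow_mem_bRing d b (ricV_mem_bRing d b) m

theorem kSer_mem_bRing (d : Params K M L) (b : PowerSeries K) :
    kSer (betaParams d b) ∈ bRing (curveRing d) := by
  rw [kSer]
  refine Subring.sum_mem _ fun i _ => Subring.sum_mem _ fun j _ => ?_
  rw [betaParams_neg]
  exact Subring.mul_mem _ (mul_C_mem_bRing _ (pSer_mem_bRing d b _)) (pSer_mem_bRing d _ _)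

theorem qSer_mem_bRing (d : Params K M L) (b : PowerSeries K) (hLM : 0 < L * M) :
    qSer (betaParams d b) ∈ bRing (curveRing d) := by
  refine inv_mem_bRing (kSer_mem_bRing d b) (kSer_mul_qSer _ hLM) (curveSigInv_mem d) ?_
  rw [bCoeff_zero_eq_map, map_kSer, betaParams_map, kSer_of_beta_eq_zero rfl hLM]
  exact curveSig_mul_inv d

theorem wkbMat_mem_bRing (d : Params K M L) (b : PowerSeries K) (hLM : 0 < L * M)
    (i j : Fin (L * M)) : wkbMat (betaParams d b) i j ∈ bRing (curveRing d) := by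
  rw [wkbMat, Matrix.vecMulVec_apply, wkbCol, wkbRow]
  refine Subring.mul_mem _ (pSer_mem_bRing d b _) (Subring.mul_mem _ (qSer_mem_bRing d b hLM)
    (Subring.sum_mem _ fun l _ => ?_))
  rw [betaParams_neg]
  exact mul_C_mem_bRing _ (pSer_mem_bRing d _ _)

end

/-! ### The sheets of the spectral curve -/

section

variable {F E : Type*} [Field F] [Field E] {M L : ℕ} (φ : F →+* E) (z : E)

/-- The hypothesis `hz` says that z is transcendental over the constants, so c(z) ≠ 0; c(0) = 1
excludes w = 0. -/
theorem curve_eval_ne_zero (hz : ∀ p : Polynomial F, p.eval₂ φ z = 0 → p = 0) (d : Params F M L)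
    {w : E} (hw : w * (polyGS d.g d.s).eval₂ φ z = z * (polyGS d.g d.s).eval₂ φ w) :
    w ≠ 0 ∧ (polyGS d.g d.s).eval₂ φ w ≠ 0 := by
  have hc0 : polyGS d.g d.s ≠ 0 := fun h => by
    have := coeff_zero_polyGS d.g d.s
    rw [h, Polynomial.coeff_zero] at this
    exact zero_ne_one this
  have hz0 : z ≠ 0 := fun h => Polynomial.X_ne_zero (hz Polynomial.X (by simpa using h))
  have hw0 : w ≠ 0 := by
    rintro rfl
    rw [zero_mul, Polynomial.eval₂_at_zero, coeff_zero_polyGS, map_one, mul_one] at hw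
    exact hz0 hw.symm
  refine ⟨hw0, fun h => ?_⟩
  rw [h, mul_zero, mul_eq_zero] at hw
  exact hw.elim hw0 fun h => hc0 (hz _ h)

/-- If w were algebraic, z would be a root of w c(X) - c(w) X, which has algebraic coefficients and
constant term w ≠ 0, and z would be algebraic too. -/
theorem transcendental_of_curve [Algebra F E] (hz : Transcendental F z) (d : Params F M L) {w : E}
    (hw0 : w ≠ 0) (hw : w * Polynomial.aeval z (polyGS d.g d.s) =
      z * Polynomial.aeval w (polyGS d.g d.s)) : Transcendental F w := by
  intro hwa
  refine hz ?_
  let K := algebraicClosure F E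
  have hwK : w ∈ K := mem_algebraicClosure_iff.2 hwa
  let w' : K := ⟨w, hwK⟩
  have : IsAlgebraic K z := by
    refine ⟨Polynomial.C w' * (polyGS d.g d.s).map (algebraMap F K) -
      Polynomial.C (Polynomial.aeval w' (polyGS d.g d.s)) * Polynomial.X, fun h => ?_, ?_⟩
    · have := congrArg (fun p => Polynomial.coeff p 0) h
      simp only [Polynomial.coeff_sub, Polynomial.coeff_C_mul, Polynomial.coeff_map,
        coeff_zero_polyGS, map_one, mul_one, Polynomial.coeff_X_zero, mul_zero, sub_zero,
        Polynomial.coeff_zero] at this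
      exact hw0 (congrArg Subtype.val this)
    · have h1 : algebraMap K E (Polynomial.aeval w' (polyGS d.g d.s)) =
          Polynomial.aeval w (polyGS d.g d.s) :=
        (Polynomial.aeval_algebraMap_apply E w' _).symm
      rw [map_sub, map_mul, map_mul, Polynomial.aeval_C, Polynomial.aeval_C, Polynomial.aeval_X,
        Polynomial.aeval_map_algebraMap, h1]
      change w * _ - _ = 0
      rw [hw]
      ring
  exact this.restrictScalars F

/-- Ramification points are algebraic over the constants, whereas every point over X(z) is
transcendental: the generic fibre is unramified. -/
theorem sigma_eval_ne_zero (hz : ∀ p : Polynomial F, p.eval₂ φ z = 0 → p = 0) (d : Params F M L)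
    {w : E} (hw : w * (polyGS d.g d.s).eval₂ φ z = z * (polyGS d.g d.s).eval₂ φ w) :
    (polySigma d.g d.s).eval₂ φ w ≠ 0 := by
  algebraize [φ]
  have hz' : Transcendental F z := by
    rintro ⟨p, hp, hp'⟩
    exact hp (hz p hp')
  have := transcendental_of_curve z hz' d (curve_eval_ne_zero φ z hz d hw).1 hw
  intro h
  refine this ⟨polySigma d.g d.s, fun h => ?_, h⟩
  have := coeff_zero_polySigma d.g d.s
  rw [h, Polynomial.coeff_zero] at this
  exact zero_ne_one this

theorem natDegree_polyGS [CharZero F] (d : Params F M L) (hM : 0 < M) (hL : 0 < L)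
    (hg : d.g ⟨M - 1, by omega⟩ ≠ 0) (hs : d.s ⟨L - 1, by omega⟩ ≠ 0) :
    (polyGS d.g d.s).natDegree = L * M := by
  have h1 : (polyS d.s).natDegree = L := by
    refine le_antisymm (natDegree_polyS_le _) (Polynomial.le_natDegree_of_ne_zero ?_)
    rw [polyS, Polynomial.finsetSum_coeff, Finset.sum_eq_single ⟨L - 1, by omega⟩]
    · rw [Polynomial.coeff_C_mul_X_pow, if_pos (by simp; omega)]
      exact mul_ne_zero (Nat.cast_ne_zero.2 (by omega)) hs
    · intro i _ hi
      rw [Polynomial.coeff_C_mul_X_pow, if_neg]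
      intro h
      exact hi (Fin.ext (by simp; omega))
    · simp
  have h2 : (weightG d.g).natDegree = M := by
    refine le_antisymm (natDegree_weightG_le _) (Polynomial.le_natDegree_of_ne_zero ?_)
    rw [weightG, Polynomial.coeff_add, Polynomial.coeff_one, if_neg (by omega), zero_add,
      Polynomial.finsetSum_coeff, Finset.sum_eq_single ⟨M - 1, by omega⟩]
    · rw [Polynomial.coeff_C_mul_X_pow, if_pos (by simp; omega)]
      exact hg
    · intro i _ hi
      rw [Polynomial.coeff_C_mul_X_pow, if_neg]
      intro h
      exact hi (Fin.ext (by simp; omega))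
    · simp
  rw [polyGS, Polynomial.natDegree_comp, h1, h2, mul_comm]

/-- The fibre is the zero set of P = z c(X) - c(z) X, of degree LM, and the absence of ramification
makes its roots simple. -/
theorem exists_sheets [IsAlgClosed E] (hz : ∀ p : Polynomial F, p.eval₂ φ z = 0 → p = 0)
    (d : Params F M L) (hLM : 1 < L * M) (hdeg : (polyGS d.g d.s).natDegree = L * M) :
    ∃ ζ : Fin (L * M) → E, Function.Injective ζ ∧ (∀ i : Fin (L * M), i.val = 0 → ζ i = z) ∧
      ∀ i, ζ i * (polyGS d.g d.s).eval₂ φ z = z * (polyGS d.g d.s).eval₂ φ (ζ i) := by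
  classical
  have hz0 : z ≠ 0 := fun h => Polynomial.X_ne_zero (hz Polynomial.X (by simpa using h))
  set c := (polyGS d.g d.s).map φ with hc
  set P : Polynomial E := Polynomial.C z * c - Polynomial.C (c.eval z) * Polynomial.X with hP
  have hPdeg : P.natDegree = L * M := by
    have h1 : (Polynomial.C z * c).natDegree = L * M := by
      rw [Polynomial.natDegree_C_mul hz0, hc, Polynomial.natDegree_map, hdeg]
    rw [hP, Polynomial.natDegree_sub_eq_left_of_natDegree_lt, h1]
    rw [h1]
    exact (Polynomial.natDegree_C_mul_le _ _).trans_lt (by rwa [Polynomial.natDegree_X])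
  have hP0 : P ≠ 0 := fun h => by
    rw [h, Polynomial.natDegree_zero] at hPdeg
    omega
  have hroot : ∀ w, P.IsRoot w ↔
      w * (polyGS d.g d.s).eval₂ φ z = z * (polyGS d.g d.s).eval₂ φ w := by
    intro w
    rw [Polynomial.IsRoot, hP, hc]
    simp only [Polynomial.eval_sub, Polynomial.eval_mul, Polynomial.eval_C, Polynomial.eval_X,
      Polynomial.eval_map]
    rw [sub_eq_zero, mul_comm w, eq_comm]
  have hnodup : P.roots.Nodup := by
    rw [Multiset.nodup_iff_count_le_one]
    intro w
    rw [Polynomial.count_roots]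
    by_contra! h
    obtain ⟨h2, h1⟩ := (Polynomial.one_lt_rootMultiplicity_iff_isRoot hP0).1 h
    have h4 := (hroot w).1 h2
    have hσ := sigma_eval_ne_zero φ z hz d h4
    have h5 : (polySigma d.g d.s).eval₂ φ w = c.eval w - w * (Polynomial.derivative c).eval w := by
      rw [polySigma_eq, Polynomial.eval₂_sub, Polynomial.eval₂_mul, Polynomial.eval₂_X, hc,
        Polynomial.derivative_map, Polynomial.eval_map, Polynomial.eval_map]
    rw [← Polynomial.eval_map, ← Polynomial.eval_map, ← hc] at h4
    rw [Polynomial.IsRoot, hP] at h1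
    simp only [Polynomial.derivative_sub, Polynomial.derivative_mul, Polynomial.derivative_C,
      Polynomial.derivative_X, Polynomial.eval_sub, Polynomial.eval_mul, Polynomial.eval_C,
      zero_mul, zero_add, mul_one] at h1
    rw [h5] at hσ
    refine hσ (mul_left_cancel₀ hz0 ?_)
    -- On the fibre w P'(w) = -z σ(w), so a double root would be a zero of σ.
    linear_combination -w * h1 - h4
  have hcard : P.roots.toFinset.card = L * M := by
    rw [Multiset.toFinset_card_of_nodup hnodup, ← hPdeg]
    exact (IsAlgClosed.splits P).natDegree_eq_card_roots.symm
  have hzmem : z ∈ P.roots.toFinset := by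
    rw [Multiset.mem_toFinset, Polynomial.mem_roots hP0, hroot]
  let e : P.roots.toFinset ≃ Fin (L * M) := P.roots.toFinset.equivFinOfCardEq hcard
  let i0 : Fin (L * M) := ⟨0, by omega⟩
  -- An arbitrary enumeration of the roots, corrected by a transposition which puts z in position 0.
  let ζ : Fin (L * M) → E := fun i => (e.symm (Equiv.swap i0 (e ⟨z, hzmem⟩) i)).val
  refine ⟨ζ, ?_, ?_, ?_⟩
  · exact Subtype.val_injective.comp (e.symm.injective.comp (Equiv.injective _))
  · intro i hi
    obtain rfl : i = i0 := Fin.ext hi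
    simp [ζ]
  · intro i
    have := (e.symm (Equiv.swap i0 (e ⟨z, hzmem⟩) i)).2
    rw [Multiset.mem_toFinset, Polynomial.mem_roots hP0, hroot] at this
    exact this

end

/-! ### Spectral decomposition at `β = 0` -/

section

variable {E : Type*} [Field E] {M L : ℕ}

/-- The points `ζ i` have the same image `x ≠ ∞` under the spectral curve and are unramified. -/
structure SameFiber (d : Params E M L) (ζ : Fin (L * M) → E) : Prop where
  injective : Function.Injective ζ
  beta : d.β = 0
  ne_zero : ∀ i, ζ i ≠ 0
  curve : ∀ i j, ζ i * (polyGS d.g d.s).eval (ζ j) = ζ j * (polyGS d.g d.s).eval (ζ i)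
  polyGS_ne : ∀ i, (polyGS d.g d.s).eval (ζ i) ≠ 0
  sigma_ne : ∀ i, (polySigma d.g d.s).eval (ζ i) ≠ 0

variable {d : Params E M L} {ζ : Fin (L * M) → E}

/-- On a fibre (r - t) A(r, t) = r c(t) - t c(r) vanishes, so off the diagonal A does. The sheets
are thus orthogonal for A with norms σ, which gives both the invertibility of A and the spectral
projectors. -/
theorem SameFiber.evalA_eq (h : SameFiber d ζ) (hLM : 0 < L * M) (i j : Fin (L * M)) :
    evalA d (ζ i) (ζ j) = if i = j then (polySigma d.g d.s).eval (ζ i) else 0 := by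
  split_ifs with hij
  · rw [hij, evalA_self h.beta hLM]
  · have h1 := sub_mul_evalA h.beta hLM (ζ i) (ζ j)
    rw [h.curve i j, sub_self, mul_eq_zero, sub_eq_zero] at h1
    exact h1.resolve_left fun h2 => hij (h.injective h2)

theorem SameFiber.vandermonde_mul (h : SameFiber d ζ) (hLM : 0 < L * M) :
    Matrix.vandermonde ζ * matA d * (Matrix.vandermonde ζ).transpose =
      Matrix.diagonal fun i => (polySigma d.g d.s).eval (ζ i) := by
  ext i j
  rw [Matrix.diagonal_apply, ← h.evalA_eq hLM i j, Matrix.mul_assoc, Matrix.mul_apply, evalA]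
  refine Finset.sum_congr rfl fun l _ => ?_
  rw [Matrix.vandermonde_apply, Matrix.mul_apply, Finset.mul_sum]
  refine Finset.sum_congr rfl fun m _ => ?_
  rw [Matrix.transpose_apply, Matrix.vandermonde_apply]
  ring

theorem SameFiber.det_matA_ne_zero (h : SameFiber d ζ) (hLM : 0 < L * M) : (matA d).det ≠ 0 := by
  intro h0
  have h1 := congrArg Matrix.det (h.vandermonde_mul hLM)
  rw [Matrix.det_mul, Matrix.det_mul, h0, mul_zero, zero_mul, Matrix.det_diagonal] at h1
  exact Finset.prod_ne_zero_iff.2 (fun i _ => h.sigma_ne i) h1.symm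

theorem SameFiber.isUnit_det (h : SameFiber d ζ) :
    IsUnit (Matrix.vandermonde ζ).transpose.det := by
  rw [Matrix.det_transpose, isUnit_iff_ne_zero]
  exact Matrix.det_vandermonde_ne_zero_iff.2 h.injective

/-- The values S(z⁽ⁱ⁾) are the eigenvalues of the classical connection. Equal values of S give equal
values of c = G(S), and then z⁽ⁱ⁾ = γ X c determines the point. -/
theorem SameFiber.polyS_ne (h : SameFiber d ζ) {i j : Fin (L * M)} (hij : i ≠ j) :
    (polyS d.s).eval (ζ i) ≠ (polyS d.s).eval (ζ j) := by
  intro h1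
  have h2 : (polyGS d.g d.s).eval (ζ i) = (polyGS d.g d.s).eval (ζ j) := by
    rw [polyGS, Polynomial.eval_comp, Polynomial.eval_comp, h1]
  have h3 := h.curve i j
  rw [h2] at h3
  exact hij (h.injective (mul_right_cancel₀ (h.polyGS_ne j) h3))

/-- By orthogonality the rank one matrix on the left fixes the column of sheet `i0` of the
Vandermonde matrix and kills the other columns. -/
theorem SameFiber.leading (h : SameFiber d ζ) (i0 : Fin (L * M)) :
    Matrix.of (fun i l : Fin (L * M) => ζ i0 ^ i.val *
        (((polySigma d.g d.s).eval (ζ i0))⁻¹ * ∑ j : Fin (L * M), matA d l j * ζ i0 ^ j.val)) =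
      (Matrix.vandermonde ζ).transpose * Matrix.diagonal (fun i => if i = i0 then 1 else 0) *
        (Matrix.vandermonde ζ).transpose⁻¹ := by
  have hLM : 0 < L * M := i0.pos
  set U := (Matrix.vandermonde ζ).transpose with hU
  set W := Matrix.of (fun i l : Fin (L * M) => ζ i0 ^ i.val *
    (((polySigma d.g d.s).eval (ζ i0))⁻¹ * ∑ j : Fin (L * M), matA d l j * ζ i0 ^ j.val)) with hW
  have key : W * U = U * Matrix.diagonal (fun i => if i = i0 then 1 else 0) := by
    ext i k
    rw [Matrix.mul_diagonal, Matrix.mul_apply]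
    have h1 : ∑ l, W i l * U l k =
        ζ i0 ^ i.val * (((polySigma d.g d.s).eval (ζ i0))⁻¹ * evalA d (ζ k) (ζ i0)) := by
      rw [evalA, Finset.mul_sum, Finset.mul_sum]
      refine Finset.sum_congr rfl fun l _ => ?_
      rw [hW, hU, Matrix.of_apply, Matrix.transpose_apply, Matrix.vandermonde_apply,
        Finset.mul_sum, Finset.mul_sum, Finset.mul_sum, Finset.mul_sum, Finset.sum_mul]
      refine Finset.sum_congr rfl fun m _ => ?_
      ring
    rw [h1, h.evalA_eq hLM, hU, Matrix.transpose_apply, Matrix.vandermonde_apply]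
    split_ifs with hk
    · rw [hk, inv_mul_cancel₀ (h.sigma_ne i0)]
    · simp
  rw [← key, Matrix.mul_nonsing_inv_cancel_right _ _ h.isUnit_det]

/-- The columns of the Vandermonde matrix are the eigenvectors of the classical connection. The
identity at the sheet k involves z⁽ᵏ⁾ and c(z⁽ᵏ⁾); the curve equation trades them for the values at
`i0`. -/
theorem SameFiber.matB_sub_matC (h : SameFiber d ζ) (hLM : L < L * M) (i0 : Fin (L * M)) :
    (ζ i0 • matB d - (polyGS d.g d.s).eval (ζ i0) • matC d).transpose *
        (Matrix.vandermonde ζ).transpose =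
      (matA d).transpose * ((Matrix.vandermonde ζ).transpose *
        Matrix.diagonal fun i => ζ i0 * (polyS d.s).eval (ζ i)) := by
  ext j k
  have h1 := sum_matB_sub_matC h.beta hLM (ζ k) j
  refine mul_left_cancel₀ (h.ne_zero k) ?_
  have h2 : ((ζ i0 • matB d - (polyGS d.g d.s).eval (ζ i0) • matC d).transpose *
      (Matrix.vandermonde ζ).transpose) j k = ζ i0 * (∑ i : Fin (L * M), matB d i j * ζ k ^ i.val) -
        (polyGS d.g d.s).eval (ζ i0) * ∑ i : Fin (L * M), matC d i j * ζ k ^ i.val := by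
    rw [Matrix.mul_apply, Finset.mul_sum, Finset.mul_sum, ← Finset.sum_sub_distrib]
    refine Finset.sum_congr rfl fun i _ => ?_
    rw [Matrix.transpose_apply, Matrix.transpose_apply, Matrix.vandermonde_apply,
      Matrix.sub_apply, Matrix.smul_apply, Matrix.smul_apply, smul_eq_mul, smul_eq_mul]
    ring
  have h3 : ((matA d).transpose * ((Matrix.vandermonde ζ).transpose *
      Matrix.diagonal fun i => ζ i0 * (polyS d.s).eval (ζ i))) j k =
        (∑ i : Fin (L * M), matA d i j * ζ k ^ i.val) * (ζ i0 * (polyS d.s).eval (ζ k)) := by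
    rw [Matrix.mul_apply, Finset.sum_mul]
    refine Finset.sum_congr rfl fun i _ => ?_
    rw [Matrix.mul_diagonal, Matrix.transpose_apply, Matrix.transpose_apply,
      Matrix.vandermonde_apply]
    ring
  rw [h2, h3]
  linear_combination ζ i0 * h1 + (∑ i : Fin (L * M), matC d i j * ζ k ^ i.val) * h.curve i0 k

/-- A matrix which commutes with the classical limit of the connection and is tangent to the
rank one projectors vanishes. -/
theorem SameFiber.eq_zero_of_commute (h : SameFiber d ζ) (hLM : L < L * M)
    (i0 : Fin (L * M)) {Z : Matrix (Fin (L * M)) (Fin (L * M)) E}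
    (hN : (matA d).transpose.adjugate *
        (ζ i0 • matB d - (polyGS d.g d.s).eval (ζ i0) • matC d).transpose * Z =
      Z * ((matA d).transpose.adjugate *
        (ζ i0 • matB d - (polyGS d.g d.s).eval (ζ i0) • matC d).transpose))
    (hW : (Matrix.vandermonde ζ).transpose * Matrix.diagonal (fun i => if i = i0 then 1 else 0) *
        (Matrix.vandermonde ζ).transpose⁻¹ * Z +
      Z * ((Matrix.vandermonde ζ).transpose * Matrix.diagonal (fun i => if i = i0 then 1 else 0) *
        (Matrix.vandermonde ζ).transpose⁻¹) = Z) : Z = 0 := by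
  have hLM' : 0 < L * M := i0.pos
  have hBC := h.matB_sub_matC hLM i0
  set U := (Matrix.vandermonde ζ).transpose with hU
  set D := Matrix.diagonal fun i => ζ i0 * (polyS d.s).eval (ζ i) with hD
  set Q := (ζ i0 • matB d - (polyGS d.g d.s).eval (ζ i0) • matC d).transpose
  set Y := U⁻¹ * Z * U with hY
  have hUY : U * Y = Z * U := by
    rw [hY, Matrix.mul_assoc, Matrix.mul_nonsing_inv_cancel_left _ _ h.isUnit_det]
  have hNU : (matA d).transpose.adjugate * Q * U = (matA d).det • (U * D) := by
    rw [Matrix.mul_assoc, hBC, ← Matrix.mul_assoc, Matrix.adjugate_mul, Matrix.det_transpose,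
      Matrix.smul_mul, Matrix.one_mul]
  have hcomm : D * Y = Y * D := by
    have h1 : (matA d).det • (U * (D * Y)) = (matA d).det • (U * (Y * D)) := by
      calc _ = (matA d).transpose.adjugate * Q * U * Y := by
            rw [hNU, Matrix.smul_mul, Matrix.mul_assoc]
        _ = Z * ((matA d).transpose.adjugate * Q * U) := by
            rw [Matrix.mul_assoc, hUY, ← Matrix.mul_assoc, hN, Matrix.mul_assoc]
        _ = _ := by
            rw [hNU, Matrix.mul_smul, ← Matrix.mul_assoc, ← hUY, Matrix.mul_assoc]
    have h2 := smul_right_injective _ (h.det_matA_ne_zero hLM') h1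
    rw [← Matrix.nonsing_inv_mul_cancel_left U (D * Y) h.isUnit_det, h2,
      Matrix.nonsing_inv_mul_cancel_left _ _ h.isUnit_det]
  have htan : Matrix.diagonal (fun i => if i = i0 then 1 else 0) * Y +
      Y * Matrix.diagonal (fun i => if i = i0 then 1 else 0) = Y := by
    have h1 := congrArg (fun T => U⁻¹ * T * U) hW
    simp only [Matrix.mul_add, Matrix.add_mul] at h1
    rw [← hY] at h1
    refine Eq.trans ?_ h1
    congr 1
    · rw [hY]
      simp only [Matrix.mul_assoc]
      rw [Matrix.nonsing_inv_mul_cancel_left _ _ h.isUnit_det]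
    · rw [hY]
      simp only [Matrix.mul_assoc]
      rw [Matrix.nonsing_inv_mul _ h.isUnit_det, Matrix.mul_one]
  have hY0 : Y = 0 := by
    ext i j
    have h1 := congrFun (congrFun hcomm i) j
    have h2 := congrFun (congrFun htan i) j
    rw [hD, Matrix.diagonal_mul, Matrix.mul_diagonal] at h1
    rw [Matrix.add_apply, Matrix.diagonal_mul, Matrix.mul_diagonal] at h2
    rw [Matrix.zero_apply]
    -- Diagonal entries: tangency reads 2y = y at `i0` and 0 = y elsewhere. Off-diagonal entries:
    -- commutation with distinct eigenvalues.
    by_cases hij : i = j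
    · subst hij
      split_ifs at h2
      · linear_combination h2
      · linear_combination -h2
    · have h3 : ζ i0 * ((polyS d.s).eval (ζ i) - (polyS d.s).eval (ζ j)) ≠ 0 :=
        mul_ne_zero (h.ne_zero i0) (sub_ne_zero.2 (h.polyS_ne hij))
      refine (mul_eq_zero.1 ?_).resolve_left h3
      linear_combination h1
  rw [hY0, Matrix.mul_zero] at hUY
  rw [← Matrix.mul_nonsing_inv_cancel_right U Z h.isUnit_det, ← hUY, Matrix.zero_mul]

end

/-! ### The connection matrix without denominators -/

section

variable {R S : Type*} [CommRing R] [CommRing S] {M L : ℕ}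

/-- The matrix `w det(A) E(X(w))`, written without denominators. -/
def connAt (d : Params R M L) (w : R) : Matrix (Fin (L * M)) (Fin (L * M)) R :=
  (matA d).transpose.adjugate *
    (w • matB d - (polyGS d.g d.s).eval w • matC d).transpose

theorem connAt_map (f : R →+* S) (d : Params R M L) (w : R) :
    (connAt d w).map f = connAt (d.map f) (f w) := by
  have h1 : (matA d).transpose.adjugate.map f = (matA (d.map f)).transpose.adjugate := by
    rw [matA_map, ← Matrix.transpose_map]
    exact RingHom.map_adjugate f _
  have h2 : (w • matB d - (polyGS d.g d.s).eval w • matC d).transpose.map f =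
      (f w • matB (d.map f) - (polyGS (d.map f).g (d.map f).s).eval (f w) •
        matC (d.map f)).transpose := by
    have hc : (polyGS (d.map f).g (d.map f).s).eval (f w) = f ((polyGS d.g d.s).eval w) := by
      rw [← Polynomial.eval_map_apply, polyGS_map]
      rfl
    rw [matB_map, matC_map, hc]
    ext i j
    simp
  rw [connAt, Matrix.map_mul, h1, h2, connAt]

theorem polyGS_eval_X (d : Params R M L) :
    (polyGS (d.map PowerSeries.C).g (d.map PowerSeries.C).s).eval PowerSeries.X = curveC d := by
  have : polyGS (d.map PowerSeries.C).g (d.map PowerSeries.C).s =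
    (polyGS d.g d.s).map (PowerSeries.C (R := R)) := (polyGS_map _ _ _).symm
  rw [this, Polynomial.eval_map, curveC]
  exact Polynomial.eval₂_C_X_eq_coe

theorem curveD_C_mul (d : Params R M L) (r : R) (x : PowerSeries R) :
    curveD d (PowerSeries.C r * x) = PowerSeries.C r * curveD d x := by
  rw [← PowerSeries.smul_eq_C_mul, map_smul, PowerSeries.smul_eq_C_mul]

theorem curveD_neg (d : Params R M L) (x : PowerSeries R) :
    curveD d.neg x = -curveD d x :=
  neg_smul d.β (curveC d * curveSigInv d * eulerX R x)

/-- The equation `D W = [E(X(z)), W]`, multiplied by `z det(A)`. -/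
def IsFlat (d : Params R M L) (W : Matrix (Fin (L * M)) (Fin (L * M)) (PowerSeries R)) : Prop :=
  ∀ i j, PowerSeries.X * PowerSeries.C (matA d).det * curveD d (W i j) =
    (connAt (d.map PowerSeries.C) PowerSeries.X * W -
      W * connAt (d.map PowerSeries.C) PowerSeries.X) i j

/-- The equation is free of denominators thanks to the adjugate, so it descends along an injective
map: it may be proved over a field where β is invertible. -/
theorem IsFlat.of_map {f : R →+* S} (hf : Function.Injective f) {d : Params R M L}
    {W : Matrix (Fin (L * M)) (Fin (L * M)) (PowerSeries R)}
    (h : IsFlat (d.map f) (W.map (PowerSeries.map f))) : IsFlat d W := by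
  intro i j
  refine PowerSeries.map_injective f hf ?_
  have h1 := h i j
  have hconn : (connAt (d.map PowerSeries.C) PowerSeries.X).map (PowerSeries.map f) =
      connAt ((d.map f).map PowerSeries.C) PowerSeries.X := by
    rw [connAt_map, PowerSeries.map_X]
    congr 1
    simp [Params.map]
  have hdet : (matA (d.map f)).det = f (matA d).det := by
    rw [matA_map]
    exact (RingHom.map_det f _).symm
  rw [← hconn, hdet, Matrix.map_apply, ← map_curveD, ← Matrix.map_mul, ← Matrix.map_mul] at h1
  rw [map_mul, map_mul, PowerSeries.map_X, PowerSeries.map_C, h1, Matrix.sub_apply,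
    Matrix.sub_apply, map_sub, Matrix.map_apply, Matrix.map_apply]

end

/-! ### The commutator equation for the rank one projector. -/

section

variable {k : Type*} [Field k] [Algebra ℚ k] {M L : ℕ}

theorem wkbMat_eq_phi (d : Params k M L) (hγ : d.γ ≠ 0) (hβ : d.β ≠ 0) (hLM : L < L * M) :
    wkbMat d = Matrix.vecMulVec (fun i => phi d i.val)
      (((matA d).map PowerSeries.C).mulVec fun j => phi d.neg j.val) := by
  ext1 i j
  rw [← matMPlus_subst d hγ hβ hLM, ← substX_apply, matMPlus, Matrix.mul_apply, map_sum,
    Matrix.vecMulVec_apply, Matrix.mulVec, dotProduct, Finset.mul_sum]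
  refine Finset.sum_congr rfl fun l _ => ?_
  rw [Matrix.vecMulVec_apply, Matrix.transpose_apply, Matrix.map_apply, psiMinus_eq d hγ,
    map_mul, map_mul, substX_C, phi, phi]
  change _ * substX d.neg _ * _ = _
  rw [mul_assoc, mul_comm (PowerSeries.C _)]

/-- The column a = φ satisfies D a = E a and the row A e, with e = φ at -β, satisfies D(A e) = -(A
e) E; the product rule gives the commutator. Both are multiplied by z det A. -/
theorem isFlat_wkbMat_of_field (d : Params k M L) (hγ : d.γ ≠ 0) (hβ : d.β ≠ 0)
    (hLM : L < L * M) : IsFlat d (wkbMat d) := by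
  set a : Fin (L * M) → PowerSeries k := fun i => phi d i.val with ha
  set e : Fin (L * M) → PowerSeries k := fun i => phi d.neg i.val with he
  set A : Matrix (Fin (L * M)) (Fin (L * M)) (PowerSeries k) := (matA d).map PowerSeries.C with hA
  set Q : Matrix (Fin (L * M)) (Fin (L * M)) (PowerSeries k) :=
    ((PowerSeries.X : PowerSeries k) • (matB d).map PowerSeries.C -
      curveC d • (matC d).map PowerSeries.C).transpose with hQ
  have hconn : connAt (d.map PowerSeries.C) PowerSeries.X = A.transpose.adjugate * Q := by
    rw [connAt, matA_map, matB_map, matC_map, polyGS_eval_X]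
  have hdet : A.transpose.det = PowerSeries.C (matA d).det := by
    rw [Matrix.det_transpose]
    exact (RingHom.map_det (PowerSeries.C (R := k)) _).symm
  have h1 : A.transpose.mulVec (fun i => PowerSeries.X * curveD d (a i)) = Q.mulVec a := by
    funext j
    have := phi_system d hγ hβ hLM j
    rw [Finset.mul_sum, Finset.mul_sum, Finset.mul_sum, ← Finset.sum_sub_distrib] at this
    rw [Matrix.mulVec, Matrix.mulVec, dotProduct, dotProduct]
    convert this using 2 with i _ i _
    · change PowerSeries.C (matA d i j) * _ = _
      ring
    · rw [hQ, Matrix.transpose_apply, Matrix.sub_apply, Matrix.smul_apply, Matrix.smul_apply,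
        Matrix.map_apply, Matrix.map_apply, smul_eq_mul, smul_eq_mul]
      ring
  -- This is the system at -β: A, B, C are transposed there, and D changes sign.
  have h2 : Matrix.vecMul e Q = -A.mulVec fun i => PowerSeries.X * curveD d (e i) := by
    funext j
    have := phi_system d.neg hγ (neg_ne_zero.2 hβ) hLM j
    rw [Finset.mul_sum, Finset.mul_sum, Finset.mul_sum, ← Finset.sum_sub_distrib] at this
    rw [Pi.neg_apply, Matrix.mulVec, Matrix.vecMul, dotProduct, dotProduct, ← Finset.sum_neg_distrib]
    convert this.symm using 2 with i _ i _
    · rw [hQ, Matrix.transpose_apply, Matrix.sub_apply, Matrix.smul_apply, Matrix.smul_apply,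
        Matrix.map_apply, Matrix.map_apply, smul_eq_mul, smul_eq_mul, matB_neg, matC_neg,
        Matrix.transpose_apply, Matrix.transpose_apply]
      change e i * (_ * _ - curveC d * _) = _ * (_ * e i) - curveC d * (_ * e i)
      ring
    · have : curveD d.neg (e i) = -curveD d (e i) := curveD_neg d _
      change _ = _ * (_ * curveD d.neg (e i))
      rw [this, matA_neg, Matrix.transpose_apply]
      change -(PowerSeries.C (matA d j i) * _) = _
      ring
  have h3 : (A.transpose.adjugate * Q).mulVec a =
      fun i => PowerSeries.C (matA d).det * (PowerSeries.X * curveD d (a i)) := by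
    rw [← Matrix.mulVec_mulVec, ← h1, Matrix.mulVec_mulVec, Matrix.adjugate_mul, hdet,
      Matrix.smul_mulVec, Matrix.one_mulVec]
    rfl
  have h4 : Matrix.vecMul (A.mulVec e) (A.transpose.adjugate * Q) =
      -fun i => PowerSeries.C (matA d).det * (PowerSeries.X * curveD d (A.mulVec e i)) := by
    rw [← Matrix.vecMul_transpose, Matrix.vecMul_vecMul, ← Matrix.mul_assoc, Matrix.mul_adjugate,
      hdet, Matrix.smul_mul, Matrix.one_mul, Matrix.vecMul_smul, h2, smul_neg]
    congr 1
    funext i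
    rw [Pi.smul_apply, smul_eq_mul, Matrix.vecMul_transpose, Matrix.mulVec, Matrix.mulVec,
      dotProduct, dotProduct, map_sum, Finset.mul_sum, Finset.mul_sum]
    rw [← Finset.mul_sum]
    refine congrArg _ (Finset.sum_congr rfl fun j _ => ?_)
    change PowerSeries.C (matA d i j) * _ = _ * curveD d (PowerSeries.C (matA d i j) * _)
    rw [curveD_C_mul]
    ring
  intro i j
  rw [wkbMat_eq_phi d hγ hβ hLM, hconn, Matrix.mul_vecMulVec, Matrix.vecMulVec_mul, h3, h4,
    Matrix.sub_apply, Matrix.vecMulVec_apply, Matrix.vecMulVec_apply, Matrix.vecMulVec_apply,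
    curveD_mul, Pi.neg_apply]
  ring

end

/-! ### Uniqueness -/

section

variable {K E : Type*} [CommRing K] [Field E] {M L : ℕ}

theorem eval_map_comp_C (f : PowerSeries K →+* E) (p : Polynomial K) :
    (p.map (f.comp PowerSeries.C)).eval (f PowerSeries.X) = f p := by
  have : (Polynomial.evalRingHom (f PowerSeries.X)).comp
      (Polynomial.mapRingHom (f.comp PowerSeries.C)) = f.comp Polynomial.coeToPowerSeries.ringHom := by
    refine Polynomial.ringHom_ext (fun a => ?_) ?_ <;> simp
  exact RingHom.congr_fun this p

variable {f : PowerSeries K →+* E} {ζ : Fin (L * M) → E} {d : Params K M L}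

/-- The leading term of the WKB matrix. -/
theorem wkbMat_leading (hζ : SameFiber (d.classical.map (f.comp PowerSeries.C)) ζ)
    (i0 : Fin (L * M)) (hz : ζ i0 = f PowerSeries.X) (b : PowerSeries K) :
    (wkbMat (betaParams d b)).map (fun x => f (bCoeff 0 x)) =
      (Matrix.vandermonde ζ).transpose * Matrix.diagonal (fun i => if i = i0 then 1 else 0) *
        (Matrix.vandermonde ζ).transpose⁻¹ := by
  have hLM : 0 < L * M := i0.pos
  rw [← hζ.leading i0]
  ext i l
  have hσ : (polySigma (d.classical.map (f.comp PowerSeries.C)).g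
      (d.classical.map (f.comp PowerSeries.C)).s).eval (ζ i0) = f (curveSig d.classical) := by
    rw [hz, curveSig, ← eval_map_comp_C, polySigma_map]
    rfl
  have hinv : f (curveSigInv d.classical) = (f (curveSig d.classical))⁻¹ := by
    refine eq_inv_of_mul_eq_one_right ?_
    rw [← map_mul, curveSig_mul_inv, map_one]
  rw [Matrix.map_apply, bCoeff_zero_eq_map, map_wkbMat _ _ hLM, betaParams_map,
    wkbMat_of_beta_eq_zero rfl hLM, Matrix.of_apply, hσ, map_mul, map_mul, hinv, map_pow, map_sum,
    matA_map, hz]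
  congr 2
  refine Finset.sum_congr rfl fun j _ => ?_
  rw [map_mul, map_pow]
  rfl

/-- Order by order in β: the lowest coefficient of the difference is tangent to the projectors at
the leading term and commutes with the classical connection, because D carries a factor β. -/
theorem eq_of_isFlat [IsDomain K] (hf : Function.Injective f)
    (hζ : SameFiber (d.classical.map (f.comp PowerSeries.C)) ζ) (hLM : L < L * M)
    (i0 : Fin (L * M)) (hz : ζ i0 = f PowerSeries.X) {b : PowerSeries K}
    {W W' : Matrix (Fin (L * M)) (Fin (L * M)) (PowerSeries (PowerSeries K))}
    (hW : IsFlat (betaParams d b) W) (hW' : IsFlat (betaParams d b) W') (hp : W * W = W)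
    (hp' : W' * W' = W')
    (hl : W.map (fun x => f (bCoeff 0 x)) =
      (Matrix.vandermonde ζ).transpose * Matrix.diagonal (fun i => if i = i0 then 1 else 0) *
        (Matrix.vandermonde ζ).transpose⁻¹)
    (hl' : W'.map (fun x => f (bCoeff 0 x)) =
      (Matrix.vandermonde ζ).transpose * Matrix.diagonal (fun i => if i = i0 then 1 else 0) *
        (Matrix.vandermonde ζ).transpose⁻¹) : W = W' := by
  have key : ∀ n : ℕ, ∀ i j, ∀ m < n + 1, bCoeff m (W i j - W' i j) = 0 := by
    intro n
    induction n with
    | zero =>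
      intro i j m hm
      obtain rfl : m = 0 := by omega
      refine hf ?_
      have := congrFun (congrFun (hl.trans hl'.symm) i) j
      rw [Matrix.map_apply, Matrix.map_apply] at this
      rw [map_sub, map_sub, this, sub_self, map_zero]
    | succ n ih =>
      choose Z hZ using fun i j => exists_eq_C_X_pow_mul (ih i j)
      set c : PowerSeries (PowerSeries K) := PowerSeries.C (PowerSeries.X ^ (n + 1)) with hc
      have hc0 : c ≠ 0 := by
        rw [hc]
        exact (map_ne_zero_iff _ PowerSeries.C_injective).2 (pow_ne_zero _ PowerSeries.X_ne_zero)
      have hWZ : W = W' + c • Matrix.of Z := by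
        ext1 i j
        rw [Matrix.add_apply, Matrix.smul_apply, Matrix.of_apply, smul_eq_mul, ← hZ,
          add_sub_cancel]
      set Y : Matrix (Fin (L * M)) (Fin (L * M)) (PowerSeries (PowerSeries K)) := Matrix.of Z
      -- `g` sets β = 0 and embeds the result in the field containing the sheets.
      set g : PowerSeries (PowerSeries K) →+* E :=
        f.comp (PowerSeries.map PowerSeries.constantCoeff) with hg
      have hgb : ∀ x, g x = f (bCoeff 0 x) := fun x => by rw [bCoeff_zero_eq_map]; rfl
      have hgc : g c = 0 := by
        rw [hg, hc, RingHom.comp_apply, PowerSeries.map_C]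
        simp
      have hgW' : W'.map g = (Matrix.vandermonde ζ).transpose *
          Matrix.diagonal (fun i => if i = i0 then 1 else 0) *
            (Matrix.vandermonde ζ).transpose⁻¹ := by
        rw [← hl']
        exact Matrix.ext fun i j => hgb _
      -- Idempotency of W' + c Y and of W', divided by c = β^(n+1); the quadratic term disappears at
      -- β = 0.
      have htan : W' * Y + Y * W' + c • (Y * Y) = Y := by
        have h1 : c • (W' * Y + Y * W' + c • (Y * Y)) = c • Y := by
          have h2 := hp
          rw [hWZ, Matrix.add_mul, Matrix.mul_add, Matrix.mul_add, hp', Matrix.mul_smul,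
            Matrix.smul_mul, Matrix.smul_mul, Matrix.mul_smul] at h2
          rw [smul_add, smul_add, ← add_right_inj W', ← h2]
          abel
        exact smul_right_injective _ hc0 h1
      have hcomm : ∀ i j, PowerSeries.X * PowerSeries.C (matA (betaParams d b)).det *
          curveD (betaParams d b) (Y i j) =
            (connAt ((betaParams d b).map PowerSeries.C) PowerSeries.X * Y -
              Y * connAt ((betaParams d b).map PowerSeries.C) PowerSeries.X) i j := by
        intro i j
        have h1 := hW i j
        have h2 := hW' i j
        rw [hWZ, Matrix.mul_add, Matrix.add_mul, Matrix.mul_smul, Matrix.smul_mul,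
          Matrix.add_apply, Matrix.smul_apply, map_add, smul_eq_mul, hc,
          curveD_C_mul, ← hc] at h1
        refine mul_left_cancel₀ hc0 ?_
        simp only [Matrix.add_apply, Matrix.sub_apply, Matrix.smul_apply, smul_eq_mul] at h1 h2 ⊢
        linear_combination h1 - h2
      have hY : Y.map g = 0 := by
        have hconn : (connAt ((betaParams d b).map PowerSeries.C) PowerSeries.X).map g =
            connAt (d.classical.map (f.comp PowerSeries.C)) (ζ i0) := by
          rw [connAt_map, hz]
          congr 1
          · simp [Params.map, betaParams, Params.classical, hg]
          · simp [hg]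
        refine hζ.eq_zero_of_commute hLM i0 ?_ ?_
        · change connAt (d.classical.map (f.comp PowerSeries.C)) (ζ i0) * _ =
            _ * connAt (d.classical.map (f.comp PowerSeries.C)) (ζ i0)
          rw [← hconn, ← Matrix.map_mul, ← Matrix.map_mul]
          ext i j
          have h1 := congrArg g (hcomm i j)
          have hD : g (curveD (betaParams d b) (Y i j)) = 0 := by
            rw [curveD_apply, PowerSeries.smul_eq_C_mul, map_mul, hg, RingHom.comp_apply,
              PowerSeries.map_C]
            simp [betaParams]
          rw [map_mul, hD, mul_zero, Matrix.sub_apply, map_sub] at h1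
          exact (sub_eq_zero.1 h1.symm)
        · rw [← hgW', ← Matrix.map_mul, ← Matrix.map_mul]
          ext i j
          have h1 := congrArg g (congrFun (congrFun htan i) j)
          rw [Matrix.add_apply, Matrix.add_apply, Matrix.smul_apply, smul_eq_mul, map_add, map_add,
            map_mul, hgc, zero_mul, add_zero] at h1
          exact h1
      intro i j m hm
      rw [hZ, bCoeff_C_X_pow_mul]
      split_ifs with h
      · obtain rfl : m = n + 1 := by omega
        have := congrFun (congrFun hY i) j
        rw [Matrix.map_apply, Matrix.zero_apply, hgb] at this
        rw [Nat.sub_self]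
        exact hf (this.trans (map_zero f).symm)
      · rfl
  ext1 i j
  refine ext_bCoeff fun n => ?_
  have := key n i j n (Nat.lt_succ_self n)
  rwa [map_sub, sub_eq_zero] at this

end

/-! ### The differential equation in a field of Laurent series -/

section

variable {F : Type*} [Field F] {M L : ℕ}

theorem matE_curveX (d : Params F M L) (hγ : d.γ ≠ 0) {w : F} (hw : w ≠ 0) :
    matE d (curveX d w) = (w * (matA d).det)⁻¹ • connAt d w := by
  have hx : (d.γ * curveX d w)⁻¹ = (polyGS d.g d.s).eval w / w := by
    rw [curveX, ← mul_div_assoc, mul_div_mul_left _ _ hγ, inv_div]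
  have hB : w • matB d - (polyGS d.g d.s).eval w • matC d =
      w • (matB d - ((polyGS d.g d.s).eval w / w) • matC d) := by
    rw [smul_sub, smul_smul, mul_div_cancel₀ _ hw]
  rw [matE, connAt, matEtilde_eq, hx, hB, Matrix.inv_def, Ring.inverse_eq_inv',
    Matrix.det_transpose, Matrix.transpose_smul, Matrix.mul_smul, smul_smul, mul_inv, mul_right_comm,
    inv_mul_cancel₀ hw, one_mul, Matrix.smul_mul]

theorem matE'_eq (d : Params F M L) (x : F) : matE' d x = matE d.neg x := by
  have h : matEtilde d.neg x = (matEtilde d x).transpose := by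
    rw [matEtilde_eq, matEtilde_eq, matB_neg, matC_neg, Matrix.transpose_sub,
      Matrix.transpose_smul]
    rfl
  rw [matE', matE, h, matA_neg, Matrix.transpose_transpose, Matrix.transpose_transpose]

/-- The two equations differ by the nonzero factor z det A. The parameter γ of `P` is free, since
E(X(z)) depends on γ only through γ X(z) = z/c. -/
theorem ode_iff_isFlat {R : Type*} [CommRing R] {J : PowerSeries R →+* F}
    (hJ : Function.Injective J) {d : Params R M L} (hdet : (matA d).det ≠ 0) {P : Params F M L}
    (hg : P.g = fun i => J (PowerSeries.C (d.g i))) (hs : P.s = fun i => J (PowerSeries.C (d.s i)))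
    (hβ : P.β = J (PowerSeries.C d.β)) (hγ : P.γ ≠ 0) (hz : J PowerSeries.X ≠ 0)
    (W : Matrix (Fin (L * M)) (Fin (L * M)) (PowerSeries R)) :
    (P.β * (J PowerSeries.X * (polyGS P.g P.s).eval (J PowerSeries.X) /
        (polySigma P.g P.s).eval (J PowerSeries.X))) •
          W.map (fun f => J (PowerSeries.derivative R f)) =
        matE P (curveX P (J PowerSeries.X)) * W.map J -
          W.map J * matE P (curveX P (J PowerSeries.X)) ↔ IsFlat d W := by
  have hP : P = { d.map (J.comp PowerSeries.C) with γ := P.γ } := by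
    cases P
    simp_all [Params.map]
  have hA : (matA P).det = J (PowerSeries.C (matA d).det) := by
    have h : matA P = (matA d).map (J.comp PowerSeries.C) := by
      rw [← matA_map, hP]
      rfl
    rw [h]
    exact (RingHom.map_det (J.comp PowerSeries.C) _).symm
  have hA0 : (matA P).det ≠ 0 := by
    rw [hA]
    exact fun h => hdet (PowerSeries.C_injective (hJ (by rw [h, map_zero, map_zero])))
  have hconn : connAt P (J PowerSeries.X) =
      (connAt (d.map PowerSeries.C) PowerSeries.X).map J := by
    rw [connAt_map, hP]
    rfl
  have hc : (polyGS P.g P.s).eval (J PowerSeries.X) = J (curveC d) := by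
    rw [curveC, ← eval_map_comp_C, polyGS_map, hg, hs]
    rfl
  have hσ : ((polySigma P.g P.s).eval (J PowerSeries.X))⁻¹ = J (curveSigInv d) := by
    have : (polySigma P.g P.s).eval (J PowerSeries.X) = J (curveSig d) := by
      rw [curveSig, ← eval_map_comp_C, polySigma_map, hg, hs]
      rfl
    rw [this]
    refine inv_eq_of_mul_eq_one_right ?_
    rw [← map_mul, curveSig_mul_inv, map_one]
  have hD : ∀ f, J (curveD d f) = P.β * (J PowerSeries.X * (polyGS P.g P.s).eval (J PowerSeries.X) /
      (polySigma P.g P.s).eval (J PowerSeries.X)) * J (PowerSeries.derivative R f) := by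
    intro f
    rw [curveD_apply, PowerSeries.smul_eq_C_mul, map_mul, map_mul, map_mul, eulerX_apply, map_mul,
      div_eq_mul_inv, hσ, hc, hβ]
    ring
  have hzA : J PowerSeries.X * (matA P).det ≠ 0 := mul_ne_zero hz hA0
  rw [matE_curveX P hγ hz, Matrix.smul_mul, Matrix.mul_smul, ← smul_sub, hconn, ← Matrix.map_mul,
    ← Matrix.map_mul, eq_inv_smul_iff₀ hzA, ← Matrix.ext_iff]
  refine forall_congr' fun i => forall_congr' fun j => ?_
  rw [← hJ.eq_iff, map_mul, map_mul, ← hA, hD, Matrix.smul_apply, Matrix.smul_apply,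
    Matrix.map_apply, Matrix.sub_apply, Matrix.sub_apply, Matrix.map_apply, Matrix.map_apply,
    map_sub, smul_eq_mul, smul_eq_mul]

end

/-! ### The indeterminate parameters -/

section

variable {M L : ℕ}

/-- The parameters `g`, `s` in `𝕂[s]`. -/
def baseParams (M L : ℕ) : Params (Ks M L) M L where
  g := gVar M L
  s := sVar M L
  -- The values of γ and β given here are immaterial: the curve in the form z/c, the matrix A and
  -- the Riccati equation do not contain γ, and β is overwritten by `betaParams` or
  -- `Params.classical`.
  γ := 1
  β := 0

/-- The inclusion of `𝕂[s][[β]]` in the field of Laurent series. -/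
def toBetaField (M L : ℕ) : PowerSeries (Ks M L) →+* BetaField M L :=
  (HahnSeries.ofPowerSeries ℤ (Frac M L)).comp (PowerSeries.map (toFrac M L))

theorem toFrac_injective : Function.Injective (toFrac M L) :=
  (IsFractionRing.injective (Polynomial (Ks M L)) (Frac M L)).comp Polynomial.C_injective

theorem ofPowerSeries_comp_map_injective {R S : Type*} [CommRing R] [CommRing S] {f : R →+* S}
    (hf : Function.Injective f) :
    Function.Injective ((HahnSeries.ofPowerSeries ℤ S).comp (PowerSeries.map f)) := by
  rw [RingHom.coe_comp]
  exact HahnSeries.ofPowerSeries_injective.comp (PowerSeries.map_injective f hf)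

theorem toBetaField_injective : Function.Injective (toBetaField M L) :=
  ofPowerSeries_comp_map_injective toFrac_injective

theorem seriesToSheet_injective : Function.Injective (seriesToSheet M L) :=
  (algebraMap (LaurentSeries (Frac M L)) (SheetField M L)).injective.comp toBetaField_injective

theorem toBetaField_C (r : Ks M L) :
    toBetaField M L (PowerSeries.C r) = HahnSeries.C (toFrac M L r) := by
  rw [toBetaField, RingHom.comp_apply, PowerSeries.map_C, HahnSeries.ofPowerSeries_C]

theorem toBetaField_X : toBetaField M L PowerSeries.X = HahnSeries.single 1 1 := by
  rw [toBetaField, RingHom.comp_apply, PowerSeries.map_X, HahnSeries.ofPowerSeries_X]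

theorem seriesToSheet_C (r : Ks M L) :
    seriesToSheet M L (PowerSeries.C r) = fracToSheet M L (toFrac M L r) := by
  change algebraMap (LaurentSeries (Frac M L)) (SheetField M L) (toBetaField M L _) = _
  rw [toBetaField_C]
  rfl

theorem gamma_ne_zero : (params M L).γ ≠ 0 := by
  change HahnSeries.C _ ≠ 0
  rw [map_ne_zero_iff _ HahnSeries.C_injective,
    map_ne_zero_iff _ (IsFractionRing.injective (Polynomial (Ks M L)) (Frac M L))]
  exact Polynomial.X_ne_zero

theorem eq_zero_of_eval₂_eq_zero (p : Polynomial (Frac M L))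
    (h : p.eval₂ (fracToSheet M L) (seriesToSheet M L PowerSeries.X) = 0) : p = 0 := by
  let f : PowerSeries (Frac M L) →+* SheetField M L :=
    (algebraMap (LaurentSeries (Frac M L)) (SheetField M L)).comp
      (HahnSeries.ofPowerSeries ℤ (Frac M L))
  have hf : Function.Injective f :=
    (algebraMap (LaurentSeries (Frac M L)) (SheetField M L)).injective.comp
      HahnSeries.ofPowerSeries_injective
  have h1 : f.comp PowerSeries.C = fracToSheet M L := by
    ext1 x
    change algebraMap (LaurentSeries (Frac M L)) (SheetField M L)
      (HahnSeries.ofPowerSeries ℤ (Frac M L) (PowerSeries.C x)) = _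
    rw [HahnSeries.ofPowerSeries_C]
    rfl
  have h2 : f PowerSeries.X = seriesToSheet M L PowerSeries.X := by
    change _ = algebraMap (LaurentSeries (Frac M L)) (SheetField M L)
      (HahnSeries.ofPowerSeries ℤ (Frac M L) (PowerSeries.map (toFrac M L) PowerSeries.X))
    rw [PowerSeries.map_X]
    rfl
  rw [← h1, ← h2, ← Polynomial.eval_map, eval_map_comp_C] at h
  exact Polynomial.coe_injective _ (hf (h.trans (by rw [Polynomial.coe_zero, map_zero])))

theorem eval_polyGS_sheet (w : SheetField M L) :
    (polyGS (paramsSheet M L).g (paramsSheet M L).s).eval w =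
      (polyGS ((baseParams M L).map (toFrac M L)).g ((baseParams M L).map (toFrac M L)).s).eval₂
        (fracToSheet M L) w := by
  rw [← Polynomial.eval_map, polyGS_map]
  rfl

theorem eval_polySigma_sheet (w : SheetField M L) :
    (polySigma (paramsSheet M L).g (paramsSheet M L).s).eval w =
      (polySigma ((baseParams M L).map (toFrac M L)).g ((baseParams M L).map (toFrac M L)).s).eval₂
        (fracToSheet M L) w := by
  rw [← Polynomial.eval_map, polySigma_map]
  rfl

theorem classical_map_seriesToSheet :
    (baseParams M L).classical.map ((seriesToSheet M L).comp PowerSeries.C) =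
      { paramsSheet M L with γ := 1 } := by
  simp [Params.map, Params.classical, baseParams, paramsSheet, seriesToSheet_C]

theorem seriesToSheet_X_ne_zero : seriesToSheet M L PowerSeries.X ≠ 0 :=
  (map_ne_zero_iff _ seriesToSheet_injective).2 PowerSeries.X_ne_zero

theorem gamma_sheet_ne_zero : (paramsSheet M L).γ ≠ 0 := by
  change fracToSheet M L _ ≠ 0
  rw [map_ne_zero_iff _ (fracToSheet M L).injective,
    map_ne_zero_iff _ (IsFractionRing.injective (Polynomial (Ks M L)) (Frac M L))]
  exact Polynomial.X_ne_zero

/-- The equation `X(w) = X(z)` as an equation between polynomials. -/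
theorem curveX_eq_iff (w : SheetField M L) :
    curveX (paramsSheet M L) w = curveX (paramsSheet M L) (seriesToSheet M L PowerSeries.X) ↔
      w * (polyGS (paramsSheet M L).g (paramsSheet M L).s).eval (seriesToSheet M L PowerSeries.X) =
        seriesToSheet M L PowerSeries.X * (polyGS (paramsSheet M L).g (paramsSheet M L).s).eval w := by
  have hγ := gamma_sheet_ne_zero (M := M) (L := L)
  have hz := seriesToSheet_X_ne_zero (M := M) (L := L)
  have hcz : (polyGS (paramsSheet M L).g (paramsSheet M L).s).eval
      (seriesToSheet M L PowerSeries.X) ≠ 0 := by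
    rw [eval_polyGS_sheet]
    exact (curve_eval_ne_zero _ _ eq_zero_of_eval₂_eq_zero _ rfl).2
  have key : (polyGS (paramsSheet M L).g (paramsSheet M L).s).eval w ≠ 0 →
      (curveX (paramsSheet M L) w = curveX (paramsSheet M L) (seriesToSheet M L PowerSeries.X) ↔
      w * (polyGS (paramsSheet M L).g (paramsSheet M L).s).eval (seriesToSheet M L PowerSeries.X) =
        seriesToSheet M L PowerSeries.X *
          (polyGS (paramsSheet M L).g (paramsSheet M L).s).eval w) := by
    intro hc
    rw [curveX, curveX, div_eq_div_iff (mul_ne_zero hγ hc) (mul_ne_zero hγ hcz),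
      mul_left_comm, mul_left_comm (seriesToSheet M L PowerSeries.X), mul_right_inj' hγ]
  constructor
  · intro h
    -- If c(w) vanished, the convention a/0 = 0 would give X(w) = 0, whereas X(z) ≠ 0.
    refine (key fun hc => ?_).1 h
    rw [curveX, curveX, hc, mul_zero, div_zero] at h
    exact div_ne_zero hz (mul_ne_zero hγ hcz) h.symm
  · intro h
    refine (key ?_).2 h
    rw [eval_polyGS_sheet, eval_polyGS_sheet] at h
    rw [eval_polyGS_sheet]
    exact (curve_eval_ne_zero _ _ eq_zero_of_eval₂_eq_zero _ h).2

theorem exists_isSheets (hM : 2 ≤ M) (hL : 1 ≤ L) :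
    ∃ ζ : Fin (L * M) → SheetField M L, IsSheets ζ := by
  have hLM : 1 < L * M := by nlinarith
  have hdeg := natDegree_polyGS ((baseParams M L).map (toFrac M L)) (by omega) (by omega)
    ((map_ne_zero_iff _ toFrac_injective).2
      ((map_ne_zero_iff _ (MvPolynomial.C_injective _ _)).2 (MvPolynomial.X_ne_zero _)))
    ((map_ne_zero_iff _ toFrac_injective).2 (MvPolynomial.X_ne_zero _))
  obtain ⟨ζ, h1, h2, h3⟩ := exists_sheets (fracToSheet M L) (seriesToSheet M L PowerSeries.X)
    eq_zero_of_eval₂_eq_zero _ hLM hdeg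
  refine ⟨ζ, h1, h2, fun i => ?_⟩
  rw [curveX_eq_iff, eval_polyGS_sheet, eval_polyGS_sheet]
  exact h3 i

theorem IsSheets.sameFiber {ζ : Fin (L * M) → SheetField M L} (h : IsSheets ζ) :
    SameFiber ((baseParams M L).classical.map ((seriesToSheet M L).comp PowerSeries.C)) ζ := by
  rw [classical_map_seriesToSheet]
  have h1 := fun i => (curveX_eq_iff (ζ i)).1 (h.curve i)
  have h2 : ∀ i, _ := fun i => by
    have := h1 i
    rw [eval_polyGS_sheet, eval_polyGS_sheet] at this
    exact this
  refine ⟨h.injective, rfl, fun i => (curve_eval_ne_zero _ _ eq_zero_of_eval₂_eq_zero _ (h2 i)).1,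
    fun i j => ?_, fun i => ?_, fun i => ?_⟩
  · refine mul_left_cancel₀ seriesToSheet_X_ne_zero ?_
    linear_combination ζ j * h1 i - ζ i * h1 j
  · change (polyGS (paramsSheet M L).g (paramsSheet M L).s).eval _ ≠ 0
    rw [eval_polyGS_sheet]
    exact (curve_eval_ne_zero _ _ eq_zero_of_eval₂_eq_zero _ (h2 i)).2
  · change (polySigma (paramsSheet M L).g (paramsSheet M L).s).eval _ ≠ 0
    rw [eval_polySigma_sheet]
    exact sigma_eval_ne_zero _ _ eq_zero_of_eval₂_eq_zero _ (h2 i)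

/-- The determinant is already nonzero at β = 0, by the diagonalisation on the sheets. -/
theorem IsSheets.det_ne_zero {ζ : Fin (L * M) → SheetField M L} (h : IsSheets ζ)
    (hLM : 0 < L * M) (b : PowerSeries (Ks M L)) :
    (matA (betaParams (baseParams M L) b)).det ≠ 0 := by
  intro h0
  refine h.sameFiber.det_matA_ne_zero hLM ?_
  rw [← betaParams_map _ b, matA_map, matA_map]
  have h1 := RingHom.map_det PowerSeries.constantCoeff (matA (betaParams (baseParams M L) b))
  have h2 := RingHom.map_det ((seriesToSheet M L).comp PowerSeries.C)
    ((matA (betaParams (baseParams M L) b)).map PowerSeries.constantCoeff)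
  rw [h0, map_zero] at h1
  refine h2.symm.trans ?_
  refine (congrArg _ h1.symm).trans (map_zero _)

end

/-! ### The differential equation over Laurent series -/

section

variable {R F : Type*} [CommRing R] [Field F] {M L : ℕ}

theorem neg_commutator_iff {k n : Type*} [CommRing k] [Fintype n] (b c : k)
    (W' N W : Matrix n n k) :
    (b * c) • W' = -N * W - W * -N ↔ (-b * c) • W' = N * W - W * N := by
  rw [neg_mul b c, neg_smul, neg_eq_iff_eq_neg, neg_sub, Matrix.neg_mul, Matrix.mul_neg,
    sub_neg_eq_add, neg_add_eq_sub]

/-- The differential equation of the WKB matrix over Laurent series in `z` is equivalent to the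
equation without denominators. -/
theorem ode_laurent_iff_isFlat (f : R →+* F) (hf : Function.Injective f) (d : Params R M L)
    (hdet : (matA d).det ≠ 0) (γ : F) (hγ : γ ≠ 0) (P : Params (LaurentSeries F) M L)
    (hP : P = ({ d.map f with γ := γ } : Params F M L).map HahnSeries.C)
    (z : LaurentSeries F) (hz : z = HahnSeries.single 1 1)
    (W : Matrix (Fin (L * M)) (Fin (L * M)) (PowerSeries R)) :
    (P.β * (z * (polyGS P.g P.s).eval z / (polySigma P.g P.s).eval z)) •
      W.map (fun x => (HahnSeries.ofPowerSeries ℤ F).comp (PowerSeries.map f)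
        (PowerSeries.derivative R x)) =
      matE P (curveX P z) * W.map ((HahnSeries.ofPowerSeries ℤ F).comp (PowerSeries.map f)) -
        W.map ((HahnSeries.ofPowerSeries ℤ F).comp (PowerSeries.map f)) * matE P (curveX P z) ↔
      IsFlat d W := by
  have hX : (HahnSeries.ofPowerSeries ℤ F).comp (PowerSeries.map f) PowerSeries.X = z := by
    rw [RingHom.comp_apply, PowerSeries.map_X, HahnSeries.ofPowerSeries_X, hz]
  have hC : ∀ r, (HahnSeries.ofPowerSeries ℤ F).comp (PowerSeries.map f) (PowerSeries.C r) =
      HahnSeries.C (f r) := fun r => by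
    rw [RingHom.comp_apply, PowerSeries.map_C, HahnSeries.ofPowerSeries_C]
  subst hP
  have h := ode_iff_isFlat (J := (HahnSeries.ofPowerSeries ℤ F).comp (PowerSeries.map f))
    (ofPowerSeries_comp_map_injective hf) hdet
    (P := ({ d.map f with γ := γ } : Params F M L).map HahnSeries.C)
    (funext fun i => (hC _).symm) (funext fun i => (hC _).symm) (hC _).symm
    ((map_ne_zero_iff _ HahnSeries.C_injective).2 hγ)
    (by rw [hX, hz]; exact HahnSeries.single_ne_zero one_ne_zero) W
  rwa [hX] at h

theorem neg_ode_laurent_iff_isFlat (f : R →+* F) (hf : Function.Injective f) (d : Params R M L)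
    (hdet : (matA d.neg).det ≠ 0) (γ : F) (hγ : γ ≠ 0) (P : Params (LaurentSeries F) M L)
    (hP : P = ({ d.map f with γ := γ } : Params F M L).map HahnSeries.C)
    (z : LaurentSeries F) (hz : z = HahnSeries.single 1 1)
    (W : Matrix (Fin (L * M)) (Fin (L * M)) (PowerSeries R)) :
    (P.β * (z * (polyGS P.g P.s).eval z / (polySigma P.g P.s).eval z)) •
      W.map (fun x => (HahnSeries.ofPowerSeries ℤ F).comp (PowerSeries.map f)
        (PowerSeries.derivative R x)) =
      -matE' P (curveX P z) * W.map ((HahnSeries.ofPowerSeries ℤ F).comp (PowerSeries.map f)) -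
        W.map ((HahnSeries.ofPowerSeries ℤ F).comp (PowerSeries.map f)) * -matE' P (curveX P z) ↔
      IsFlat d.neg W := by
  have hP' : P.neg = ({ d.neg.map f with γ := γ } : Params F M L).map HahnSeries.C := by
    rw [hP]
    simp [Params.neg, Params.map]
  rw [← ode_laurent_iff_isFlat f hf d.neg hdet γ hγ P.neg hP' z hz, matE'_eq]
  exact neg_commutator_iff _ _ _ _ _

end

/-! ### The WKB solution -/

section

variable {M L : ℕ}

/-- The parameters `g`, `s`, `β b` as Laurent series, with `γ` an indeterminate. -/
def laurentParams (b : PowerSeries (Ks M L)) : Params (BetaField M L) M L :=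
  { (betaParams (baseParams M L) b).map (toBetaField M L) with γ := (params M L).γ }

theorem laurentParams_one : laurentParams 1 = params M L := by
  simp [laurentParams, betaParams, Params.map, baseParams, params, toBetaField_C, toBetaField_X]

theorem paramsZ_eq : paramsZ M L = (laurentParams 1).map HahnSeries.C := by
  rw [laurentParams_one, paramsZ]

theorem laurentParams_neg_one : laurentParams (-1) = (params M L).neg := by
  rw [laurentParams, ← betaParams_neg, Params.map_neg, ← laurentParams_one]
  rfl

theorem isFlat_wkbMat {b : PowerSeries (Ks M L)} (hb : b ≠ 0) (hLM : L < L * M) :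
    IsFlat (betaParams (baseParams M L) b) (wkbMat (betaParams (baseParams M L) b)) := by
  refine IsFlat.of_map (f := toBetaField M L) toBetaField_injective ?_
  have h : (wkbMat (betaParams (baseParams M L) b)).map (PowerSeries.map (toBetaField M L)) =
      wkbMat ((betaParams (baseParams M L) b).map (toBetaField M L)) :=
    Matrix.ext fun i j =>
      map_wkbMat (toBetaField M L) (betaParams (baseParams M L) b) (by omega) i j
  rw [h]
  refine isFlat_wkbMat_of_field _ ?_ ?_ hLM
  · change toBetaField M L (PowerSeries.C 1) ≠ 0
    rw [map_one, map_one]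
    exact one_ne_zero
  · exact (map_ne_zero_iff _ toBetaField_injective).2 (mul_ne_zero PowerSeries.X_ne_zero hb)

theorem matMPlus_laurentParams {b : PowerSeries (Ks M L)} (hb : b ≠ 0) (hLM : L < L * M)
    (n : ℕ) (i j : Fin (L * M)) :
    PowerSeries.map (toFrac M L) (betaCoeff n (wkbMat (betaParams (baseParams M L) b) i j)) =
      betaCoeffLaurent n
        ((matMPlus (laurentParams b) i j).subst (curveXSeries (laurentParams b))) := by
  have hβ : (laurentParams b).β ≠ 0 :=
    (map_ne_zero_iff _ toBetaField_injective).2 (mul_ne_zero PowerSeries.X_ne_zero hb)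
  -- `wkbMat` does not contain γ, so the indeterminate γ of the Laurent parameters may be dropped.
  have h : wkbMat (laurentParams b) i j =
      wkbMat ((betaParams (baseParams M L) b).map (toBetaField M L)) i j := rfl
  have hγ : (laurentParams b).γ ≠ 0 := gamma_ne_zero
  rw [matMPlus_subst _ hγ hβ hLM, h, ← map_wkbMat _ _ (by omega)]
  ext m
  rw [PowerSeries.coeff_map, betaCoeff, PowerSeries.coeff_mk, betaCoeffLaurent,
    PowerSeries.coeff_mk, PowerSeries.coeff_map, toBetaField, RingHom.comp_apply,
    HahnSeries.ofPowerSeries_apply_coeff, PowerSeries.coeff_map]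

theorem matMMinus_eq {k : Type*} [Field k] [Algebra ℚ k] (d : Params k M L) (hγ : d.γ ≠ 0) :
    matMMinus d = matMPlus d.neg := by
  have h1 : ∀ m, psiMinus d m = psiPlus d.neg m := psiMinus_eq d hγ
  have h2 : ∀ m, psiPlus d m = psiMinus d.neg m := fun m => by
    rw [psiMinus_eq d.neg hγ, Params.neg_neg]
  rw [matMMinus, matMPlus, matA_neg]
  simp only [h1, h2]
  rfl

theorem matV_mul_matF_mul {ζ : Fin (L * M) → SheetField M L} (hLM : 0 < L * M) :
    matV ζ * matF M L * (matV ζ)⁻¹ = (Matrix.vandermonde ζ).transpose *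
      Matrix.diagonal (fun i => if i = ⟨0, hLM⟩ then 1 else 0) *
        (Matrix.vandermonde ζ).transpose⁻¹ := by
  have h1 : matV ζ = (Matrix.vandermonde ζ).transpose := rfl
  have h2 : matF M L = Matrix.diagonal (fun i => if i = ⟨0, hLM⟩ then 1 else 0) := by
    rw [matF]
    congr 1
    funext i
    simp only [Fin.ext_iff]
  rw [h1, h2]

theorem IsSheets.leading {ζ : Fin (L * M) → SheetField M L} (hζ : IsSheets ζ) (hLM : 0 < L * M)
    (b : PowerSeries (Ks M L)) :
    (wkbMat (betaParams (baseParams M L) b)).map (fun x => seriesToSheet M L (betaCoeff 0 x)) =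
      matV ζ * matF M L * (matV ζ)⁻¹ :=
  (wkbMat_leading hζ.sameFiber ⟨0, hLM⟩ (hζ.zero _ rfl) b).trans (matV_mul_matF_mul hLM).symm

/-- Common to both pairs: `b` is 1 for E and -1 for -E', and `hN` is the only place where the
connection enters. -/
theorem isWKBSolution_iff {ζ : Fin (L * M) → SheetField M L} (hζ : IsSheets ζ) (hLM : L < L * M)
    {b : PowerSeries (Ks M L)} (hb : b ≠ 0)
    {N : Matrix (Fin (L * M)) (Fin (L * M)) (ZBetaField M L)}
    (hN : ∀ W : Matrix (Fin (L * M)) (Fin (L * M)) (ZBeta M L),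
      ((paramsZ M L).β * (zVar M L * (polyGS (paramsZ M L).g (paramsZ M L).s).eval (zVar M L) /
          (polySigma (paramsZ M L).g (paramsZ M L).s).eval (zVar M L))) •
        W.map (fun f => toZBetaField M L (PowerSeries.derivative (PowerSeries (Ks M L)) f)) =
      N * W.map (toZBetaField M L) - W.map (toZBetaField M L) * N ↔
        IsFlat (betaParams (baseParams M L) b) W)
    (W : Matrix (Fin (L * M)) (Fin (L * M)) (ZBeta M L)) :
    IsWKBSolution ζ N W ↔ W = wkbMat (betaParams (baseParams M L) b) := by
  have hLM' : 0 < L * M := by omega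
  constructor
  · intro h
    exact eq_of_isFlat seriesToSheet_injective hζ.sameFiber hLM ⟨0, hLM'⟩ (hζ.zero _ rfl)
      ((hN W).1 h.ode) (isFlat_wkbMat hb hLM) h.idempotent (wkbMat_mul_self _ hLM')
      (h.leading.trans (matV_mul_matF_mul hLM'))
      (wkbMat_leading hζ.sameFiber _ (hζ.zero _ rfl) b)
  · rintro rfl
    exact ⟨wkbMat_mul_self _ hLM', rank_wkbMat _ hLM', (hN _).2 (isFlat_wkbMat hb hLM),
      hζ.leading hLM' b⟩

theorem isWKBSolution_plus_iff {ζ : Fin (L * M) → SheetField M L} (hζ : IsSheets ζ)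
    (hLM : L < L * M) (W : Matrix (Fin (L * M)) (Fin (L * M)) (ZBeta M L)) :
    IsWKBSolution ζ (matE (paramsZ M L) (curveX (paramsZ M L) (zVar M L))) W ↔
      W = wkbMat (betaParams (baseParams M L) 1) :=
  isWKBSolution_iff hζ hLM one_ne_zero (ode_laurent_iff_isFlat (toBetaField M L)
    toBetaField_injective (betaParams (baseParams M L) 1) (hζ.det_ne_zero (by omega) 1)
    (params M L).γ gamma_ne_zero (paramsZ M L)
    paramsZ_eq (zVar M L) rfl) W

theorem isWKBSolution_minus_iff {ζ : Fin (L * M) → SheetField M L} (hζ : IsSheets ζ)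
    (hLM : L < L * M) (W : Matrix (Fin (L * M)) (Fin (L * M)) (ZBeta M L)) :
    IsWKBSolution ζ (-matE' (paramsZ M L) (curveX (paramsZ M L) (zVar M L))) W ↔
      W = wkbMat (betaParams (baseParams M L) (-1)) := by
  have h := neg_ode_laurent_iff_isFlat (toBetaField M L) toBetaField_injective
    (betaParams (baseParams M L) 1)
    (by rw [betaParams_neg]; exact hζ.det_ne_zero (by omega) (-1))
    (params M L).γ gamma_ne_zero (paramsZ M L)
    paramsZ_eq (zVar M L) rfl
  rw [betaParams_neg] at h
  exact isWKBSolution_iff hζ hLM (neg_ne_zero.2 one_ne_zero) h W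

end

end

end WKBAdjoint

/-! ### The theorem for both pairs. -/

open WKBAdjoint in
theorem mainTheorem5 (M L : ℕ) (hM : 2 ≤ M) (hL : 1 ≤ L) :
    (∃ ζ : Fin (L * M) → SheetField M L, IsSheets ζ) ∧
    ∀ ζ : Fin (L * M) → SheetField M L, IsSheets ζ →
      ((∃! W : Matrix (Fin (L * M)) (Fin (L * M)) (ZBeta M L),
          IsWKBSolution ζ (matE (paramsZ M L) (curveX (paramsZ M L) (zVar M L))) W) ∧
        ∀ W : Matrix (Fin (L * M)) (Fin (L * M)) (ZBeta M L),
          IsWKBSolution ζ (matE (paramsZ M L) (curveX (paramsZ M L) (zVar M L))) W →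
          ∀ (n : ℕ) (i j : Fin (L * M)),
            RationalPolesAtRamification (betaCoeff n (W i j)) ∧
            PowerSeries.map (toFrac M L) (betaCoeff n (W i j)) =
              betaCoeffLaurent n (atCurve (matMPlus (params M L)) i j)) ∧
      ((∃! W : Matrix (Fin (L * M)) (Fin (L * M)) (ZBeta M L),
          IsWKBSolution ζ (-matE' (paramsZ M L) (curveX (paramsZ M L) (zVar M L))) W) ∧
        ∀ W : Matrix (Fin (L * M)) (Fin (L * M)) (ZBeta M L),
          IsWKBSolution ζ (-matE' (paramsZ M L) (curveX (paramsZ M L) (zVar M L))) W →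
          ∀ (n : ℕ) (i j : Fin (L * M)),
            RationalPolesAtRamification (betaCoeff n (W i j)) ∧
            PowerSeries.map (toFrac M L) (betaCoeff n (W i j)) =
              betaCoeffLaurent n (atCurve (matMMinus (params M L)) i j)) := by
  refine ⟨exists_isSheets hM hL, fun ζ hζ => ?_⟩
  have hLM : L < L * M := by nlinarith
  have hp := isWKBSolution_plus_iff hζ hLM
  have hm := isWKBSolution_minus_iff hζ hLM
  refine ⟨⟨⟨_, (hp _).2 rfl, fun W hW => (hp W).1 hW⟩, fun W hW n i j => ?_⟩,
    ⟨⟨_, (hm _).2 rfl, fun W hW => (hm W).1 hW⟩, fun W hW n i j => ?_⟩⟩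
  · rw [(hp W).1 hW]
    refine ⟨wkbMat_mem_bRing (baseParams M L) 1 (by omega) i j n, ?_⟩
    rw [matMPlus_laurentParams one_ne_zero hLM, laurentParams_one]
    rfl
  · rw [(hm W).1 hW]
    refine ⟨wkbMat_mem_bRing (baseParams M L) (-1) (by omega) i j n, ?_⟩
    rw [matMPlus_laurentParams (neg_ne_zero.2 one_ne_zero) hLM, laurentParams_neg_one,
      ← matMMinus_eq (params M L) gamma_ne_zero]
    rfl
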